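/- All Hilbert spaces are real. For a finite-dimensional Euclidean space $W$ let $Cl(W)$ be the complex Clifford $C^*$-algebra generated by self-adjoint elements $w\in W$ (linear in $w$) with $w^2=\|w\|^2$, graded by parity; an isometry $W\to W_1$ induces a $*$-homomorphism $Cl(W)\to Cl(W_1)$. $C_0(\mathbb R)$ is graded by even and odd functions, $X$ is the unbounded multiplier $X(t)=t$ of it, and $\hat\otimes$ is the graded tensor product. Let $l:H'\to H$ be a bounded linear isomorphism of Hilbert spaces, and let $\bar l=l\,(l^*l)^{-1/2}$ be the unitary of its polar decomposition. Assume that $l$ is asymptotically unitary: for every $\epsilon>0$ there is a finite-dimensional subspace $V\subset H'$ with $\|(l-\bar l)|_{V^\perp}\|<\epsilon$. For a finite-dimensional subspace $E\subset H'$ put $\bar E=\bar l^*(l(E))$; the map $C_l=\bar l^*l:E\to\bar E\subset Cl(\bar E)$ is the induced Clifford operator. Put $$S\mathfrak C(E)=C_0(\mathbb R)\hat\otimes C_0(E,Cl(E)),\qquad S\mathfrak C_l(E)=C_0(\mathbb R)\hat\otimes C_0(E,Cl(\bar E)).$$ For finite-dimensional subspaces $E_a\subset E_b$ of $H'$ let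 $E_{ba}=E_b\cap E_a^\perp$. (i) The Bott map $\beta_{ba}:S\mathfrak C(E_a)\to S\mathfrak C(E_b)$ is $f\hat\otimes u\mapsto f(X\hat\otimes1+1\hat\otimes C)\hat\otimes u$, where $C:E_{ba}\to Cl(E_{ba})$ is the inclusion and $S\mathfrak C(E_{ba})\hat\otimes C_0(E_a,Cl(E_a))=S\mathfrak C(E_b)$. (ii) Let $\hat E_{ba}$ be the orthogonal complement of $\bar E_a$ in $\bar E_b$. The orthogonal projection $\overline{E_{ba}}\to\hat E_{ba}$ is an isomorphism, and the unitary of its polar decomposition induces $$I_{ba}:S\mathfrak C_l(E_{ba})\hat\otimes C_0(E_a,Cl(\bar E_a))\cong S\mathfrak C_l(E_b).$$ Let $\beta^l_{ba}:S\mathfrak C_l(E_a)\to S\mathfrak C_l(E_b)$ be $f\hat\otimes u\mapsto I_{ba}\bigl(f(X\hat\otimes1+1\hat\otimes C_l)\hat\otimes u\bigr)$. For a family of $*$-homomorphisms $\beta_{ba}:A_a\to A_b$ ($a\le b$) over a directed set, the direct limit $\varinjlim A_a$ is the closure of the $*$-algebra generated by the classes $\beta_a(v)$ of the nets $(\beta_{ba}(v))_{b\ge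 a}$, $v\in A_a$, in the $C^*$-algebra of bounded nets modulo nets which tend to $0$ in norm. Over all finite-dimensional subspaces of $H'$, put $S\mathfrak C(H')=\varinjlim_a S\mathfrak C(E_a)$, with respect to (i) and with canonical maps $\beta_a:S\mathfrak C(E_a)\to S\mathfrak C(H')$, and $S\mathfrak C_l(H')=\varinjlim_a S\mathfrak C_l(E_a)$, with respect to (ii) and with canonical maps $\beta^l_a:S\mathfrak C_l(E_a)\to S\mathfrak C_l(H')$. For each $a$ the orthogonal projection $\bar E_a\to E_a$ is an isomorphism; let $\mathbf{pr}_a$ be the unitary of its polar decomposition, and let $1\hat\otimes\mathbf{pr}_a:S\mathfrak C_l(E_a)\to S\mathfrak C(E_a)$ be the induced $*$-isomorphism. **Proposition.** There is a unique $*$-isomorphism $\mathbf{pr}:S\mathfrak C_l(H')\to S\mathfrak C(H')$ with the following property: every $x\in S\mathfrak C_l(H')$ is a limit $x=\lim_a\beta^l_a(x_a)$ of a net with $x_a\in S\mathfrak C_l(E_a)$, and for every such net $$\mathbf{pr}(x)=\lim_a\beta_a\bigl((1\hat\otimes\mathbf{pr}_a)(x_a)\bigr).$$ Moreover, suppose that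 a group $\Gamma$ acts linearly and isometrically on $H'$ and on $H$, and that $l$ is $\Gamma$-equivariant. Then the maps $f\hat\otimes u\mapsto f\hat\otimes\gamma u\gamma^{-1}$, where $(\gamma u\gamma^{-1})(v)=\gamma(u(\gamma^{-1}v))$, from $S\mathfrak C_l(E_a)$ to $S\mathfrak C_l(\gamma E_a)$ and from $S\mathfrak C(E_a)$ to $S\mathfrak C(\gamma E_a)$, induce actions of $\Gamma$ by $*$-automorphisms on $S\mathfrak C_l(H')$ and $S\mathfrak C(H')$, and $\mathbf{pr}$ is $\Gamma$-equivariant. -/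

import Mathlib

open Filter Topology
open scoped TensorProduct ENNReal ZeroAtInfty BoundedContinuousFunction

namespace HilbertClifford

noncomputable section

/-! ## The complex Clifford algebra of a Euclidean space -/

section Clifford

variable (V : Type*) [NormedAddCommGroup V] [InnerProductSpace ℝ V]

/-- The quadratic form `v ↦ ‖v‖ ^ 2`. -/
def normForm : QuadraticForm ℝ V := LinearMap.BilinMap.toQuadraticMap (innerₗ V)

/-- The complex Clifford algebra `Cl(V)`, with the sign `v * v = ‖v‖ ^ 2`. -/
def Cl : Type _ := ℂ ⊗[ℝ] CliffordAlgebra (normForm V)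

instance : Ring (Cl V) := inferInstanceAs (Ring (ℂ ⊗[ℝ] CliffordAlgebra (normForm V)))

instance : Algebra ℂ (Cl V) := inferInstanceAs (Algebra ℂ (ℂ ⊗[ℝ] CliffordAlgebra (normForm V)))

variable {V}

lemma normForm_apply (v : V) : normForm V v = ‖v‖ ^ 2 := by
  simp [normForm, LinearMap.BilinMap.toQuadraticMap_apply]

namespace Cl

/-- The embedding `V → Cl(V)` (the Clifford operator). -/
def vec : V →ₗ[ℝ] Cl V where
  toFun v := (1 : ℂ) ⊗ₜ[ℝ] CliffordAlgebra.ι (normForm V) v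
  map_add' v w := by simp only [map_add, TensorProduct.tmul_add]; rfl
  map_smul' r v := by
    rw [map_smul, ← TensorProduct.smul_tmul, RingHom.id_apply]
    change _ = (r : ℂ) • ((1 : ℂ) ⊗ₜ[ℝ] CliffordAlgebra.ι (normForm V) v)
    rw [TensorProduct.smul_tmul']
    simp

lemma vec_mul_self (v : V) : vec v * vec v = algebraMap ℂ (Cl V) ((‖v‖ ^ 2 : ℝ) : ℂ) := by
  change ((1 : ℂ) ⊗ₜ[ℝ] CliffordAlgebra.ι (normForm V) v) *
    ((1 : ℂ) ⊗ₜ[ℝ] CliffordAlgebra.ι (normForm V) v) =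
      (((‖v‖ ^ 2 : ℝ) : ℂ) ⊗ₜ[ℝ] (1 : CliffordAlgebra (normForm V)))
  rw [Algebra.TensorProduct.tmul_mul_tmul, CliffordAlgebra.ι_sq_scalar, normForm_apply,
    Algebra.algebraMap_eq_smul_one, ← TensorProduct.smul_tmul]
  simp

lemma vec_mul_vec_of_inner_eq_zero {v w : V} (h : inner ℝ v w = 0) :
    vec v * vec w = -(vec w * vec v) := by
  have h1 := vec_mul_self (v + w)
  have h2 : ‖v + w‖ ^ 2 = ‖v‖ ^ 2 + ‖w‖ ^ 2 := by
    rw [norm_add_sq_real, h]; ring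
  rw [h2, Complex.ofReal_add, map_add (algebraMap ℂ (Cl V)), ← vec_mul_self, ← vec_mul_self,
    map_add] at h1
  have h3 : vec v * vec w + vec w * vec v = 0 := by
    have : (vec v + vec w) * (vec v + vec w) =
        vec v * vec v + vec w * vec w + (vec v * vec w + vec w * vec v) := by noncomm_ring
    rw [this] at h1
    simpa using h1
  exact eq_neg_of_add_eq_zero_left h3

lemma induction {P : Cl V → Prop} (scalar : ∀ z : ℂ, P (algebraMap ℂ (Cl V) z))
    (add : ∀ x y, P x → P y → P (x + y)) (vec_mul : ∀ v x, P x → P (vec v * x)) (x : Cl V) :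
    P x := by
  have key : ∀ a : CliffordAlgebra (normForm V), ∀ z : ℂ,
      P ((z ⊗ₜ[ℝ] a : ℂ ⊗[ℝ] CliffordAlgebra (normForm V))) := by
    intro a
    induction a using CliffordAlgebra.left_induction with
    | algebraMap r =>
      intro z
      have : (z ⊗ₜ[ℝ] (algebraMap ℝ (CliffordAlgebra (normForm V)) r) :
          ℂ ⊗[ℝ] CliffordAlgebra (normForm V)) = (r • z) ⊗ₜ[ℝ] 1 := by
        rw [Algebra.algebraMap_eq_smul_one, ← TensorProduct.smul_tmul]
      rw [this]
      exact scalar (r • z)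
    | add x y hx hy =>
      intro z
      rw [TensorProduct.tmul_add]
      exact add _ _ (hx z) (hy z)
    | ι_mul x m hx =>
      intro z
      have : (z ⊗ₜ[ℝ] (CliffordAlgebra.ι (normForm V) m * x) :
          ℂ ⊗[ℝ] CliffordAlgebra (normForm V)) =
          ((1 : ℂ) ⊗ₜ[ℝ] CliffordAlgebra.ι (normForm V) m) * (z ⊗ₜ[ℝ] x) := by
        rw [Algebra.TensorProduct.tmul_mul_tmul, one_mul]
      rw [this]
      exact vec_mul m _ (hx z)
  have h0 : P 0 := by simpa using scalar 0
  exact TensorProduct.induction_on (motive := fun y => P y) x h0 (fun z a => key a z)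
    (fun x y hx hy => add x y hx hy)

/-- The underlying additive map of the involution: complex conjugation on the scalars, reversal
of products of vectors. -/
def starAux : ℂ ⊗[ℝ] CliffordAlgebra (normForm V) →ₗ[ℝ] ℂ ⊗[ℝ] CliffordAlgebra (normForm V) :=
  TensorProduct.map Complex.conjAe.toLinearMap CliffordAlgebra.reverse

lemma starAux_mul (x y : ℂ ⊗[ℝ] CliffordAlgebra (normForm V)) :
    starAux (x * y) = starAux y * starAux x := by
  induction x using TensorProduct.induction_on with
  | zero => simp
  | add a b ha hb => rw [add_mul, map_add, ha, hb, map_add, mul_add]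
  | tmul z a =>
    induction y using TensorProduct.induction_on with
    | zero => simp
    | add c d hc hd => rw [mul_add, map_add, hc, hd, map_add, add_mul]
    | tmul w c =>
      simp [starAux, mul_comm]

lemma starAux_starAux (x : ℂ ⊗[ℝ] CliffordAlgebra (normForm V)) : starAux (starAux x) = x := by
  induction x using TensorProduct.induction_on with
  | zero => simp
  | add a b ha hb => rw [map_add, map_add, ha, hb]
  | tmul z a => simp [starAux]

/-- The involution of `Cl(V)`: conjugate-linear, anti-multiplicative, and the identity on `V`. -/
instance : StarRing (Cl V) where
  star x := starAux x
  star_involutive x := starAux_starAux x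
  star_mul x y := starAux_mul x y
  star_add x y := map_add starAux x y

lemma star_algebraMap (z : ℂ) :
    star (algebraMap ℂ (Cl V) z) = algebraMap ℂ (Cl V) (star z) := by
  change starAux (z ⊗ₜ[ℝ] (1 : CliffordAlgebra (normForm V))) = (star z) ⊗ₜ[ℝ] 1
  simp [starAux]

instance : StarModule ℂ (Cl V) where
  star_smul z x := by
    rw [Algebra.smul_def, star_mul, star_algebraMap, Algebra.smul_def, Algebra.commutes]

lemma star_vec (v : V) : star (vec v) = vec v := by
  change starAux ((1 : ℂ) ⊗ₜ[ℝ] CliffordAlgebra.ι (normForm V) v) = _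
  simp [starAux]
  rfl

instance [FiniteDimensional ℝ V] : Module.Finite ℂ (Cl V) := by
  have key : ∀ L : List V, ∃ M : Submodule ℝ (CliffordAlgebra (normForm V)), M.FG ∧ 1 ∈ M ∧
      ∀ e ∈ L, ∀ x ∈ M, CliffordAlgebra.ι (normForm V) e * x ∈ M := by
    intro L
    induction L with
    | nil =>
      exact ⟨Submodule.span ℝ {1}, Submodule.fg_span_singleton _,
        Submodule.mem_span_singleton_self _, by simp⟩
    | cons e L ih =>
      obtain ⟨M, hM, h1, hmul⟩ := ih
      let f := LinearMap.mulLeft ℝ (CliffordAlgebra.ι (normForm V) e)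
      refine ⟨M ⊔ M.map f, hM.sup (hM.map f), Submodule.mem_sup_left h1, ?_⟩
      intro e' he' x hx
      obtain ⟨m, hm, _, ⟨n, hn, rfl⟩, rfl⟩ := Submodule.mem_sup.1 hx
      rw [mul_add]
      rcases List.mem_cons.1 he' with rfl | he'
      · refine Submodule.add_mem _ (Submodule.mem_sup_right ⟨m, hm, rfl⟩) ?_
        refine Submodule.mem_sup_left ?_
        change CliffordAlgebra.ι (normForm V) e' * (CliffordAlgebra.ι (normForm V) e' * n) ∈ M
        rw [← mul_assoc, CliffordAlgebra.ι_sq_scalar, ← Algebra.smul_def]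
        exact M.smul_mem _ hn
      · refine Submodule.add_mem _ (Submodule.mem_sup_left (hmul _ he' _ hm)) ?_
        change CliffordAlgebra.ι (normForm V) e' * (CliffordAlgebra.ι (normForm V) e * n) ∈ _
        have h := CliffordAlgebra.ι_mul_ι_add_swap (Q := normForm V) e' e
        have h2 : CliffordAlgebra.ι (normForm V) e' * (CliffordAlgebra.ι (normForm V) e * n) =
            QuadraticMap.polar (normForm V) e' e • n -
              f (CliffordAlgebra.ι (normForm V) e' * n) := by
          rw [Algebra.smul_def, ← h]
          change _ = _ - CliffordAlgebra.ι (normForm V) e * (CliffordAlgebra.ι (normForm V) e' * n)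
          noncomm_ring
        rw [h2]
        exact Submodule.sub_mem _ (Submodule.mem_sup_left (M.smul_mem _ hn))
          (Submodule.mem_sup_right ⟨_, hmul _ he' _ hn, rfl⟩)
  have hfin : Module.Finite ℝ (CliffordAlgebra (normForm V)) := by
    let b := Module.finBasis ℝ V
    obtain ⟨M, hM, h1, hmul⟩ := key (List.ofFn b)
    have hv : ∀ v : V, ∀ x ∈ M, CliffordAlgebra.ι (normForm V) v * x ∈ M := by
      intro v x hx
      rw [← b.sum_repr v, map_sum, Finset.sum_mul]
      refine Submodule.sum_mem _ fun i _ => ?_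
      rw [map_smul, smul_mul_assoc]
      exact M.smul_mem _ (hmul _ (by simp) _ hx)
    refine ⟨?_⟩
    convert! hM
    refine (eq_top_iff.2 fun x _ => ?_).symm
    induction x using CliffordAlgebra.left_induction with
    | algebraMap r => rw [Algebra.algebraMap_eq_smul_one]; exact M.smul_mem _ h1
    | add x y hx hy => exact M.add_mem (hx trivial) (hy trivial)
    | ι_mul x m hx => exact hv _ _ (hx trivial)
  exact inferInstanceAs (Module.Finite ℂ (ℂ ⊗[ℝ] CliffordAlgebra (normForm V)))

variable (V) in
/-- The finite-dimensional `*`-representations of `Cl(V)`. -/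
abbrev Rep : Type _ :=
  Σ n : ℕ, (Cl V →⋆ₐ[ℂ] (EuclideanSpace ℂ (Fin n) →L[ℂ] EuclideanSpace ℂ (Fin n)))

lemma norm_rep_vec_le (r : Rep V) (v : V) : ‖r.2 (vec v)‖ ≤ ‖v‖ := by
  have h : ‖r.2 (vec v)‖ * ‖r.2 (vec v)‖ ≤ ‖v‖ * ‖v‖ := by
    rw [← CStarRing.norm_star_mul_self, ← map_star, star_vec, ← map_mul, vec_mul_self,
      AlgHomClass.commutes, Algebra.algebraMap_eq_smul_one]
    refine (norm_smul_le _ _).trans ?_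
    have h1 : ‖(1 : EuclideanSpace ℂ (Fin r.1) →L[ℂ] EuclideanSpace ℂ (Fin r.1))‖ ≤ 1 :=
      ContinuousLinearMap.norm_id_le
    have h2 : ‖((‖v‖ ^ 2 : ℝ) : ℂ)‖ = ‖v‖ * ‖v‖ := by
      rw [Complex.norm_real, norm_pow, norm_norm, sq]
    rw [h2]
    exact mul_le_of_le_one_right (by positivity) h1
  nlinarith [norm_nonneg (r.2 (vec v)), norm_nonneg v]

lemma norm_rep_smul (r : Rep V) (a : ℂ) (x : Cl V) : ‖r.2 (a • x)‖ = ‖a‖ * ‖r.2 x‖ := by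
  rw [map_smul r.2 a x, norm_smul]

lemma exists_norm_rep_le (x : Cl V) : ∃ C : ℝ, ∀ r : Rep V, ‖r.2 x‖ ≤ C := by
  induction x using Cl.induction with
  | scalar z =>
    refine ⟨‖z‖, fun r => ?_⟩
    rw [AlgHomClass.commutes, Algebra.algebraMap_eq_smul_one]
    refine (norm_smul_le _ _).trans ?_
    have h1 : ‖(1 : EuclideanSpace ℂ (Fin r.1) →L[ℂ] EuclideanSpace ℂ (Fin r.1))‖ ≤ 1 :=
      ContinuousLinearMap.norm_id_le
    exact mul_le_of_le_one_right (norm_nonneg _) h1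
  | add x y hx hy =>
    obtain ⟨C, hC⟩ := hx
    obtain ⟨D, hD⟩ := hy
    refine ⟨C + D, fun r => ?_⟩
    rw [map_add]
    exact (norm_add_le _ _).trans (add_le_add (hC r) (hD r))
  | vec_mul v x hx =>
    obtain ⟨C, hC⟩ := hx
    refine ⟨‖v‖ * C, fun r => ?_⟩
    rw [map_mul]
    exact (norm_mul_le _ _).trans (mul_le_mul (norm_rep_vec_le r v) (hC r) (norm_nonneg _)
      (norm_nonneg _))

lemma bddAbove_norm_rep (x : Cl V) : BddAbove (Set.range fun r : Rep V => ‖r.2 x‖) := by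
  obtain ⟨C, hC⟩ := exists_norm_rep_le x
  exact ⟨C, by rintro _ ⟨r, rfl⟩; exact hC r⟩

/-- A sesquilinear form on `Cl(V)`, averaged over the products of the vectors of a list. -/
def form (φ : Cl V → Cl V → ℂ) : List V → Cl V → Cl V → ℂ
  | [] => φ
  | e :: L => fun x y => form φ L x y + form φ L (vec e * x) (vec e * y)

lemma form_invariant (φ : Cl V → Cl V → ℂ)
    (hneg : ∀ x y, φ (-x) (-y) = φ x y)
    (L : List V) (hL : ∀ e ∈ L, ‖e‖ = 1) (hp : L.Pairwise fun e f => inner ℝ e f = 0) :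
    (∀ x y, form φ L (-x) (-y) = form φ L x y) ∧
      ∀ e ∈ L, ∀ x y, form φ L (vec e * x) (vec e * y) = form φ L x y := by
  induction L with
  | nil => exact ⟨hneg, by simp⟩
  | cons e L ih =>
    obtain ⟨ih1, ih2⟩ := ih (fun f hf => hL f (List.mem_cons_of_mem _ hf)) hp.of_cons
    refine ⟨fun x y => ?_, fun f hf x y => ?_⟩
    · simp only [form, mul_neg, ih1]
    · have hee : ∀ x : Cl V, vec e * (vec e * x) = x := fun x => by
        rw [← mul_assoc, vec_mul_self, hL e (by simp)]
        simp
      rcases List.mem_cons.1 hf with rfl | hf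
      · simp only [form, hee]
        exact add_comm _ _
      · have h0 : inner ℝ e f = 0 := List.rel_of_pairwise_cons hp hf
        have hef : ∀ x : Cl V, vec e * (vec f * x) = -(vec f * (vec e * x)) := fun x => by
          rw [← mul_assoc, vec_mul_vec_of_inner_eq_zero h0, neg_mul, mul_assoc]
        simp only [form, hef, ih1, ih2 f hf]

open scoped ComplexConjugate in
lemma exists_core [FiniteDimensional ℝ V] : ∃ c : InnerProductSpace.Core ℂ (Cl V),
    ∀ x y z : Cl V, c.inner (x * y) z = c.inner y (star x * z) := by
  classical
  let b := Module.finBasis ℂ (Cl V)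
  let φ : Cl V → Cl V → ℂ := fun x y => ∑ i, conj (b.equivFun x i) * b.equivFun y i
  have hφadd : ∀ x y z, φ (x + y) z = φ x z + φ y z := fun x y z => by
    simp only [φ, map_add, Pi.add_apply, add_mul, Finset.sum_add_distrib]
  have hφsmul : ∀ (a : ℂ) x z, φ (a • x) z = conj a * φ x z := fun a x z => by
    simp only [φ, map_smul, Pi.smul_apply, smul_eq_mul, map_mul, mul_assoc, Finset.mul_sum]
  have hφconj : ∀ x y, conj (φ y x) = φ x y := fun x y => by
    simp only [φ, map_sum, map_mul, Complex.conj_conj, mul_comm]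
  have hφself : ∀ x, φ x x = ((∑ i, Complex.normSq (b.equivFun x i) : ℝ) : ℂ) := fun x => by
    simp only [φ, Complex.ofReal_sum, Complex.normSq_eq_conj_mul_self]
  let B : List V → Cl V → Cl V → ℂ := form φ
  have hadd : ∀ L x y z, B L (x + y) z = B L x z + B L y z := by
    intro L
    induction L with
    | nil => exact hφadd
    | cons e L ih =>
      intro x y z
      simp only [B, form, mul_add] at ih ⊢
      rw [ih, ih]; ring
  have hsmul : ∀ L (a : ℂ) x z, B L (a • x) z = conj a * B L x z := by
    intro L
    induction L with
    | nil => exact hφsmul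
    | cons e L ih =>
      intro a x z
      simp only [B, form, mul_smul_comm] at ih ⊢
      rw [ih, ih]; ring
  have hconj : ∀ L x y, conj (B L y x) = B L x y := by
    intro L
    induction L with
    | nil => exact hφconj
    | cons e L ih =>
      intro x y
      simp only [B, form, map_add] at ih ⊢
      rw [ih, ih]
  have hnonneg : ∀ L x, 0 ≤ (B L x x).re := by
    intro L
    induction L with
    | nil =>
      intro x
      simp only [B, form, hφself, Complex.ofReal_re]
      exact Finset.sum_nonneg fun i _ => Complex.normSq_nonneg _
    | cons e L ih =>
      intro x
      simp only [B, form, Complex.add_re] at ih ⊢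
      exact add_nonneg (ih _) (ih _)
  have hdef : ∀ L x, (B L x x).re = 0 → x = 0 := by
    intro L
    induction L with
    | nil =>
      intro x hx
      simp only [B, form, hφself, Complex.ofReal_re] at hx
      rw [Finset.sum_eq_zero_iff_of_nonneg fun i _ => Complex.normSq_nonneg _] at hx
      apply b.equivFun.injective
      ext i
      simpa using hx i (Finset.mem_univ i)
    | cons e L ih =>
      intro x hx
      have h1 := hnonneg L x
      have h2 := hnonneg L (vec e * x)
      simp only [B, form, Complex.add_re] at ih hx h1 h2
      exact ih x (by linarith)
  let o := stdOrthonormalBasis ℝ V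
  let L : List V := List.ofFn o
  have hL1 : ∀ e ∈ L, ‖e‖ = 1 := by
    intro e he
    obtain ⟨i, rfl⟩ := (List.mem_ofFn' _ _).1 he
    exact o.orthonormal.1 i
  have hL2 : L.Pairwise fun e f => inner ℝ e f = 0 := by
    rw [List.pairwise_ofFn]
    intro i j hij
    exact o.orthonormal.2 hij.ne
  obtain ⟨-, hinv⟩ := form_invariant φ
    (fun x y => by simp [φ]) L hL1 hL2
  have hadd' : ∀ x y z, B L x (y + z) = B L x y + B L x z := fun x y z => by
    rw [← hconj, hadd, map_add, hconj, hconj]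
  have hsmul' : ∀ (a : ℂ) x z, B L x (a • z) = a * B L x z := fun a x z => by
    rw [← hconj, hsmul, map_mul, hconj, Complex.conj_conj]
  have hsum : ∀ {ι : Type} (s : Finset ι) (f : ι → Cl V) z,
      B L (∑ i ∈ s, f i) z = ∑ i ∈ s, B L (f i) z := by
    intro ι s f z
    let g : Cl V →+ ℂ := AddMonoidHom.mk' (fun x => B L x z) (fun x y => hadd L x y z)
    exact map_sum g f s
  have hsum' : ∀ {ι : Type} (s : Finset ι) (f : ι → Cl V) z,
      B L z (∑ i ∈ s, f i) = ∑ i ∈ s, B L z (f i) := by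
    intro ι s f z
    let g : Cl V →+ ℂ := AddMonoidHom.mk' (fun x => B L z x) (fun x y => hadd' z x y)
    exact map_sum g f s
  have hvec : ∀ v y z, B L (vec v * y) z = B L y (vec v * z) := by
    intro v y z
    have he : ∀ i, B L (vec (o i) * y) z = B L y (vec (o i) * z) := by
      intro i
      have hi : o i ∈ L := (List.mem_ofFn' _ _).2 ⟨i, rfl⟩
      have hz : z = vec (o i) * (vec (o i) * z) := by
        rw [← mul_assoc, vec_mul_self, hL1 _ hi]
        simp
      conv_lhs => rw [hz]
      exact hinv _ hi _ _
    have hv : vec v = ∑ i, ((o.repr v i : ℝ) : ℂ) • vec (o i) := by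
      conv_lhs => rw [← o.sum_repr v]
      rw [map_sum]
      exact Finset.sum_congr rfl fun i _ => map_smul vec _ _
    rw [hv, Finset.sum_mul, Finset.sum_mul, hsum, hsum']
    refine Finset.sum_congr rfl fun i _ => ?_
    rw [smul_mul_assoc, smul_mul_assoc, hsmul, hsmul', he, Complex.conj_ofReal]
  refine ⟨{ inner := B L
            conj_inner_symm := hconj L
            re_inner_nonneg := hnonneg L
            add_left := hadd L
            smul_left := fun x y r => hsmul L r x y
            definite := fun x hx => hdef L x (by
              have : B L x x = 0 := hx
              rw [this]; simp) }, ?_⟩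
  intro x
  change ∀ y z, B L (x * y) z = B L y (star x * z)
  induction x using Cl.induction with
  | scalar a =>
    intro y z
    rw [star_algebraMap, ← Algebra.smul_def, ← Algebra.smul_def, hsmul, hsmul']
    rfl
  | add x x' hx hx' =>
    intro y z
    rw [add_mul, hadd, hx, hx', star_add, add_mul, hadd']
  | vec_mul v x hx =>
    intro y z
    rw [mul_assoc, hvec, hx, star_mul, star_vec, mul_assoc]

/-- `Cl(V)` has a faithful finite-dimensional `*`-representation. -/
lemma exists_faithful [FiniteDimensional ℝ V] : ∃ r : Rep V, Function.Injective r.2 := by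
  obtain ⟨c, hc⟩ := exists_core (V := V)
  let _ : NormedAddCommGroup (Cl V) := c.toNormedAddCommGroup
  let _ : InnerProductSpace ℂ (Cl V) := InnerProductSpace.ofCore c.toCore
  let o := stdOrthonormalBasis ℂ (Cl V)
  let e := o.repr
  let π : Cl V →ₐ[ℂ] _ := ((Module.End.toContinuousLinearMap
    (EuclideanSpace ℂ (Fin (Module.finrank ℂ (Cl V))))).toAlgHom).comp
      ((e.toLinearEquiv.conjAlgEquiv ℂ).toAlgHom.comp (Algebra.lmul ℂ (Cl V)))
  have hπ : ∀ x y, π x y = e (x * e.symm y) := fun x y => rfl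
  refine ⟨⟨_, { π with map_star' := fun x => ?_ }⟩, ?_⟩
  · change π (star x) = star (π x)
    rw [ContinuousLinearMap.star_eq_adjoint, ContinuousLinearMap.eq_adjoint_iff]
    intro y z
    rw [hπ, hπ]
    have h1 : inner ℂ (e (star x * e.symm y)) z = inner ℂ (star x * e.symm y) (e.symm z) := by
      conv_lhs => rw [← e.apply_symm_apply z]
      exact e.inner_map_map _ _
    have h2 : inner ℂ y (e (x * e.symm z)) = inner ℂ (e.symm y) (x * e.symm z) := by
      conv_lhs => rw [← e.apply_symm_apply y]
      exact e.inner_map_map _ _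
    rw [h1, h2]
    have := hc (star x) (e.symm y) (e.symm z)
    rw [star_star] at this
    exact this
  · intro x y hxy
    have h : π x (e 1) = π y (e 1) := congrArg (fun T => T (e 1)) hxy
    rw [hπ, hπ] at h
    simpa using h

variable [FiniteDimensional ℝ V]

/-- The `C*`-norm of `Cl(V)`, as a ring norm: the supremum over all finite-dimensional
`*`-representations. -/
def ringNorm : RingNorm (Cl V) where
  toFun x := ⨆ r : Rep V, ‖r.2 x‖
  map_zero' := by simp
  add_le' x y := by
    refine Real.iSup_le (fun r => ?_)
      (add_nonneg (Real.iSup_nonneg fun _ => norm_nonneg _) (Real.iSup_nonneg fun _ => norm_nonneg _))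
    rw [map_add]
    exact (norm_add_le _ _).trans (add_le_add (le_ciSup (bddAbove_norm_rep x) r)
      (le_ciSup (bddAbove_norm_rep y) r))
  neg' x := by simp
  mul_le' x y := by
    refine Real.iSup_le (fun r => ?_)
      (mul_nonneg (Real.iSup_nonneg fun _ => norm_nonneg _) (Real.iSup_nonneg fun _ => norm_nonneg _))
    rw [map_mul]
    exact (norm_mul_le _ _).trans (mul_le_mul (le_ciSup (bddAbove_norm_rep x) r)
      (le_ciSup (bddAbove_norm_rep y) r) (norm_nonneg _) (Real.iSup_nonneg fun _ => norm_nonneg _))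
  eq_zero_of_map_eq_zero' x hx := by
    obtain ⟨r, hr⟩ := exists_faithful (V := V)
    have h : ‖r.2 x‖ ≤ 0 := hx ▸ le_ciSup (bddAbove_norm_rep x) r
    have h2 : r.2 x = r.2 0 := by rw [map_zero]; exact norm_le_zero_iff.1 h
    exact hr h2

instance : NormedRing (Cl V) := ringNorm.toNormedRing

lemma norm_def (x : Cl V) : ‖x‖ = ⨆ r : Rep V, ‖r.2 x‖ := rfl

lemma norm_rep_le (r : Rep V) (x : Cl V) : ‖r.2 x‖ ≤ ‖x‖ := le_ciSup (bddAbove_norm_rep x) r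

lemma norm_le_of_rep {x : Cl V} {C : ℝ} (hC : 0 ≤ C) (h : ∀ r : Rep V, ‖r.2 x‖ ≤ C) : ‖x‖ ≤ C :=
  Real.iSup_le h hC

lemma norm_smul_le_aux (a : ℂ) (x : Cl V) : ‖a • x‖ ≤ ‖a‖ * ‖x‖ := by
  refine norm_le_of_rep (mul_nonneg (norm_nonneg _) (norm_nonneg _)) fun r => ?_
  rw [norm_rep_smul]
  exact mul_le_mul_of_nonneg_left (norm_rep_le r x) (norm_nonneg a)

instance : NormedAlgebra ℂ (Cl V) where
  norm_smul_le := norm_smul_le_aux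

instance : CStarRing (Cl V) where
  norm_mul_self_le x := by
    have h0 : 0 ≤ ‖star x * x‖ := norm_nonneg _
    have h : ‖x‖ ≤ Real.sqrt ‖star x * x‖ := by
      rw [norm_def]
      refine Real.iSup_le (fun r => Real.le_sqrt_of_sq_le ?_) (Real.sqrt_nonneg _)
      rw [sq, ← CStarRing.norm_star_mul_self, ← map_star, ← map_mul]
      exact le_ciSup (bddAbove_norm_rep (star x * x)) r
    calc ‖x‖ * ‖x‖ ≤ Real.sqrt ‖star x * x‖ * Real.sqrt ‖star x * x‖ :=
          mul_le_mul h h (norm_nonneg _) (Real.sqrt_nonneg _)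
      _ = ‖star x * x‖ := Real.mul_self_sqrt h0

instance : CompleteSpace (Cl V) := FiniteDimensional.complete ℂ (Cl V)

instance : CStarAlgebra (Cl V) where

end Cl

section Functoriality

variable {V₁ V₂ V₃ : Type*} [NormedAddCommGroup V₁] [InnerProductSpace ℝ V₁]
  [NormedAddCommGroup V₂] [InnerProductSpace ℝ V₂] [NormedAddCommGroup V₃] [InnerProductSpace ℝ V₃]

/-- A linear isometry `j : V₁ → V₂` induces a unital `*`-homomorphism `Cl(V₁) → Cl(V₂)` which
extends `j`. -/
def Cl.map (j : V₁ →ₗᵢ[ℝ] V₂) : Cl V₁ →⋆ₐ[ℂ] Cl V₂ :=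
  let jq : normForm V₁ →qᵢ normForm V₂ :=
    ⟨j.toLinearMap, fun v => by
      rw [normForm_apply, normForm_apply]; exact congrArg (· ^ 2) (j.norm_map v)⟩
  let m : ℂ ⊗[ℝ] CliffordAlgebra (normForm V₁) →ₐ[ℂ] ℂ ⊗[ℝ] CliffordAlgebra (normForm V₂) :=
    Algebra.TensorProduct.map (AlgHom.id ℂ ℂ) (CliffordAlgebra.map jq)
  let f : Cl V₁ →ₐ[ℂ] Cl V₂ := m
  have hvec : ∀ v, f (Cl.vec v) = Cl.vec (j v) := fun v => by
    change m ((1 : ℂ) ⊗ₜ[ℝ] CliffordAlgebra.ι (normForm V₁) v) =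
      (1 : ℂ) ⊗ₜ[ℝ] CliffordAlgebra.ι (normForm V₂) (j v)
    simp only [m, Algebra.TensorProduct.map_tmul, CliffordAlgebra.map_apply_ι]
    rfl
  { f with
    map_star' := fun x => by
      change f (star x) = star (f x)
      induction x using Cl.induction with
      | scalar z =>
        rw [Cl.star_algebraMap, AlgHom.commutes, AlgHom.commutes, Cl.star_algebraMap]
      | add x y hx hy => rw [star_add, map_add, hx, hy, map_add, star_add]
      | vec_mul v x hx =>
        rw [star_mul, Cl.star_vec, map_mul, map_mul, hx, hvec, star_mul, Cl.star_vec] }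

lemma Cl.map_vec (j : V₁ →ₗᵢ[ℝ] V₂) (v : V₁) : Cl.map j (Cl.vec v) = Cl.vec (j v) := by
  change (Algebra.TensorProduct.map (AlgHom.id ℂ ℂ) (CliffordAlgebra.map _))
    ((1 : ℂ) ⊗ₜ[ℝ] CliffordAlgebra.ι (normForm V₁) v) =
      (1 : ℂ) ⊗ₜ[ℝ] CliffordAlgebra.ι (normForm V₂) (j v)
  rw [Algebra.TensorProduct.map_tmul, CliffordAlgebra.map_apply_ι]
  rfl

lemma Cl.hom_ext {A : Type*} [Ring A] [Algebra ℂ A] {f g : Cl V₁ →ₐ[ℂ] A}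
    (h : ∀ v, f (Cl.vec v) = g (Cl.vec v)) (x : Cl V₁) : f x = g x := by
  induction x using Cl.induction with
  | scalar z => rw [AlgHom.commutes, AlgHom.commutes]
  | add x y hx hy => rw [map_add, map_add, hx, hy]
  | vec_mul v x hx => rw [map_mul, map_mul, hx, h]

lemma Cl.map_map (j : V₁ →ₗᵢ[ℝ] V₂) (k : V₂ →ₗᵢ[ℝ] V₃) (x : Cl V₁) :
    Cl.map k (Cl.map j x) = Cl.map (k.comp j) x :=
  Cl.hom_ext (f := (Cl.map k).toAlgHom.comp (Cl.map j).toAlgHom) (g := (Cl.map (k.comp j)).toAlgHom)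
    (fun v => by
      change Cl.map k (Cl.map j (Cl.vec v)) = Cl.map (k.comp j) (Cl.vec v)
      rw [Cl.map_vec, Cl.map_vec, Cl.map_vec]; rfl) x

lemma Cl.map_id (x : Cl V₁) : Cl.map (LinearIsometry.id : V₁ →ₗᵢ[ℝ] V₁) x = x :=
  Cl.hom_ext (f := (Cl.map (LinearIsometry.id : V₁ →ₗᵢ[ℝ] V₁)).toAlgHom) (g := AlgHom.id ℂ _)
    (fun v => Cl.map_vec _ v) x

lemma Cl.norm_map_le [FiniteDimensional ℝ V₁] [FiniteDimensional ℝ V₂] (j : V₁ →ₗᵢ[ℝ] V₂)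
    (x : Cl V₁) : ‖Cl.map j x‖ ≤ ‖x‖ :=
  NonUnitalStarAlgHom.norm_apply_le (Cl.map j) x

lemma Cl.continuous_vec [FiniteDimensional ℝ V₁] : Continuous (Cl.vec : V₁ → Cl V₁) :=
  LinearMap.continuous_of_finiteDimensional Cl.vec

/-- The image of a fixed element under a pointwise convergent family of isometries converges. -/
lemma Cl.tendsto_map [FiniteDimensional ℝ V₁] [FiniteDimensional ℝ V₂] {Z : Type*} {l : Filter Z}
    {j : Z → V₁ →ₗᵢ[ℝ] V₂} {j₀ : V₁ →ₗᵢ[ℝ] V₂} (h : ∀ v, Tendsto (fun z => j z v) l (𝓝 (j₀ v)))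
    (x : Cl V₁) : Tendsto (fun z => Cl.map (j z) x) l (𝓝 (Cl.map j₀ x)) := by
  induction x using Cl.induction with
  | scalar a =>
    simp only [AlgHomClass.commutes]
    exact tendsto_const_nhds
  | add x y hx hy =>
    simp only [map_add]
    exact hx.add hy
  | vec_mul v x hx =>
    simp only [map_mul, Cl.map_vec]
    exact ((Cl.continuous_vec.tendsto _).comp (h v)).mul hx

end Functoriality

end Clifford


/-! ## The graded tensor products `S𝔠(E) = C₀(ℝ) ⊗̂ C₀(E, Cl(W))` -/

set_option linter.unusedSectionVars false
set_option linter.unnecessarySeqFocus false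

section Suspension

/-- The Euclidean space `ℝ ⊕ W`. -/
abbrev Ext (W : Type*) [NormedAddCommGroup W] [InnerProductSpace ℝ W] : Type _ :=
  WithLp 2 (ℝ × W)

section Ext

variable {W W₁ : Type*} [NormedAddCommGroup W] [InnerProductSpace ℝ W]
  [NormedAddCommGroup W₁] [InnerProductSpace ℝ W₁]

lemma Ext.norm_sq (x : Ext W) : ‖x‖ ^ 2 = x.fst ^ 2 + ‖x.snd‖ ^ 2 := by
  rw [WithLp.prod_norm_sq_eq_of_L2]; simp

/-- The vector `(t, y)` of `ℝ ⊕ W`. -/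
abbrev Ext.mk (t : ℝ) (y : W) : Ext W := WithLp.toLp 2 (t, y)

lemma Ext.ext_iff' {x y : Ext W} (h₁ : x.fst = y.fst) (h₂ : x.snd = y.snd) : x = y :=
  WithLp.ofLp_injective 2 (Prod.ext h₁ h₂)

/-- The isometry `id ⊕ u : ℝ ⊕ W → ℝ ⊕ W₁`. -/
def Ext.map (u : W →ₗᵢ[ℝ] W₁) : Ext W →ₗᵢ[ℝ] Ext W₁ where
  toFun x := Ext.mk (x.fst) (u x.snd)
  map_add' x y := by refine Ext.ext_iff' ?_ ?_ <;> simp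
  map_smul' r x := by refine Ext.ext_iff' ?_ ?_ <;> simp
  norm_map' x := by
    have h : ‖(Ext.mk (x.fst) (u x.snd) : Ext W₁)‖ ^ 2 = ‖x‖ ^ 2 := by
      rw [Ext.norm_sq, Ext.norm_sq]; simp
    exact (sq_eq_sq₀ (norm_nonneg _) (norm_nonneg _)).1 h

variable (W) in
/-- The reflection `(t, y) ↦ (-t, y)` of `ℝ ⊕ W`. -/
def Ext.refl : Ext W →ₗᵢ[ℝ] Ext W where
  toFun x := Ext.mk (-x.fst) (x.snd)
  map_add' x y := by refine Ext.ext_iff' ?_ ?_ <;> simp [add_comm]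
  map_smul' r x := by refine Ext.ext_iff' ?_ ?_ <;> simp
  norm_map' x := by
    have h : ‖(Ext.mk (-x.fst) (x.snd) : Ext W)‖ ^ 2 = ‖x‖ ^ 2 := by
      rw [Ext.norm_sq, Ext.norm_sq]; simp
    exact (sq_eq_sq₀ (norm_nonneg _) (norm_nonneg _)).1 h

variable (W) in
/-- The inclusion `y ↦ (0, y)` of `W` in `ℝ ⊕ W`. -/
def Ext.inr : W →ₗᵢ[ℝ] Ext W where
  toFun y := Ext.mk 0 y
  map_add' x y := by refine Ext.ext_iff' ?_ ?_ <;> simp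
  map_smul' r x := by refine Ext.ext_iff' ?_ ?_ <;> simp
  norm_map' y := by
    have h : ‖(Ext.mk 0 y : Ext W)‖ ^ 2 = ‖y‖ ^ 2 := by
      rw [Ext.norm_sq]; simp
    exact (sq_eq_sq₀ (norm_nonneg _) (norm_nonneg _)).1 h

/-- The unit vector in the direction of `w` (and `(1, 0)` if `w = 0`). -/
def Ext.unitDir (w : Ext W) : Ext W :=
  open Classical in if w = 0 then Ext.mk 1 0 else ‖w‖⁻¹ • w

lemma Ext.norm_unitDir (w : Ext W) : ‖w.unitDir‖ = 1 := by
  unfold Ext.unitDir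
  split_ifs with h
  · have h : ‖(Ext.mk 1 0 : Ext W)‖ ^ 2 = 1 ^ 2 := by
      rw [Ext.norm_sq]; simp
    exact (sq_eq_sq₀ (norm_nonneg _) zero_le_one).1 h
  · rw [norm_smul, norm_inv, norm_norm, inv_mul_cancel₀ (norm_ne_zero_iff.2 h)]

/-- If `u : W → W₁` is an isometry and `c` is a vector of `W₁` orthogonal to `u(W)`, this is the
isometry `ℝ ⊕ W → ℝ ⊕ W₁` which is `u` on `W` and takes the unit vector of `ℝ` to `w / ‖w‖`, where
`w = (t, c)`. -/
def Ext.turn (u : W →ₗᵢ[ℝ] W₁) (t : ℝ) (c : W₁) (hc : ∀ y, inner ℝ c (u y) = 0) :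
    Ext W →ₗᵢ[ℝ] Ext W₁ where
  toFun x := x.fst • (Ext.mk t c).unitDir + Ext.inr W₁ (u x.snd)
  map_add' x y := by
    simp only [WithLp.add_fst, WithLp.add_snd, map_add, add_smul]; abel
  map_smul' r x := by
    simp only [WithLp.smul_fst, WithLp.smul_snd, map_smul, smul_eq_mul, mul_smul, smul_add,
      RingHom.id_apply]
  norm_map' x := by
    have h0 : inner ℝ (Ext.mk t c).unitDir (Ext.inr W₁ (u x.snd)) = 0 := by
      unfold Ext.unitDir
      split_ifs with h
      · simp [Ext.mk, Ext.inr, WithLp.prod_inner_apply]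
      · rw [inner_smul_left]
        simp [Ext.mk, Ext.inr, WithLp.prod_inner_apply, hc]
    have h : ‖x.fst • (Ext.mk t c).unitDir + Ext.inr W₁ (u x.snd)‖ ^ 2 = ‖x‖ ^ 2 := by
      rw [norm_add_sq_real, inner_smul_left, h0, norm_smul, Ext.norm_unitDir,
        (Ext.inr W₁).norm_map, u.norm_map, Ext.norm_sq]
      simp
    exact (sq_eq_sq₀ (norm_nonneg _) (norm_nonneg _)).1 h

lemma Ext.turn_apply (u : W →ₗᵢ[ℝ] W₁) (t : ℝ) (c : W₁) (hc : ∀ y, inner ℝ c (u y) = 0)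
    (x : Ext W) : Ext.turn u t c hc x = x.fst • (Ext.mk t c).unitDir + Ext.inr W₁ (u x.snd) := rfl

lemma Ext.turn_inr (u : W →ₗᵢ[ℝ] W₁) (t : ℝ) (c : W₁) (hc : ∀ y, inner ℝ c (u y) = 0) (y : W) :
    Ext.turn u t c hc (Ext.inr W y) = Ext.inr W₁ (u y) := by
  rw [Ext.turn_apply]
  simp [Ext.inr]

lemma Ext.refl_inr (y : W) : Ext.refl W (Ext.inr W y) = Ext.inr W y := by
  refine Ext.ext_iff' ?_ ?_ <;> simp [Ext.inr, Ext.refl]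

lemma Cl.exists_of_refl_eq {x : Cl (Ext W)} (hx : Cl.map (Ext.refl W) x = x) :
    ∃ y : Cl W, x = Cl.map (Ext.inr W) y := by
  let e : Cl (Ext W) := Cl.vec (Ext.mk 1 0)
  have he : Cl.map (Ext.refl W) e = -e := by
    rw [Cl.map_vec, ← map_neg]
    congr 1
    refine Ext.ext_iff' ?_ ?_ <;> simp [Ext.refl]
  have hr : ∀ y : Cl W, Cl.map (Ext.refl W) (Cl.map (Ext.inr W) y) = Cl.map (Ext.inr W) y := by
    intro y
    rw [Cl.map_map]
    congr 1
    congr 1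
    ext z <;> simp [Ext.refl, Ext.inr]
  have hee : e * e = 1 := by
    have h : ‖(Ext.mk 1 0 : Ext W)‖ ^ 2 = 1 := by rw [Ext.norm_sq]; simp
    rw [Cl.vec_mul_self, h]; simp
  have key : ∀ x : Cl (Ext W), ∃ p q : Cl W,
      x = Cl.map (Ext.inr W) p + e * Cl.map (Ext.inr W) q := by
    intro x
    induction x using Cl.induction with
    | scalar z => exact ⟨algebraMap ℂ _ z, 0, by rw [map_zero, mul_zero, add_zero,
        AlgHomClass.commutes]⟩
    | add x y hx hy =>
      obtain ⟨p, q, rfl⟩ := hx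
      obtain ⟨p', q', rfl⟩ := hy
      exact ⟨p + p', q + q', by rw [map_add, map_add, mul_add]; abel⟩
    | vec_mul v x hx =>
      obtain ⟨p, q, rfl⟩ := hx
      have hv : v = v.fst • (Ext.mk 1 0 : Ext W) + Ext.inr W v.snd := by
        refine Ext.ext_iff' ?_ ?_ <;> simp [Ext.inr]
      have hv' : Cl.vec v = (v.fst : ℂ) • e + Cl.map (Ext.inr W) (Cl.vec v.snd) := by
        conv_lhs => rw [hv, map_add]
        rw [Cl.map_vec, map_smul]
        rfl
      have hanti : Cl.map (Ext.inr W) (Cl.vec v.snd) * e =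
          -(e * Cl.map (Ext.inr W) (Cl.vec v.snd)) := by
        rw [Cl.map_vec]
        exact Cl.vec_mul_vec_of_inner_eq_zero (by simp [Ext.inr, WithLp.prod_inner_apply])
      refine ⟨(v.fst : ℂ) • q + Cl.vec v.snd * p, (v.fst : ℂ) • p - Cl.vec v.snd * q, ?_⟩
      rw [hv', add_mul, mul_add, mul_add, ← mul_assoc (Cl.map (Ext.inr W) (Cl.vec v.snd)) e, hanti,
        map_add, map_sub, map_smul, map_smul, map_mul, map_mul, smul_mul_assoc, smul_mul_assoc,
        ← mul_assoc e e, hee, one_mul, mul_sub, mul_smul_comm, neg_mul, mul_assoc]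
      abel
  obtain ⟨p, q, rfl⟩ := key x
  refine ⟨p, ?_⟩
  rw [map_add, map_mul, hr, hr, he, neg_mul] at hx
  have h2 : e * Cl.map (Ext.inr W) q = 0 := by
    have h3 : -(e * Cl.map (Ext.inr W) q) = e * Cl.map (Ext.inr W) q := add_left_cancel hx
    have h4 : (2 : ℂ) • (e * Cl.map (Ext.inr W) q) = 0 := by
      rw [two_smul]
      nth_rewrite 1 [← h3]
      exact neg_add_cancel _
    exact (smul_eq_zero.1 h4).resolve_left two_ne_zero
  rw [h2, add_zero]

/-- Isometries which agree on `W` agree on the elements which are fixed by the reflection. -/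
lemma Cl.map_eq_of_refl_eq {x : Cl (Ext W)} (hx : Cl.map (Ext.refl W) x = x)
    {j k : Ext W →ₗᵢ[ℝ] Ext W₁} (h : ∀ y, j (Ext.inr W y) = k (Ext.inr W y)) :
    Cl.map j x = Cl.map k x := by
  obtain ⟨y, rfl⟩ := Cl.exists_of_refl_eq hx
  rw [Cl.map_map, Cl.map_map]
  congr 2
  ext1 z
  exact h z

end Ext

section Symmetric

variable (X A : Type*) [TopologicalSpace X] [CStarAlgebra A] (σ : A →⋆ₐ[ℂ] A)

/-- The functions `F ∈ C₀(ℝ × X, A)` with `F(-t, v) = σ(F(t, v))`. -/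
def symSub : NonUnitalStarSubalgebra ℂ C₀(ℝ × X, A) where
  carrier := {F | ∀ t v, F (-t, v) = σ (F (t, v))}
  add_mem' {F G} hF hG t v := by simp [hF t v, hG t v]
  zero_mem' t v := by simp
  mul_mem' {F G} hF hG t v := by simp [hF t v, hG t v]
  smul_mem' c F hF t v := by simp [hF t v]
  star_mem' {F} hF t v := by simp [hF t v, map_star]

instance instIsClosedSymSub : IsClosed (symSub X A σ : Set C₀(ℝ × X, A)) := by
  have heval : ∀ z, Continuous fun F : C₀(ℝ × X, A) => F z := fun z =>
    (continuous_eval_const (F := (ℝ × X) →ᵇ A) z).comp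
      ZeroAtInftyContinuousMap.isometry_toBCF.continuous
  have hσ : Continuous σ :=
    AddMonoidHomClass.continuous_of_bound σ 1 fun x => by
      rw [one_mul]; exact NonUnitalStarAlgHom.norm_apply_le σ x
  have : (symSub X A σ : Set C₀(ℝ × X, A)) = ⋂ t : ℝ, ⋂ v : X, {F | F (-t, v) = σ (F (t, v))} := by
    ext F
    simp only [Set.mem_iInter]
    rfl
  rw [this]
  exact isClosed_iInter fun t => isClosed_iInter fun v =>
    isClosed_eq (heval _) (hσ.comp (heval _))

/-- The `C*`-algebra of the functions `F ∈ C₀(ℝ × X, A)` with `F(-t, v) = σ(F(t, v))`. -/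
def SymC0 : Type _ := ↥(symSub X A σ)

instance : NonUnitalCStarAlgebra (SymC0 X A σ) :=
  inferInstanceAs (NonUnitalCStarAlgebra ↥(symSub X A σ))

instance : CoeFun (SymC0 X A σ) fun _ => ℝ × X → A := ⟨fun F => F.1⟩

variable {X A σ}

namespace SymC0

lemma continuous (F : SymC0 X A σ) : Continuous F := F.1.continuous

lemma tendsto_zero (F : SymC0 X A σ) : Tendsto F (cocompact _) (𝓝 0) := zero_at_infty F.1

lemma apply_neg (F : SymC0 X A σ) (t : ℝ) (v : X) : F (-t, v) = σ (F (t, v)) :=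
  F.2 t v

lemma sym_apply_zero (F : SymC0 X A σ) (v : X) : σ (F (0, v)) = F (0, v) := by
  rw [← F.apply_neg, neg_zero]

lemma ext {F G : SymC0 X A σ} (h : ∀ z, F z = G z) : F = G :=
  Subtype.ext (ZeroAtInftyContinuousMap.ext h)

/-- The element of `SymC0 X A σ` with a given underlying function. -/
def mk (F : ℝ × X → A) (hc : Continuous F) (h0 : Tendsto F (cocompact _) (𝓝 0))
    (hF : ∀ t v, F (-t, v) = σ (F (t, v))) : SymC0 X A σ := ⟨⟨⟨F, hc⟩, h0⟩, hF⟩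

lemma mk_apply (F : ℝ × X → A) (hc : Continuous F) (h0 : Tendsto F (cocompact _) (𝓝 0))
    (hF : ∀ t v, F (-t, v) = σ (F (t, v))) (z : ℝ × X) :
    mk F hc h0 hF z = F z := rfl

lemma zero_apply (z : ℝ × X) : (0 : SymC0 X A σ) z = 0 := rfl
lemma add_apply (F G : SymC0 X A σ) (z : ℝ × X) : (F + G) z = F z + G z := rfl
lemma smul_apply (c : ℂ) (F : SymC0 X A σ) (z : ℝ × X) : (c • F) z = c • F z := rfl
lemma mul_apply (F G : SymC0 X A σ) (z : ℝ × X) : (F * G) z = F z * G z := rfl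
lemma star_apply (F : SymC0 X A σ) (z : ℝ × X) : (star F) z = star (F z) := rfl

variable {X₁ A₁ : Type*} [TopologicalSpace X₁] [CStarAlgebra A₁] {σ₁ : A₁ →⋆ₐ[ℂ] A₁}

/-- A `*`-homomorphism given by applying `*`-homomorphisms to the values at other points. -/
def homMk (j : ℝ × X₁ → A →⋆ₐ[ℂ] A₁) (g : ℝ × X₁ → ℝ × X)
    (hc : ∀ F : SymC0 X A σ, Continuous fun z => j z (F (g z)))
    (h0 : ∀ F : SymC0 X A σ, Tendsto (fun z => j z (F (g z))) (cocompact _) (𝓝 0))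
    (hF : ∀ (F : SymC0 X A σ) t v, j (-t, v) (F (g (-t, v))) = σ₁ (j (t, v) (F (g (t, v))))) :
    SymC0 X A σ →⋆ₙₐ[ℂ] SymC0 X₁ A₁ σ₁ where
  toFun F := mk (fun z => j z (F (g z))) (hc F) (h0 F) (hF F)
  map_smul' c F := ext fun z => by
    rw [mk_apply, smul_apply, MonoidHom.id_apply, smul_apply, mk_apply, map_smul]
  map_zero' := ext fun z => by rw [mk_apply, zero_apply, zero_apply, map_zero]
  map_add' F G := ext fun z => by
    rw [mk_apply, add_apply, add_apply, mk_apply, mk_apply, map_add]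
  map_mul' F G := ext fun z => by
    rw [mk_apply, mul_apply, mul_apply, mk_apply, mk_apply, map_mul]
  map_star' F := ext fun z => by
    rw [mk_apply, star_apply, star_apply, mk_apply, map_star]

lemma homMk_apply (j : ℝ × X₁ → A →⋆ₐ[ℂ] A₁) (g : ℝ × X₁ → ℝ × X)
    (hc : ∀ F : SymC0 X A σ, Continuous fun z => j z (F (g z)))
    (h0 : ∀ F : SymC0 X A σ, Tendsto (fun z => j z (F (g z))) (cocompact _) (𝓝 0))
    (hF : ∀ (F : SymC0 X A σ) t v, j (-t, v) (F (g (-t, v))) = σ₁ (j (t, v) (F (g (t, v)))))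
    (F : SymC0 X A σ) (z : ℝ × X₁) : homMk (σ₁ := σ₁) j g hc h0 hF F z = j z (F (g z)) := rfl

end SymC0

end Symmetric

variable (E W : Type*) [NormedAddCommGroup E] [InnerProductSpace ℝ E] [FiniteDimensional ℝ E]
  [NormedAddCommGroup W] [InnerProductSpace ℝ W] [FiniteDimensional ℝ W]

/-- The `C*`-algebra `C₀(ℝ) ⊗̂ C₀(E, Cl(W))` (graded tensor product), where `C₀(ℝ)` is graded by
even and odd functions and `Cl(W)` by its parity.

Let `ε` be the unit vector of `ℝ`, so that `Cl(ℝ ⊕ W) = Cl(ℝ) ⊗̂ Cl(W)` (`ε ^ 2 = 1` and `ε`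
anticommutes with `W`). Functional calculus `f ↦ (t ↦ f(t ε))`, with
`f(t ε) = f_even(t) + f_odd(t) ε`, identifies the graded `C*`-algebra `C₀(ℝ)` with the algebra of
those `F ∈ C₀(ℝ, Cl(ℝ))` for which `F(-t)` is the image of `F(t)` under the reflection `ε ↦ -ε`.
Hence `C₀(ℝ) ⊗̂ C₀(E, Cl(W))` is the `C*`-algebra of the functions `F ∈ C₀(ℝ × E, Cl(ℝ ⊕ W))` for
which `F(-t, v)` is the image of `F(t, v)` under the reflection of `ℝ`, and the elementary tensor
`f ⊗̂ u` is the function `(t, v) ↦ f(t ε) u(v)`. -/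
abbrev SC : Type _ := SymC0 E (Cl (Ext W)) (Cl.map (Ext.refl W))

variable {E W}
variable {E₁ W₁ : Type*}
  [NormedAddCommGroup E₁] [InnerProductSpace ℝ E₁] [FiniteDimensional ℝ E₁]
  [NormedAddCommGroup W₁] [InnerProductSpace ℝ W₁] [FiniteDimensional ℝ W₁]

/-- The underlying function of `bott`. -/
def bottFun (i : W →ₗᵢ[ℝ] W₁) (p : E₁ →ₗ[ℝ] E) (C : E₁ →ₗ[ℝ] W₁)
    (hC : ∀ v y, inner ℝ (C v) (i y) = 0) (F : SC E W) (z : ℝ × E₁) : Cl (Ext W₁) :=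
  Cl.map (Ext.turn i z.1 (C z.2) (hC z.2))
    (F (‖(Ext.mk z.1 (C z.2) : Ext W₁)‖, p z.2))

lemma continuous_bottFun (i : W →ₗᵢ[ℝ] W₁) (p : E₁ →ₗ[ℝ] E) (C : E₁ →ₗ[ℝ] W₁)
    (hC : ∀ v y, inner ℝ (C v) (i y) = 0) (F : SC E W) : Continuous (bottFun i p C hC F) := by
  have hCc : Continuous C := C.continuous_of_finiteDimensional
  have hpc : Continuous p := p.continuous_of_finiteDimensional
  have hw : Continuous fun z : ℝ × E₁ => (Ext.mk z.1 (C z.2) : Ext W₁) := by fun_prop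
  have hF : Continuous fun z : ℝ × E₁ =>
      F (‖(Ext.mk z.1 (C z.2) : Ext W₁)‖, p z.2) :=
    F.continuous.comp (hw.norm.prodMk (hpc.comp continuous_snd))
  refine continuous_iff_continuousAt.2 fun z₀ => ?_
  set G : ℝ × E₁ → Cl (Ext W) :=
    fun z => F (‖(Ext.mk z.1 (C z.2) : Ext W₁)‖, p z.2) with hG
  set j : ℝ × E₁ → Ext W →ₗᵢ[ℝ] Ext W₁ :=
    fun z => Ext.turn i z.1 (C z.2) (hC z.2) with hj
  have h1 : Tendsto (fun z => Cl.map (j z) (G z₀)) (𝓝 z₀) (𝓝 (Cl.map (j z₀) (G z₀))) := by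
    by_cases h0 : (Ext.mk z₀.1 (C z₀.2) : Ext W₁) = 0
    · have hfix : Cl.map (Ext.refl W) (G z₀) = G z₀ := by
        simp only [hG, h0, norm_zero]
        exact F.sym_apply_zero _
      have : (fun z => Cl.map (j z) (G z₀)) = fun _ => Cl.map (j z₀) (G z₀) := by
        funext z
        refine Cl.map_eq_of_refl_eq hfix fun y => ?_
        rw [hj, Ext.turn_inr, Ext.turn_inr]
      rw [this]
      exact tendsto_const_nhds
    · refine Cl.tendsto_map (fun x => ?_) _
      simp only [hj, Ext.turn_apply]
      refine Tendsto.add (Tendsto.smul tendsto_const_nhds ?_) tendsto_const_nhds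
      have hne : ∀ᶠ z in 𝓝 z₀, (Ext.mk z.1 (C z.2) : Ext W₁) ≠ 0 :=
        hw.continuousAt.eventually_ne h0
      have hu : Tendsto (fun z : ℝ × E₁ => ‖(Ext.mk z.1 (C z.2) : Ext W₁)‖⁻¹ •
          (Ext.mk z.1 (C z.2) : Ext W₁)) (𝓝 z₀)
          (𝓝 (Ext.unitDir (Ext.mk z₀.1 (C z₀.2)))) := by
        rw [Ext.unitDir, if_neg h0]
        exact (hw.norm.continuousAt.tendsto.inv₀ (norm_ne_zero_iff.2 h0)).smul
          hw.continuousAt.tendsto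
      refine hu.congr' ?_
      filter_upwards [hne] with z hz
      rw [Ext.unitDir, if_neg hz]
  have h2 : Tendsto (fun z => Cl.map (j z) (G z - G z₀)) (𝓝 z₀) (𝓝 0) := by
    have hd : Tendsto (fun z => ‖G z - G z₀‖) (𝓝 z₀) (𝓝 0) := by
      have := (hF.continuousAt (x := z₀)).tendsto.sub (tendsto_const_nhds (x := G z₀))
      rw [sub_self] at this
      simpa using this.norm
    exact squeeze_zero_norm (fun z => Cl.norm_map_le _ _) hd
  have h3 := h1.add h2
  rw [add_zero] at h3
  refine Tendsto.congr (fun z => ?_) h3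
  rw [← map_add, add_sub_cancel]
  rfl

lemma tendsto_bottPoint (p : E₁ →ₗ[ℝ] E) (C : E₁ →ₗ[ℝ] W₁)
    (hinj : ∀ v, p v = 0 → C v = 0 → v = 0) :
    Tendsto (fun z : ℝ × E₁ => (‖(Ext.mk z.1 (C z.2) : Ext W₁)‖, p z.2))
      (cocompact (ℝ × E₁)) (cocompact (ℝ × E)) := by
  have : ProperSpace E := FiniteDimensional.proper ℝ E
  have : ProperSpace W₁ := FiniteDimensional.proper ℝ W₁
  let f : ℝ × E₁ →ₗ[ℝ] (ℝ × W₁) × E :=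
    (LinearMap.prodMap LinearMap.id C).prod (p ∘ₗ LinearMap.snd ℝ ℝ E₁)
  have hf : f.ker = ⊥ := by
    rw [LinearMap.ker_eq_bot']
    rintro ⟨t, v⟩ h
    have h1 : ((t, C v) : ℝ × W₁) = 0 := congrArg Prod.fst h
    have h2 : p v = 0 := congrArg Prod.snd h
    have h3 : t = 0 := congrArg Prod.fst h1
    have h4 : C v = 0 := congrArg Prod.snd h1
    rw [h3, hinj v h2 h4]
    rfl
  have h1 : Tendsto (fun z => f z) (cocompact (ℝ × E₁)) (cocompact ((ℝ × W₁) × E)) :=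
    (LinearMap.isClosedEmbedding_of_injective hf).tendsto_cocompact
  have h2 := tendsto_norm_cocompact_atTop.comp h1
  rw [← Metric.cobounded_eq_cocompact (α := ℝ × E), ← tendsto_norm_atTop_iff_cobounded]
  refine tendsto_atTop_mono (fun z => ?_) h2
  have h3 : |z.1| ≤ ‖(Ext.mk z.1 (C z.2) : Ext W₁)‖ := by
    refine abs_le_of_sq_le_sq' ?_ (norm_nonneg _) |> abs_le.2
    rw [Ext.norm_sq]
    exact le_add_of_nonneg_right (sq_nonneg _)
  have h4 : ‖C z.2‖ ≤ ‖(Ext.mk z.1 (C z.2) : Ext W₁)‖ := by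
    refine (sq_le_sq₀ (norm_nonneg _) (norm_nonneg _)).1 ?_
    rw [Ext.norm_sq]
    exact le_add_of_nonneg_left (sq_nonneg _)
  change max (max |z.1| ‖C z.2‖) ‖p z.2‖ ≤ _
  rw [Prod.norm_def, norm_norm]
  exact max_le_max (max_le h3 h4) le_rfl

lemma tendsto_bottFun (i : W →ₗᵢ[ℝ] W₁) (p : E₁ →ₗ[ℝ] E) (C : E₁ →ₗ[ℝ] W₁)
    (hC : ∀ v y, inner ℝ (C v) (i y) = 0) (hinj : ∀ v, p v = 0 → C v = 0 → v = 0) (F : SC E W) :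
    Tendsto (bottFun i p C hC F) (cocompact (ℝ × E₁)) (𝓝 0) := by
  have hF : Tendsto (fun z : ℝ × E₁ => F (‖(Ext.mk z.1 (C z.2) : Ext W₁)‖, p z.2))
      (cocompact _) (𝓝 0) := F.tendsto_zero.comp (tendsto_bottPoint p C hinj)
  have hF' := hF.norm
  rw [norm_zero] at hF'
  exact squeeze_zero_norm (fun z => Cl.norm_map_le (Ext.turn i z.1 (C z.2) (hC z.2)) _) hF'

lemma bottFun_neg (i : W →ₗᵢ[ℝ] W₁) (p : E₁ →ₗ[ℝ] E) (C : E₁ →ₗ[ℝ] W₁)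
    (hC : ∀ v y, inner ℝ (C v) (i y) = 0) (F : SC E W) (t : ℝ) (v : E₁) :
    bottFun i p C hC F (-t, v) = Cl.map (Ext.refl W₁) (bottFun i p C hC F (t, v)) := by
  have hw : (Ext.mk (-t) (C v) : Ext W₁) = Ext.refl W₁ (Ext.mk t (C v)) := rfl
  have hn : ‖(Ext.mk (-t) (C v) : Ext W₁)‖ = ‖(Ext.mk t (C v) : Ext W₁)‖ := by
    rw [hw, LinearIsometry.norm_map]
  unfold bottFun
  simp only [hn]
  rw [Cl.map_map]
  by_cases h0 : (Ext.mk t (C v) : Ext W₁) = 0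
  · refine Cl.map_eq_of_refl_eq ?_ fun y => ?_
    · rw [h0, norm_zero]
      exact F.sym_apply_zero _
    · rw [Ext.turn_inr, LinearIsometry.coe_comp, Function.comp_apply, Ext.turn_inr, Ext.refl_inr]
  · congr 2
    ext1 x
    have h0' : (Ext.mk (-t) (C v) : Ext W₁) ≠ 0 := by
      rw [← norm_ne_zero_iff, hn]; exact norm_ne_zero_iff.2 h0
    rw [LinearIsometry.coe_comp, Function.comp_apply, Ext.turn_apply, Ext.turn_apply, Ext.unitDir, Ext.unitDir,
      if_neg h0, if_neg h0', hn, hw, map_add, map_smul, map_smul, Ext.refl_inr]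

/-- The Bott map `β ⊗̂ 1`, for a general Clifford operator.

Here `i : W → W₁` is an isometric inclusion, `p : E₁ → E` a projection, and `C : E₁ → W₁` a linear
map whose values are orthogonal to `i(W)` and which is injective on the kernel of `p`. The map
takes `f ⊗̂ u` to the function
`(t, v) ↦ f(t ε + C(v)) u(p(v))` (see `bott_apply_of_eq_cfc`), that is, to
`f(X ⊗̂ 1 + 1 ⊗̂ C) ⊗̂ u` when `E₁ = ker p ⊕ E` and `W₁ ⊇ C(ker p) ⊕ W`.

If `w = t ε + C(v)`, then `f(w) u(p(v))` is the image of `f(‖w‖ ε) u(p(v))` under the isometry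
`Ext.turn` of `ℝ ⊕ W` to `ℝ ⊕ W₁` which takes `ε` to `w / ‖w‖`; this is the definition of `bott`
on an arbitrary element of the tensor product. -/
def bott (i : W →ₗᵢ[ℝ] W₁) (p : E₁ →ₗ[ℝ] E) (C : E₁ →ₗ[ℝ] W₁)
    (hC : ∀ v y, inner ℝ (C v) (i y) = 0) (hinj : ∀ v, p v = 0 → C v = 0 → v = 0) :
    SC E W →⋆ₙₐ[ℂ] SC E₁ W₁ :=
  SymC0.homMk (fun z => Cl.map (Ext.turn i z.1 (C z.2) (hC z.2)))
    (fun z => (‖(Ext.mk z.1 (C z.2) : Ext W₁)‖, p z.2))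
    (continuous_bottFun i p C hC) (tendsto_bottFun i p C hC hinj) (bottFun_neg i p C hC)

lemma bott_apply (i : W →ₗᵢ[ℝ] W₁) (p : E₁ →ₗ[ℝ] E) (C : E₁ →ₗ[ℝ] W₁)
    (hC : ∀ v y, inner ℝ (C v) (i y) = 0) (hinj : ∀ v, p v = 0 → C v = 0 → v = 0) (F : SC E W)
    (t : ℝ) (v : E₁) :
    bott i p C hC hinj F (t, v) = Cl.map (Ext.turn i t (C v) (hC v))
      (F (‖(Ext.mk t (C v) : Ext W₁)‖, p v)) := rfl

/-- The Bott map takes `f ⊗̂ u` to `(t, v) ↦ f(t ε + C(v)) u(p(v))`. -/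
lemma bott_apply_of_eq_cfc (i : W →ₗᵢ[ℝ] W₁) (p : E₁ →ₗ[ℝ] E) (C : E₁ →ₗ[ℝ] W₁)
    (hC : ∀ v y, inner ℝ (C v) (i y) = 0) (hinj : ∀ v, p v = 0 → C v = 0 → v = 0)
    {f : ℝ → ℂ} (hf : Continuous f) {u : E → Cl W} {F : SC E W}
    (hF : ∀ t v, F (t, v) =
      cfc (fun x : ℂ => f x.re) (Cl.vec (Ext.mk t 0 : Ext W)) * Cl.map (Ext.inr W) (u v))
    (t : ℝ) (v : E₁) :
    bott i p C hC hinj F (t, v) =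
      cfc (fun x : ℂ => f x.re) (Cl.vec (Ext.mk t (C v) : Ext W₁)) *
        Cl.map ((Ext.inr W₁).comp i) (u (p v)) := by
  have hcont : Continuous (fun x : ℂ => f x.re) := hf.comp Complex.continuous_re
  have hsa : ∀ x : Ext W, IsStarNormal (Cl.vec x) := fun x =>
    (show IsSelfAdjoint (Cl.vec x) from Cl.star_vec x).isStarNormal
  have hsa₁ : ∀ x : Ext W₁, IsStarNormal (Cl.vec x) := fun x =>
    (show IsSelfAdjoint (Cl.vec x) from Cl.star_vec x).isStarNormal
  have hm : Continuous (Cl.map (Ext.turn i t (C v) (hC v))) :=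
    LinearMap.continuous_of_finiteDimensional
      (Cl.map (Ext.turn i t (C v) (hC v))).toAlgHom.toLinearMap
  rw [bott_apply, hF, map_mul, Cl.map_map]
  congr 1
  · rw [StarAlgHom.map_cfc (Cl.map _) _ _ hcont.continuousOn hm
      (hsa _) (by rw [Cl.map_vec]; exact hsa₁ _), Cl.map_vec]
    congr 2
    rw [Ext.turn_apply]
    have hz : Ext.inr W₁ (i 0) = 0 := by rw [map_zero, map_zero]
    change ‖(Ext.mk t (C v) : Ext W₁)‖ • _ + Ext.inr W₁ (i 0) = _
    rw [hz, add_zero]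
    by_cases h0 : (Ext.mk t (C v) : Ext W₁) = 0
    · rw [h0, norm_zero, zero_smul]
    · rw [Ext.unitDir, if_neg h0, smul_smul, mul_inv_cancel₀ (norm_ne_zero_iff.2 h0), one_smul]
  · congr 2
    ext1 y
    exact Ext.turn_inr i t (C v) (hC v) y

/-- The `*`-homomorphism induced by a linear isomorphism `ψ : E₁ → E` of the domains and an
isometry `j : W → W₁` of the Clifford variables: `f ⊗̂ u ↦ f ⊗̂ (v ↦ j(u(ψ(v))))`. -/
def push (ψ : E₁ ≃ₗ[ℝ] E) (j : W →ₗᵢ[ℝ] W₁) : SC E W →⋆ₙₐ[ℂ] SC E₁ W₁ :=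
  SymC0.homMk (fun _ => Cl.map (Ext.map j)) (fun z => (z.1, ψ z.2))
    (fun F => by
      have hψ : Continuous ψ := ψ.toLinearMap.continuous_of_finiteDimensional
      have hm : Continuous (Cl.map (Ext.map j)) :=
        LinearMap.continuous_of_finiteDimensional (Cl.map (Ext.map j)).toAlgHom.toLinearMap
      exact hm.comp (F.continuous.comp (continuous_fst.prodMk (hψ.comp continuous_snd))))
    (fun F => by
      have hψ : Tendsto (fun z : ℝ × E₁ => (z.1, ψ z.2)) (cocompact _) (cocompact _) :=
        (((ContinuousLinearEquiv.refl ℝ ℝ).prodCongr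
          ψ.toContinuousLinearEquiv).toHomeomorph.isClosedEmbedding).tendsto_cocompact
      refine squeeze_zero_norm (fun z => Cl.norm_map_le _ _) ?_
      simpa using (F.tendsto_zero.comp hψ).norm)
    (fun F t v => by
      rw [F.apply_neg, Cl.map_map, Cl.map_map]
      rfl)

lemma push_apply (ψ : E₁ ≃ₗ[ℝ] E) (j : W →ₗᵢ[ℝ] W₁) (F : SC E W) (t : ℝ) (v : E₁) :
    push ψ j F (t, v) = Cl.map (Ext.map j) (F (t, ψ v)) := rfl

end Suspension


/-! ## The polar decomposition of an isomorphism of real Hilbert spaces -/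

section Polar

open ContinuousLinearMap

lemma exists_sqrt_one_sub {V : Type*} [NormedAddCommGroup V] [InnerProductSpace ℝ V]
    [CompleteSpace V] (R : V →L[ℝ] V) (hR : IsSelfAdjoint R) (h : ‖R‖ < 1) :
    ∃ S : V →L[ℝ] V, S.IsPositive ∧ IsUnit S ∧ S * S = 1 - R ∧
      ∀ Z : V →L[ℝ] V, Commute R Z → Commute S Z := by
  set ρ : ℝ := 1 - √(1 - ‖R‖) with hρ
  have hs : 0 < √(1 - ‖R‖) := Real.sqrt_pos.2 (by linarith)
  have hs2 : √(1 - ‖R‖) * √(1 - ‖R‖) = 1 - ‖R‖ := Real.mul_self_sqrt (by linarith)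
  have hs1 : √(1 - ‖R‖) ≤ 1 := by
    nlinarith [norm_nonneg R]
  have hρ0 : 0 ≤ ρ := by linarith
  have hρ1 : ρ < 1 := by linarith
  have hρe : (1 / 2) * (‖R‖ + ρ * ρ) = ρ := by rw [hρ]; nlinarith
  let f : (V →L[ℝ] V) → (V →L[ℝ] V) := fun Y => (1 / 2 : ℝ) • (R + Y * Y)
  let s : Set (V →L[ℝ] V) :=
    {Y | ‖Y‖ ≤ ρ} ∩ ({Y | star Y = Y} ∩ ⋂ Z ∈ {Z : V →L[ℝ] V | Commute R Z}, {Y | Y * Z = Z * Y})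
  have hsc : IsComplete s := by
    refine IsClosed.isComplete ?_
    refine (isClosed_le continuous_norm continuous_const).inter
      ((isClosed_eq continuous_star continuous_id).inter ?_)
    exact isClosed_biInter fun Z _ =>
      isClosed_eq (continuous_id.mul continuous_const) (continuous_const.mul continuous_id)
  have hmaps : Set.MapsTo f s s := by
    rintro Y ⟨h1, h2, h3⟩
    have h1' : ‖Y‖ ≤ ρ := h1
    have h2' : star Y = Y := h2
    refine ⟨?_, ?_, ?_⟩
    · change ‖(1 / 2 : ℝ) • (R + Y * Y)‖ ≤ ρ
      rw [norm_smul, Real.norm_of_nonneg (by norm_num), ← hρe]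
      refine mul_le_mul_of_nonneg_left ?_ (by norm_num)
      refine (norm_add_le _ _).trans (add_le_add le_rfl ((norm_mul_le _ _).trans ?_))
      exact mul_le_mul h1' h1' (norm_nonneg _) hρ0
    · change star ((1 / 2 : ℝ) • (R + Y * Y)) = (1 / 2 : ℝ) • (R + Y * Y)
      rw [star_smul, star_add, star_mul, h2', hR.star_eq, star_trivial]
    · simp only [Set.mem_iInter] at h3 ⊢
      intro Z hZ
      have hY : Commute Y Z := h3 Z hZ
      have hZ' : Commute R Z := hZ
      have h7 : Commute (R + Y * Y) Z := hZ'.add_left (hY.mul_left hY)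
      change (1 / 2 : ℝ) • (R + Y * Y) * Z = Z * (1 / 2 : ℝ) • (R + Y * Y)
      rw [smul_mul_assoc, mul_smul_comm, h7.eq]
  have h0 : (0 : V →L[ℝ] V) ∈ s := by
    refine ⟨?_, ?_, ?_⟩
    · change ‖(0 : V →L[ℝ] V)‖ ≤ ρ
      rw [norm_zero]; exact hρ0
    · exact star_zero _
    · simp only [Set.mem_iInter]
      intro Z _
      change (0 : V →L[ℝ] V) * Z = Z * 0
      rw [zero_mul, mul_zero]
  have hcontr : ContractingWith ⟨ρ, hρ0⟩ (hmaps.restrict f s s) := by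
    refine ⟨hρ1, LipschitzWith.of_dist_le_mul ?_⟩
    rintro ⟨Y, hY, -⟩ ⟨Z, hZ, -⟩
    have hY : ‖Y‖ ≤ ρ := hY
    have hZ : ‖Z‖ ≤ ρ := hZ
    change dist ((1 / 2 : ℝ) • (R + Y * Y)) ((1 / 2 : ℝ) • (R + Z * Z)) ≤ ρ * dist Y Z
    rw [dist_eq_norm, dist_eq_norm, ← smul_sub, norm_smul, Real.norm_of_nonneg (by norm_num)]
    have h4 : R + Y * Y - (R + Z * Z) = Y * (Y - Z) + (Y - Z) * Z := by noncomm_ring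
    have h5 : ‖R + Y * Y - (R + Z * Z)‖ ≤ ρ * ‖Y - Z‖ + ‖Y - Z‖ * ρ := by
      rw [h4]
      refine (norm_add_le _ _).trans (add_le_add ((norm_mul_le _ _).trans ?_)
        ((norm_mul_le _ _).trans ?_))
      · exact mul_le_mul_of_nonneg_right hY (norm_nonneg _)
      · exact mul_le_mul_of_nonneg_left hZ (norm_nonneg _)
    linarith
  obtain ⟨Y, ⟨hY1, hY2, hY3⟩, hfix, -⟩ :=
    hcontr.exists_fixedPoint' hsc hmaps h0 (edist_ne_top _ _)
  have hY1 : ‖Y‖ ≤ ρ := hY1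
  have hY2 : star Y = Y := hY2
  have hfix : (1 / 2 : ℝ) • (R + Y * Y) = Y := hfix
  have hfix' : R + Y * Y = Y + Y := by
    conv_rhs => rw [← hfix]
    rw [← add_smul]; norm_num
  refine ⟨1 - Y, ?_, isUnit_one_sub_of_norm_lt_one (hY1.trans_lt hρ1), ?_, fun Z hZ => ?_⟩
  · rw [ContinuousLinearMap.isPositive_def']
    refine ⟨?_, fun x => ?_⟩
    · rw [IsSelfAdjoint, star_sub, star_one, hY2]
    · change 0 ≤ inner ℝ (x - Y x) x
      rw [inner_sub_left, real_inner_self_eq_norm_sq]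
      have h6 : inner ℝ (Y x) x ≤ ‖x‖ ^ 2 := by
        refine (real_inner_le_norm _ _).trans ?_
        rw [sq]
        refine mul_le_mul_of_nonneg_right ((Y.le_opNorm x).trans ?_) (norm_nonneg _)
        exact mul_le_of_le_one_left (norm_nonneg _) (hY1.trans hρ1.le)
      linarith
  · have : (1 - Y) * (1 - Y) = 1 - (Y + Y) + Y * Y := by noncomm_ring
    rw [this, ← hfix']; abel
  · have h3 : Commute Y Z := by
      simp only [Set.mem_iInter] at hY3
      exact hY3 Z hZ
    exact (Commute.one_left Z).sub_left h3

variable {V W : Type*} [NormedAddCommGroup V] [InnerProductSpace ℝ V] [CompleteSpace V]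
  [NormedAddCommGroup W] [InnerProductSpace ℝ W] [CompleteSpace W]

lemma exists_absOp (l : V ≃L[ℝ] W) :
    ∃ S : V ≃L[ℝ] V, (S : V →L[ℝ] V).IsPositive ∧
      (S : V →L[ℝ] V) * (S : V →L[ℝ] V) = adjoint (l : V →L[ℝ] W) ∘L (l : V →L[ℝ] W) ∧
      ∀ Z : V →L[ℝ] V, Commute (adjoint (l : V →L[ℝ] W) ∘L (l : V →L[ℝ] W)) Z →
        Commute (S : V →L[ℝ] V) Z := by
  set L : V →L[ℝ] W := (l : V →L[ℝ] W) with hL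
  set P : V →L[ℝ] V := adjoint L ∘L L with hP
  set M : ℝ := ‖L‖ ^ 2 + 1 with hM
  set K : ℝ := ‖(l.symm : W →L[ℝ] V)‖ + 1 with hK
  have hM1 : 1 ≤ M := by nlinarith [sq_nonneg ‖L‖]
  have hK1 : 1 ≤ K := by linarith [norm_nonneg (l.symm : W →L[ℝ] V)]
  have hM0 : 0 < M := by linarith
  have hPs : IsSelfAdjoint P := (isPositive_adjoint_comp_self L).isSelfAdjoint
  set R : V →L[ℝ] V := 1 - M⁻¹ • P with hRdef
  have hRs : IsSelfAdjoint R := by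
    rw [IsSelfAdjoint, hRdef, star_sub, star_one, star_smul, hPs.star_eq, star_trivial]
  have hlow : ∀ x, ‖x‖ ≤ K * ‖L x‖ := fun x => by
    have := (l.symm : W →L[ℝ] V).le_opNorm (L x)
    have h2 : (l.symm : W →L[ℝ] V) (L x) = x := l.symm_apply_apply x
    rw [h2] at this
    nlinarith [norm_nonneg (L x)]
  have hPx : ∀ x, inner ℝ x (P x) = ‖L x‖ ^ 2 := fun x => by
    rw [hP, ContinuousLinearMap.comp_apply, adjoint_inner_right, real_inner_self_eq_norm_sq]
  have hPn : ∀ x, ‖P x‖ ^ 2 ≤ M * ‖L x‖ ^ 2 := fun x => by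
    have h1 : ‖P x‖ ≤ ‖L‖ * ‖L x‖ := by
      have := (adjoint L).le_opNorm (L x)
      rwa [LinearIsometryEquiv.norm_map] at this
    have h2 : ‖P x‖ ^ 2 ≤ (‖L‖ * ‖L x‖) ^ 2 := by gcongr
    nlinarith [sq_nonneg ‖L x‖]
  have hMK : 0 < M * K ^ 2 := by positivity
  have hMK1 : 1 ≤ M * K ^ 2 := by nlinarith
  have hRn : ∀ x, ‖R x‖ ^ 2 ≤ (1 - (M * K ^ 2)⁻¹) * ‖x‖ ^ 2 := fun x => by
    have h1 : ‖R x‖ ^ 2 = ‖x‖ ^ 2 - 2 * (M⁻¹ * ‖L x‖ ^ 2) + (M⁻¹ * ‖P x‖) ^ 2 := by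
      have : R x = x - M⁻¹ • P x := rfl
      rw [this, norm_sub_sq_real, inner_smul_right, hPx, norm_smul, Real.norm_of_nonneg (by positivity)]
    have h2 : (M⁻¹ * ‖P x‖) ^ 2 ≤ M⁻¹ * ‖L x‖ ^ 2 := by
      have : (M⁻¹ * ‖P x‖) ^ 2 = M⁻¹ * (M⁻¹ * ‖P x‖ ^ 2) := by ring
      rw [this]
      refine mul_le_mul_of_nonneg_left ?_ (by positivity)
      rw [inv_mul_le_iff₀ hM0]
      exact hPn x
    have h3 : (M * K ^ 2)⁻¹ * ‖x‖ ^ 2 ≤ M⁻¹ * ‖L x‖ ^ 2 := by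
      rw [mul_inv, mul_assoc]
      refine mul_le_mul_of_nonneg_left ?_ (by positivity)
      rw [inv_mul_le_iff₀ (by positivity), ← mul_pow]
      exact pow_le_pow_left₀ (norm_nonneg _) (hlow x) 2
    rw [h1, sub_mul, one_mul]
    linarith
  have hinv1 : (M * K ^ 2)⁻¹ ≤ 1 := inv_le_one_of_one_le₀ hMK1
  have hinv0 : 0 < (M * K ^ 2)⁻¹ := inv_pos.2 hMK
  have hRlt : ‖R‖ < 1 := by
    refine lt_of_le_of_lt (R.opNorm_le_bound (M := √(1 - (M * K ^ 2)⁻¹)) (Real.sqrt_nonneg _)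
      fun x => ?_) ?_
    · refine (sq_le_sq₀ (norm_nonneg _) (by positivity)).1 ?_
      rw [mul_pow, Real.sq_sqrt (by linarith)]
      exact hRn x
    · rw [Real.sqrt_lt' one_pos]; linarith
  obtain ⟨S, hS1, hS2, hS3, hS4⟩ := exists_sqrt_one_sub R hRs hRlt
  have hsM : √M ≠ 0 := (Real.sqrt_pos.2 hM0).ne'
  have hunit : IsUnit (√M • S) := by
    obtain ⟨u, rfl⟩ := hS2
    exact ((Units.mk0 (√M) hsM) • u).isUnit
  obtain ⟨u, hu⟩ := hunit
  refine ⟨ContinuousLinearEquiv.ofUnit u, ?_⟩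
  have hcoe : ((ContinuousLinearEquiv.ofUnit u : V ≃L[ℝ] V) : V →L[ℝ] V) = √M • S := by
    rw [← hu]; rfl
  rw [hcoe]
  refine ⟨hS1.smul_of_nonneg (Real.sqrt_nonneg _), ?_, fun Z hZ => ?_⟩
  · rw [smul_mul_smul_comm, Real.mul_self_sqrt hM0.le, hS3, hRdef, sub_sub_cancel, smul_smul,
      mul_inv_cancel₀ hM0.ne', one_smul]
  · exact (hS4 Z ((Commute.one_left Z).sub_left (hZ.smul_left _))).smul_left _

/-- The positive square root `(l* l)^(1/2)` of an isomorphism `l` of real Hilbert spaces (the unique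
positive `S` with `S * S = l* l`). -/
def absOp (l : V ≃L[ℝ] W) : V ≃L[ℝ] V := (exists_absOp l).choose

lemma absOp_isPositive (l : V ≃L[ℝ] W) : (absOp l : V →L[ℝ] V).IsPositive :=
  (exists_absOp l).choose_spec.1

lemma absOp_mul_self (l : V ≃L[ℝ] W) : (absOp l : V →L[ℝ] V) * (absOp l : V →L[ℝ] V) =
    adjoint (l : V →L[ℝ] W) ∘L (l : V →L[ℝ] W) :=
  (exists_absOp l).choose_spec.2.1

lemma absOp_commute (l : V ≃L[ℝ] W) (Z : V →L[ℝ] V)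
    (hZ : Commute (adjoint (l : V →L[ℝ] W) ∘L (l : V →L[ℝ] W)) Z) :
    Commute (absOp l : V →L[ℝ] V) Z :=
  (exists_absOp l).choose_spec.2.2 Z hZ

lemma norm_absOp (l : V ≃L[ℝ] W) (x : V) : ‖absOp l x‖ = ‖l x‖ := by
  have h : ‖absOp l x‖ ^ 2 = ‖l x‖ ^ 2 := by
    rw [← real_inner_self_eq_norm_sq, ← real_inner_self_eq_norm_sq]
    have h1 : inner ℝ (absOp l x) (absOp l x) = inner ℝ (absOp l (absOp l x)) x :=
      ((absOp_isPositive l).isSymmetric (absOp l x) x).symm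
    have h2 : absOp l (absOp l x) = adjoint (l : V →L[ℝ] W) (l x) :=
      congrArg (fun A : V →L[ℝ] V => A x) (absOp_mul_self l)
    rw [h1, h2, adjoint_inner_left]
    rfl
  exact (sq_eq_sq₀ (norm_nonneg _) (norm_nonneg _)).1 h

/-- The unitary `u` of the polar decomposition `l = u (l* l)^(1/2)`. -/
def polarUnitary (l : V ≃L[ℝ] W) : V ≃ₗᵢ[ℝ] W where
  toLinearEquiv := ((absOp l).symm.trans l).toLinearEquiv
  norm_map' x := by
    change ‖l ((absOp l).symm x)‖ = ‖x‖
    rw [← norm_absOp, ContinuousLinearEquiv.apply_symm_apply]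

lemma polarUnitary_absOp (l : V ≃L[ℝ] W) (x : V) : polarUnitary l (absOp l x) = l x := by
  change l ((absOp l).symm (absOp l x)) = l x
  rw [ContinuousLinearEquiv.symm_apply_apply]

/-- The operator `l̄* ∘ l` of an isomorphism `l`, where `l̄` is the unitary of the polar
decomposition. -/
def cliffordOp (l : V ≃L[ℝ] W) : V ≃L[ℝ] V :=
  l.trans (polarUnitary l).symm.toContinuousLinearEquiv

lemma cliffordOp_apply (l : V ≃L[ℝ] W) (x : V) :
    cliffordOp l x = (polarUnitary l).symm (l x) := rfl

lemma cliffordOp_eq_absOp (l : V ≃L[ℝ] W) (x : V) : cliffordOp l x = absOp l x := by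
  rw [cliffordOp_apply, ← polarUnitary_absOp, LinearIsometryEquiv.symm_apply_apply]

lemma inner_cliffordOp_left (l : V ≃L[ℝ] W) (x y : V) :
    inner ℝ (cliffordOp l x) y = inner ℝ x (cliffordOp l y) := by
  rw [cliffordOp_eq_absOp, cliffordOp_eq_absOp]
  exact (absOp_isPositive l).isSymmetric x y

lemma eq_zero_of_inner_cliffordOp (l : V ≃L[ℝ] W) {x : V}
    (h : inner ℝ (cliffordOp l x) x = 0) : x = 0 := by
  rw [cliffordOp_eq_absOp] at h
  by_contra hx
  have hne : absOp l x ≠ 0 := fun h0 => hx ((absOp l).map_eq_zero_iff.1 h0)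
  have hsym : ∀ u v, inner ℝ (absOp l u) v = inner ℝ u (absOp l v) :=
    (absOp_isPositive l).isSymmetric
  have hpos : ∀ u, 0 ≤ inner ℝ (absOp l u) u := fun u => (absOp_isPositive l).inner_nonneg_left u
  set y := absOp l x with hy
  have hyy : 0 < ‖y‖ ^ 2 := by positivity
  have key : ∀ r : ℝ, 0 ≤ 2 * r * ‖y‖ ^ 2 + r ^ 2 * inner ℝ (absOp l y) y := fun r => by
    have h1 := hpos (x + r • y)
    rw [map_add, map_smul, inner_add_left, inner_add_right, inner_add_right, inner_smul_left,
      inner_smul_left, inner_smul_right, inner_smul_right, hsym y x, ← hy, h,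
      real_inner_self_eq_norm_sq] at h1
    simp only [conj_trivial] at h1
    nlinarith
  set q := inner ℝ (absOp l y) y
  have hq : 0 ≤ q := hpos y
  have h2 := key (-(‖y‖ ^ 2 / (q + 1)))
  have h3 : ‖y‖ ^ 2 / (q + 1) * (q + 1) = ‖y‖ ^ 2 := div_mul_cancel₀ _ (by positivity)
  set d := ‖y‖ ^ 2 / (q + 1)
  have hd : 0 < d := by positivity
  rw [← h3] at h2
  nlinarith [mul_pos hd hd, mul_nonneg (mul_pos hd hd).le hq]

/-- `l` is asymptotically unitary: for every `ε > 0` there is a finite-dimensional subspace `E`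
with `‖(l - l̄)|E^⊥‖ < ε`, where `l̄` is the unitary of the polar decomposition of `l`. -/
def AsymptoticallyUnitary (l : V ≃L[ℝ] W) : Prop :=
  ∀ ε : ℝ, 0 < ε → ∃ E : Submodule ℝ V, FiniteDimensional ℝ E ∧
    ‖((l : V →L[ℝ] W) - ((polarUnitary l).toContinuousLinearEquiv : V →L[ℝ] W)) ∘L
      Eᗮ.subtypeL‖ < ε

/-- If `l` intertwines isometries, then so does `l̄* ∘ l`. -/
lemma cliffordOp_equivariant (l : V ≃L[ℝ] W) (g : V ≃ₗᵢ[ℝ] V) (k : W ≃ₗᵢ[ℝ] W)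
    (h : ∀ x, l (g x) = k (l x)) (x : V) : cliffordOp l (g x) = g (cliffordOp l x) := by
  rw [cliffordOp_eq_absOp, cliffordOp_eq_absOp]
  have hc : Commute (adjoint (l : V →L[ℝ] W) ∘L (l : V →L[ℝ] W))
      (g.toContinuousLinearEquiv : V →L[ℝ] V) := by
    ext1 x
    change adjoint (l : V →L[ℝ] W) (l (g x)) = g (adjoint (l : V →L[ℝ] W) (l x))
    refine ext_inner_right ℝ fun y => ?_
    have hy : y = g (g.symm y) := (g.apply_symm_apply y).symm
    rw [adjoint_inner_left, h]
    nth_rewrite 1 [hy]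
    nth_rewrite 2 [hy]
    have e1 : (l : V →L[ℝ] W) (g (g.symm y)) = k (l (g.symm y)) := h _
    rw [e1, k.inner_map_map, g.inner_map_map, adjoint_inner_left]
    rfl
  exact congrArg (fun A : V →L[ℝ] V => A x) (absOp_commute l _ hc)

end Polar


/-! ## The direct limit of a directed family of `C*`-algebras -/

section Limit

variable {ι : Type*} [SemilatticeSup ι] (A : ι → Type*) [∀ a, NonUnitalCStarAlgebra (A a)]

/-- The bounded nets `(x_b)` with `‖x_b‖ → 0`. -/
def nullNets : Submodule ℂ (lp A ∞) where
  carrier := {x | Tendsto (fun b => ‖x b‖) atTop (𝓝 0)}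
  add_mem' {x y} hx hy := by
    have h := Tendsto.add hx hy
    rw [add_zero] at h
    exact squeeze_zero (fun _ => norm_nonneg _) (fun b => norm_add_le (x b) (y b)) h
  zero_mem' := by
    refine tendsto_const_nhds.congr fun b => ?_
    rw [lp.coeFn_zero, Pi.zero_apply, norm_zero]
  smul_mem' c x hx := by
    have h := Tendsto.const_mul ‖c‖ hx
    rw [mul_zero] at h
    refine h.congr fun b => ?_
    rw [lp.coeFn_smul, Pi.smul_apply, norm_smul]

variable {A}

lemma mem_nullNets {x : lp A ∞} : x ∈ nullNets A ↔ Tendsto (fun b => ‖x b‖) atTop (𝓝 0) := Iff.rfl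

lemma mul_mem_nullNets_left (x : lp A ∞) {y : lp A ∞} (hy : y ∈ nullNets A) :
    x * y ∈ nullNets A := by
  have h := Tendsto.const_mul ‖x‖ (mem_nullNets.1 hy)
  rw [mul_zero] at h
  refine squeeze_zero (fun _ => norm_nonneg _) (fun b => ?_) h
  exact (norm_mul_le _ _).trans
    (mul_le_mul_of_nonneg_right (lp.norm_apply_le_norm ENNReal.top_ne_zero x b) (norm_nonneg _))

lemma mul_mem_nullNets_right {x : lp A ∞} (hx : x ∈ nullNets A) (y : lp A ∞) :
    x * y ∈ nullNets A := by
  have h := Tendsto.mul_const ‖y‖ (mem_nullNets.1 hx)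
  rw [zero_mul] at h
  refine squeeze_zero (fun _ => norm_nonneg _) (fun b => ?_) h
  exact (norm_mul_le _ _).trans
    (mul_le_mul_of_nonneg_left (lp.norm_apply_le_norm ENNReal.top_ne_zero y b) (norm_nonneg _))

lemma star_mem_nullNets {x : lp A ∞} (hx : x ∈ nullNets A) : star x ∈ nullNets A := by
  refine (mem_nullNets.1 hx).congr fun b => ?_
  rw [lp.star_apply, norm_star]

instance instIsClosedNullNets [Nonempty ι] : IsClosed (nullNets A : Set (lp A ∞)) := by
  refine isClosed_of_closure_subset fun x hx => ?_
  refine Metric.tendsto_atTop.2 fun ε hε => ?_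
  obtain ⟨y, hy, hxy⟩ := Metric.mem_closure_iff.1 hx (ε / 2) (half_pos hε)
  obtain ⟨N, hN⟩ := Metric.tendsto_atTop.1 (mem_nullNets.1 hy) (ε / 2) (half_pos hε)
  refine ⟨N, fun b hb => ?_⟩
  have h1 := hN b hb
  rw [Real.dist_0_eq_abs, abs_norm] at h1 ⊢
  have h2 : ‖(x - y) b‖ ≤ ‖x - y‖ := lp.norm_apply_le_norm ENNReal.top_ne_zero _ b
  rw [dist_eq_norm] at hxy
  have h3 : x b = (x - y) b + y b := by rw [lp.coeFn_sub, Pi.sub_apply, sub_add_cancel]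
  rw [h3]
  exact (norm_add_le _ _).trans_lt (by linarith)

variable (A) in
/-- The `C*`-algebra of the bounded nets `(x_b)`, divided by the nets with `‖x_b‖ → 0`. -/
def NetAlg : Type _ := lp A ∞ ⧸ nullNets A

namespace NetAlg

variable [Nonempty ι]

instance : NormedAddCommGroup (NetAlg A) :=
  inferInstanceAs (NormedAddCommGroup (lp A ∞ ⧸ nullNets A))

instance : NormedSpace ℂ (NetAlg A) :=
  inferInstanceAs (NormedSpace ℂ (lp A ∞ ⧸ nullNets A))

instance : CompleteSpace (NetAlg A) :=
  inferInstanceAs (CompleteSpace (lp A ∞ ⧸ nullNets A))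

variable (A) in
/-- The class of a bounded net. -/
def cls : lp A ∞ →ₗ[ℂ] NetAlg A := (nullNets A).mkQ

lemma cls_surjective : Function.Surjective (cls A) := (nullNets A).mkQ_surjective

lemma cls_eq_iff {x y : lp A ∞} : cls A x = cls A y ↔ x - y ∈ nullNets A :=
  Submodule.Quotient.eq _

lemma norm_cls_le (x : lp A ∞) : ‖cls A x‖ ≤ ‖x‖ := Submodule.Quotient.norm_mk_le _ x

lemma exists_lift (x : NetAlg A) {ε : ℝ} (hε : 0 < ε) : ∃ y, cls A y = x ∧ ‖y‖ < ‖x‖ + ε :=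
  Submodule.Quotient.norm_mk_lt x hε

instance : Mul (NetAlg A) where
  mul := Quotient.map₂ (· * ·) fun x x' hx y y' hy => by
    have hx : x - x' ∈ nullNets A := (Submodule.quotientRel_def _).1 hx
    have hy : y - y' ∈ nullNets A := (Submodule.quotientRel_def _).1 hy
    refine (Submodule.quotientRel_def _).2 ?_
    have : x * y - x' * y' = (x - x') * y + x' * (y - y') := by noncomm_ring
    rw [this]
    exact add_mem (mul_mem_nullNets_right hx _) (mul_mem_nullNets_left _ hy)

lemma cls_mul (x y : lp A ∞) : cls A (x * y) = cls A x * cls A y := rfl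

instance : Star (NetAlg A) where
  star := Quotient.map star fun x x' hx => by
    have hx : x - x' ∈ nullNets A := (Submodule.quotientRel_def _).1 hx
    refine (Submodule.quotientRel_def _).2 ?_
    rw [← star_sub]
    exact star_mem_nullNets hx

lemma cls_star (x : lp A ∞) : cls A (star x) = star (cls A x) := rfl

instance : NonUnitalRing (NetAlg A) where
  __ := (inferInstance : AddCommGroup (NetAlg A))
  left_distrib x y z := by
    obtain ⟨x, rfl⟩ := cls_surjective x
    obtain ⟨y, rfl⟩ := cls_surjective y
    obtain ⟨z, rfl⟩ := cls_surjective z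
    rw [← map_add, ← cls_mul, ← cls_mul, ← cls_mul, ← map_add, mul_add]
  right_distrib x y z := by
    obtain ⟨x, rfl⟩ := cls_surjective x
    obtain ⟨y, rfl⟩ := cls_surjective y
    obtain ⟨z, rfl⟩ := cls_surjective z
    rw [← map_add, ← cls_mul, ← cls_mul, ← cls_mul, ← map_add, add_mul]
  zero_mul x := by
    obtain ⟨x, rfl⟩ := cls_surjective x
    rw [← map_zero (cls A), ← cls_mul, zero_mul]
  mul_zero x := by
    obtain ⟨x, rfl⟩ := cls_surjective x
    rw [← map_zero (cls A), ← cls_mul, mul_zero]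
  mul_assoc x y z := by
    obtain ⟨x, rfl⟩ := cls_surjective x
    obtain ⟨y, rfl⟩ := cls_surjective y
    obtain ⟨z, rfl⟩ := cls_surjective z
    rw [← cls_mul, ← cls_mul, ← cls_mul, ← cls_mul, mul_assoc]

instance : StarRing (NetAlg A) where
  star_involutive x := by
    obtain ⟨x, rfl⟩ := cls_surjective x
    rw [← cls_star, ← cls_star, star_star]
  star_mul x y := by
    obtain ⟨x, rfl⟩ := cls_surjective x
    obtain ⟨y, rfl⟩ := cls_surjective y
    rw [← cls_mul, ← cls_star, ← cls_star, ← cls_star, ← cls_mul, star_mul]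
  star_add x y := by
    obtain ⟨x, rfl⟩ := cls_surjective x
    obtain ⟨y, rfl⟩ := cls_surjective y
    rw [← map_add, ← cls_star, ← cls_star, ← cls_star, ← map_add, star_add]

instance : NonUnitalNormedRing (NetAlg A) where
  __ := (inferInstance : NormedAddCommGroup (NetAlg A))
  __ := (inferInstance : NonUnitalRing (NetAlg A))
  norm_mul_le x y := by
    refine le_of_forall_pos_le_add fun ε hε => ?_
    have ht : Tendsto (fun δ : ℝ => (‖x‖ + δ) * (‖y‖ + δ)) (𝓝[>] 0)
        (𝓝 ((‖x‖ + 0) * (‖y‖ + 0))) :=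
      ((tendsto_const_nhds.add tendsto_id).mul (tendsto_const_nhds.add tendsto_id)).mono_left
        nhdsWithin_le_nhds
    rw [add_zero, add_zero] at ht
    refine (ge_of_tendsto ht ?_).trans (le_add_of_nonneg_right hε.le)
    filter_upwards [self_mem_nhdsWithin] with δ hδ
    obtain ⟨x', rfl, hx'⟩ := exists_lift x hδ
    obtain ⟨y', rfl, hy'⟩ := exists_lift y hδ
    rw [← cls_mul]
    refine (norm_cls_le _).trans ((norm_mul_le _ _).trans ?_)
    exact mul_le_mul hx'.le hy'.le (norm_nonneg _) ((norm_nonneg _).trans hx'.le)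

open Classical in
/-- If `‖x_b‖ ≤ r` for all large `b`, then the class of `(x_b)` has norm at most `r`. -/
lemma norm_cls_le_of_eventually {x : lp A ∞} {r : ℝ} (hr : 0 ≤ r)
    (h : ∀ᶠ b in atTop, ‖x b‖ ≤ r) : ‖cls A x‖ ≤ r := by
  obtain ⟨a, ha⟩ := eventually_atTop.1 h
  let y : lp A ∞ := ⟨fun b => if a ≤ b then x b else 0, memℓp_infty ⟨r, by
    rintro _ ⟨b, rfl⟩
    change ‖if a ≤ b then x b else 0‖ ≤ r
    split_ifs with hb
    · exact ha b hb
    · rw [norm_zero]; exact hr⟩⟩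
  have hxy : cls A x = cls A y := by
    refine cls_eq_iff.2 (mem_nullNets.2 ?_)
    refine tendsto_const_nhds.congr' ?_
    filter_upwards [eventually_ge_atTop a] with b hb
    change 0 = ‖x b - if a ≤ b then x b else 0‖
    rw [if_pos hb, sub_self, norm_zero]
  rw [hxy]
  refine (norm_cls_le y).trans (lp.norm_le_of_forall_le hr fun b => ?_)
  change ‖if a ≤ b then x b else 0‖ ≤ r
  split_ifs with hb
  · exact ha b hb
  · rw [norm_zero]; exact hr

/-- The norm of the class of a net is the limit of the norms. -/
lemma norm_cls_of_tendsto {x : lp A ∞} {r : ℝ} (h : Tendsto (fun b => ‖x b‖) atTop (𝓝 r)) :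
    ‖cls A x‖ = r := by
  have hr : 0 ≤ r := ge_of_tendsto' h fun b => norm_nonneg _
  refine le_antisymm (le_of_forall_pos_le_add fun ε hε => ?_) (le_of_forall_pos_le_add fun ε hε => ?_)
  · exact norm_cls_le_of_eventually (by positivity) (h.eventually_le_const (by linarith))
  · obtain ⟨y, hy, hy'⟩ := exists_lift (cls A x) hε
    have h1 := h.sub (mem_nullNets.1 (cls_eq_iff.1 hy.symm))
    rw [sub_zero] at h1
    refine (le_of_tendsto' h1 fun b => ?_).trans hy'.le
    have h2 : ‖y b‖ ≤ ‖y‖ := lp.norm_apply_le_norm ENNReal.top_ne_zero _ b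
    have h3 : ‖x b‖ ≤ ‖(x - y) b‖ + ‖y b‖ := by
      have : x b = (x - y) b + y b := by rw [lp.coeFn_sub, Pi.sub_apply, sub_add_cancel]
      conv_lhs => rw [this]
      exact norm_add_le _ _
    linarith

instance : NonUnitalCStarAlgebra (NetAlg A) where
  smul_assoc c x y := by
    obtain ⟨x, rfl⟩ := cls_surjective x
    obtain ⟨y, rfl⟩ := cls_surjective y
    rw [smul_eq_mul, smul_eq_mul, ← map_smul, ← cls_mul, ← cls_mul, ← map_smul, smul_mul_assoc]
  smul_comm c x y := by
    obtain ⟨x, rfl⟩ := cls_surjective x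
    obtain ⟨y, rfl⟩ := cls_surjective y
    rw [smul_eq_mul, smul_eq_mul, ← map_smul, ← cls_mul, ← cls_mul, ← map_smul, mul_smul_comm]
  star_smul c x := by
    obtain ⟨x, rfl⟩ := cls_surjective x
    rw [← map_smul, ← cls_star, ← cls_star, ← map_smul, star_smul]
  norm_mul_self_le x := by
    refine le_of_forall_pos_le_add fun ε hε => ?_
    obtain ⟨x, rfl⟩ := cls_surjective x
    rw [← cls_star, ← cls_mul]
    obtain ⟨y, hy, hy'⟩ := exists_lift (cls A (star x * x)) (half_pos hε)
    set r := ‖cls A (star x * x)‖ + ε with hr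
    have hr0 : 0 ≤ r := by positivity
    have key : ‖cls A x‖ ≤ √r := by
      refine norm_cls_le_of_eventually (Real.sqrt_nonneg _) ?_
      have h1 := (mem_nullNets.1 (cls_eq_iff.1 hy.symm)).eventually_le_const (half_pos hε)
      filter_upwards [h1] with b hb
      refine Real.le_sqrt_of_sq_le ?_
      have h2 : ‖y b‖ ≤ ‖y‖ := lp.norm_apply_le_norm ENNReal.top_ne_zero _ b
      have h3 : ‖(star x * x) b‖ ≤ ‖(star x * x - y) b‖ + ‖y b‖ := by
        have : (star x * x) b = (star x * x - y) b + y b := by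
          rw [lp.coeFn_sub, Pi.sub_apply, sub_add_cancel]
        conv_lhs => rw [this]
        exact norm_add_le _ _
      have h4 : ‖(star x * x) b‖ = ‖x b‖ * ‖x b‖ := CStarRing.norm_star_mul_self (x := x b)
      rw [sq, ← h4]
      linarith
    calc ‖cls A x‖ * ‖cls A x‖ ≤ √r * √r := mul_le_mul key key (norm_nonneg _) (Real.sqrt_nonneg _)
      _ = r := Real.mul_self_sqrt hr0

end NetAlg

variable (β : ∀ a b, a ≤ b → A a →⋆ₙₐ[ℂ] A b)

open Classical in
/-- The net `{β_ba(v)}_{b ≥ a}` (and `0` at the other indices). -/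
def orbitNet (a : ι) (v : A a) : lp A ∞ :=
  ⟨fun b => if h : a ≤ b then β a b h v else 0, memℓp_infty ⟨‖v‖, by
    rintro _ ⟨b, rfl⟩
    change ‖if h : a ≤ b then β a b h v else 0‖ ≤ ‖v‖
    split_ifs with hb
    · exact NonUnitalStarAlgHom.norm_apply_le _ v
    · rw [norm_zero]; exact norm_nonneg v⟩⟩

lemma orbitNet_apply {a b : ι} (h : a ≤ b) (v : A a) : orbitNet β a v b = β a b h v := dif_pos h

lemma orbitNet_of_not {a b : ι} (h : ¬ a ≤ b) (v : A a) : orbitNet β a v b = 0 := dif_neg h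

lemma orbitNet_eq {a : ι} {v : A a} {x : lp A ∞} (h1 : ∀ b (h : a ≤ b), x b = β a b h v)
    (h2 : ∀ b, ¬ a ≤ b → x b = 0) : orbitNet β a v = x := by
  ext b
  by_cases h : a ≤ b
  · rw [orbitNet_apply β h, h1 b h]
  · rw [orbitNet_of_not β h, h2 b h]

lemma orbitNet_smul (a : ι) (c : ℂ) (v : A a) : orbitNet β a (c • v) = c • orbitNet β a v := by
  refine orbitNet_eq β (fun b h => ?_) fun b h => ?_ <;> rw [lp.coeFn_smul, Pi.smul_apply]
  · rw [orbitNet_apply β h, map_smul]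
  · rw [orbitNet_of_not β h, smul_zero]

lemma orbitNet_zero (a : ι) : orbitNet β a 0 = 0 := by
  refine orbitNet_eq β (fun b h => ?_) fun b h => ?_ <;> rw [lp.coeFn_zero, Pi.zero_apply]
  rw [map_zero]

lemma orbitNet_add (a : ι) (v w : A a) :
    orbitNet β a (v + w) = orbitNet β a v + orbitNet β a w := by
  refine orbitNet_eq β (fun b h => ?_) fun b h => ?_ <;> rw [lp.coeFn_add, Pi.add_apply]
  · rw [orbitNet_apply β h, orbitNet_apply β h, map_add]
  · rw [orbitNet_of_not β h, orbitNet_of_not β h, add_zero]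

lemma orbitNet_mul (a : ι) (v w : A a) :
    orbitNet β a (v * w) = orbitNet β a v * orbitNet β a w := by
  refine orbitNet_eq β (fun b h => ?_) fun b h => ?_ <;> rw [lp.infty_coeFn_mul, Pi.mul_apply]
  · rw [orbitNet_apply β h, orbitNet_apply β h, map_mul]
  · rw [orbitNet_of_not β h, orbitNet_of_not β h, zero_mul]

lemma orbitNet_star (a : ι) (v : A a) : orbitNet β a (star v) = star (orbitNet β a v) := by
  refine orbitNet_eq β (fun b h => ?_) fun b h => ?_ <;> rw [lp.star_apply]
  · rw [orbitNet_apply β h, map_star]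
  · rw [orbitNet_of_not β h, star_zero]

variable [Nonempty ι]

/-- The closed `*`-subalgebra which is generated by the classes of the nets `{β_ba(v)}_{b ≥ a}`. -/
def limSub : NonUnitalStarSubalgebra ℂ (NetAlg A) :=
  (NonUnitalStarAlgebra.adjoin ℂ
    {x | ∃ (a : ι) (v : A a), NetAlg.cls A (orbitNet β a v) = x}).topologicalClosure

instance instIsClosedLimSub : IsClosed (limSub β : Set (NetAlg A)) :=
  NonUnitalStarSubalgebra.isClosed_topologicalClosure _

/-- The direct limit `C*`-algebra of a directed family `β_ba : A_a → A_b` (which need not commute):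
the closure of the algebra generated by the classes of the nets `{β_ba(v)}_{b ≥ a}`, `v ∈ A_a`,
divided by the nets which converge to `0` in norm, with the norm `lim_b ‖x_b‖`
(see `NetAlg.norm_cls_of_tendsto`). -/
def DirLim : Type _ := ↥(limSub β)

instance : NonUnitalCStarAlgebra (DirLim β) := inferInstanceAs (NonUnitalCStarAlgebra ↥(limSub β))

/-- The canonical `*`-homomorphism of `A_a` to the direct limit, which takes `v` to the class of
`{β_ba(v)}_{b ≥ a}`. -/
def toLim (a : ι) : A a →⋆ₙₐ[ℂ] DirLim β where
  toFun v := ⟨NetAlg.cls A (orbitNet β a v),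
    NonUnitalStarSubalgebra.le_topologicalClosure _
      (NonUnitalStarAlgebra.subset_adjoin ℂ _ ⟨a, v, rfl⟩)⟩
  map_smul' c v := Subtype.ext
    ((congrArg (NetAlg.cls A) (orbitNet_smul β a c v)).trans (map_smul _ _ _))
  map_zero' := Subtype.ext ((congrArg (NetAlg.cls A) (orbitNet_zero β a)).trans (map_zero _))
  map_add' v w := Subtype.ext
    ((congrArg (NetAlg.cls A) (orbitNet_add β a v w)).trans (map_add _ _ _))
  map_mul' v w := Subtype.ext
    ((congrArg (NetAlg.cls A) (orbitNet_mul β a v w)).trans (NetAlg.cls_mul _ _))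
  map_star' v := Subtype.ext
    ((congrArg (NetAlg.cls A) (orbitNet_star β a v)).trans (NetAlg.cls_star _))

/-- If the norms `‖β_ba(v)‖` converge, then `‖v‖ = lim_b ‖β_ba(v)‖` in the direct limit. -/
lemma norm_toLim_of_tendsto {a : ι} {v : A a} {f : ι → ℝ} {r : ℝ}
    (hf : ∀ b (h : a ≤ b), f b = ‖β a b h v‖) (h : Tendsto f atTop (𝓝 r)) :
    ‖toLim β a v‖ = r := by
  refine NetAlg.norm_cls_of_tendsto (h.congr' ?_)
  filter_upwards [eventually_ge_atTop a] with b hb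
  rw [orbitNet_apply β hb, hf b hb]

end Limit


/-! ## Finite-dimensional subspaces -/

section FinSub

variable {V W : Type*} [NormedAddCommGroup V] [InnerProductSpace ℝ V] [CompleteSpace V]
  [NormedAddCommGroup W] [InnerProductSpace ℝ W] [CompleteSpace W]

variable (V) in
/-- The finite-dimensional linear subspaces of `V`, ordered by inclusion. -/
abbrev FinSub : Type _ := {E : Submodule ℝ V // FiniteDimensional ℝ E}

namespace FinSub

instance (a : FinSub V) : FiniteDimensional ℝ a.1 := a.2

instance (a : FinSub V) : CompleteSpace a.1 := FiniteDimensional.complete ℝ a.1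

instance : SemilatticeSup (FinSub V) :=
  Subtype.semilatticeSup fun {E F} (_ : FiniteDimensional ℝ E) (_ : FiniteDimensional ℝ F) =>
    Submodule.finiteDimensional_sup E F

instance : Nonempty (FinSub V) := ⟨⟨⊥, inferInstance⟩⟩

/-- The inclusion of `E_a` in `E_b`. -/
def incl {a b : FinSub V} (h : a ≤ b) : a.1 →ₗᵢ[ℝ] b.1 where
  toLinearMap := Submodule.inclusion h
  norm_map' _ := rfl

lemma coe_incl {a b : FinSub V} (h : a ≤ b) (x : a.1) : (incl h x : V) = x := rfl

/-- The restriction to `E_a` of the orthogonal projection of `V` to `E_b`. -/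
def proj (a b : FinSub V) : a.1 →ₗ[ℝ] b.1 :=
  (b.1.orthogonalProjectionOnto : V →ₗ[ℝ] b.1) ∘ₗ a.1.subtype

lemma inner_proj (a b : FinSub V) (x : a.1) (y : b.1) :
    inner ℝ (proj a b x : V) (y : V) = inner ℝ (x : V) (y : V) := by
  have h := b.1.starProjection_inner_eq_zero (x : V) y y.2
  rw [inner_sub_left, sub_eq_zero] at h
  exact h.symm

lemma inner_eq_zero_of_proj (a b : FinSub V) {x : a.1} (h : proj a b x = 0) {y : V}
    (hy : y ∈ b.1) : inner ℝ (x : V) y = 0 := by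
  rw [← inner_proj a b x ⟨y, hy⟩, h, Submodule.coe_zero, inner_zero_left]

/-- The orthogonal complement `E_ba` of `E_a` in `E_b`. -/
def diff (a b : FinSub V) : FinSub V := ⟨a.1ᗮ ⊓ b.1, Submodule.finiteDimensional_inf_right _ _⟩

lemma diff_le (a b : FinSub V) : diff a b ≤ b := inf_le_right (a := a.1ᗮ) (b := b.1)

lemma finrank_diff {a b : FinSub V} (h : a ≤ b) :
    Module.finrank ℝ a.1 + Module.finrank ℝ (diff a b).1 = Module.finrank ℝ b.1 :=
  Submodule.finrank_add_inf_finrank_orthogonal h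

lemma inner_diff {a b : FinSub V} (x : (diff a b).1) {y : V} (hy : y ∈ a.1) :
    inner ℝ (x : V) y = 0 := (Submodule.mem_orthogonal' _ _).1 x.2.1 y hy

lemma eq_zero_of_proj {a b : FinSub V} {v : b.1} (h1 : proj b a v = 0)
    (h2 : proj b (diff a b) v = 0) : v = 0 := by
  have h3 : (v : V) ∈ (diff a b).1 :=
    ⟨(Submodule.mem_orthogonal' _ _).2 fun y hy => inner_eq_zero_of_proj b a h1 hy, v.2⟩
  have h4 := inner_eq_zero_of_proj b (diff a b) h2 h3
  exact Subtype.ext (inner_self_eq_zero.1 h4)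

/-- The unitary of the polar decomposition of the orthogonal projection `E_a → E_b`, if the latter
is an isomorphism. -/
def projUnitary (a b : FinSub V) (h : Function.Bijective (proj a b)) : a.1 ≃ₗᵢ[ℝ] b.1 :=
  polarUnitary (LinearEquiv.ofBijective (proj a b) h).toContinuousLinearEquiv

/-- The subspace `Ē = l̄*(l(E))`. -/
def bar (l : V ≃L[ℝ] W) (a : FinSub V) : FinSub V :=
  ⟨a.1.map (cliffordOp l : V →ₗ[ℝ] V), inferInstance⟩

lemma bar_mono (l : V ≃L[ℝ] W) {a b : FinSub V} (h : a ≤ b) : bar l a ≤ bar l b :=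
  Submodule.map_mono h

/-- The isomorphism `l̄* ∘ l : E → Ē`. -/
def toBar (l : V ≃L[ℝ] W) (a : FinSub V) : a.1 ≃ₗ[ℝ] (bar l a).1 :=
  (cliffordOp l).toLinearEquiv.submoduleMap a.1

lemma coe_toBar (l : V ≃L[ℝ] W) (a : FinSub V) (x : a.1) :
    (toBar l a x : V) = cliffordOp l (x : V) := rfl

lemma finrank_bar (l : V ≃L[ℝ] W) (a : FinSub V) :
    Module.finrank ℝ (bar l a).1 = Module.finrank ℝ a.1 := (toBar l a).finrank_eq.symm

/-- The orthogonal projection `Ē → E` is an isomorphism. -/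
lemma bijective_proj_bar (l : V ≃L[ℝ] W) (a : FinSub V) :
    Function.Bijective (proj (bar l a) a) := by
  have hinj : Function.Injective (proj (bar l a) a) := by
    refine (injective_iff_map_eq_zero _).2 fun x hx => ?_
    obtain ⟨e, rfl⟩ := (toBar l a).surjective x
    have h1 := inner_eq_zero_of_proj _ _ hx e.2
    rw [coe_toBar] at h1
    have h2 : e = 0 := Subtype.ext (eq_zero_of_inner_cliffordOp l h1)
    rw [h2, map_zero]
  exact ⟨hinj, (LinearMap.injective_iff_surjective_of_finrank_eq_finrank (finrank_bar l a)).1 hinj⟩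

/-- The orthogonal projection of `Ē_ba` to the orthogonal complement of `Ē_a` in `Ē_b` is an
isomorphism. -/
lemma bijective_proj_diff (l : V ≃L[ℝ] W) {a b : FinSub V} (h : a ≤ b) :
    Function.Bijective (proj (bar l (diff a b)) (diff (bar l a) (bar l b))) := by
  have hinj : Function.Injective (proj (bar l (diff a b)) (diff (bar l a) (bar l b))) := by
    refine (injective_iff_map_eq_zero _).2 fun x hx => ?_
    have hxb : (x : V) ∈ (bar l b).1 := bar_mono l (diff_le a b) x.2
    set p : V := (bar l a).1.starProjection (x : V) with hp
    have hpa : p ∈ (bar l a).1 := Submodule.starProjection_apply_mem _ _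
    have hd : (x : V) - p ∈ (diff (bar l a) (bar l b)).1 :=
      ⟨Submodule.sub_starProjection_mem_orthogonal _, sub_mem hxb (bar_mono l h hpa)⟩
    have h1 : inner ℝ (x : V) ((x : V) - p) = 0 := inner_eq_zero_of_proj _ _ hx hd
    have h2 : inner ℝ p ((x : V) - p) = 0 := by
      rw [real_inner_comm]
      exact (bar l a).1.starProjection_inner_eq_zero (x : V) p hpa
    have h3 : (x : V) - p = 0 := by
      refine (inner_self_eq_zero (𝕜 := ℝ)).1 ?_
      rw [inner_sub_left, h1, h2, sub_zero]
    have hxa : (x : V) ∈ (bar l a).1 := by rw [sub_eq_zero.1 h3]; exact hpa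
    obtain ⟨e, he⟩ := (toBar l a).surjective ⟨(x : V), hxa⟩
    obtain ⟨z, rfl⟩ := (toBar l (diff a b)).surjective x
    have he' : cliffordOp l (e : V) = cliffordOp l (z : V) := congrArg Subtype.val he
    have hez : (e : V) = z := (cliffordOp l).injective he'
    have h4 : inner ℝ (z : V) (z : V) = 0 := inner_diff z (hez ▸ e.2)
    have h5 : z = 0 := Subtype.ext (inner_self_eq_zero.1 h4)
    rw [h5, map_zero]
  refine ⟨hinj, (LinearMap.injective_iff_surjective_of_finrank_eq_finrank ?_).1 hinj⟩
  have h1 := finrank_diff h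
  have h2 := finrank_diff (bar_mono l h)
  rw [finrank_bar, finrank_bar] at h2
  rw [finrank_bar]
  omega

end FinSub

end FinSub

/-! ## The Clifford `C*`-algebras of a Hilbert space -/

section Systems

open FinSub

variable {V W : Type*} [NormedAddCommGroup V] [InnerProductSpace ℝ V] [CompleteSpace V]
  [NormedAddCommGroup W] [InnerProductSpace ℝ W] [CompleteSpace W]

/-- The Bott map `S𝔠(E_a) → S𝔠(E_b)`, where `S𝔠(E) = C₀(ℝ) ⊗̂ C₀(E, Cl(E))`: it takes `f ⊗̂ u` to
`f(X ⊗̂ 1 + 1 ⊗̂ C) ⊗̂ u`, where `C` is the Clifford operator (the inclusion `E_ba → Cl(E_ba)`). -/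
def bottStd (a b : FinSub V) (h : a ≤ b) : SC a.1 a.1 →⋆ₙₐ[ℂ] SC b.1 b.1 :=
  bott (incl h) (proj b a) ((incl (diff_le a b)).toLinearMap ∘ₗ proj b (diff a b))
    (fun v y => inner_diff (proj b (diff a b) v) y.2)
    (fun _ h1 h2 => eq_zero_of_proj h1 ((incl (diff_le a b)).injective (h2.trans (map_zero _).symm)))

variable (V) in
/-- The `C*`-algebra `S𝔠(V)` of Higson, Kasparov and Trout: the direct limit of the `C*`-algebras
`S𝔠(E)` over the finite-dimensional subspaces `E` of `V`. -/
abbrev SCH : Type _ := DirLim (A := fun a : FinSub V => SC a.1 a.1) bottStd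

variable (l : V ≃L[ℝ] W)

/-- The composition `E_ba → Ē_ba → Ê_ba ⊆ Ē_b` of the induced Clifford operator `l̄* ∘ l` and the
unitary of the polar decomposition of the orthogonal projection `Ē_ba → Ê_ba`, where `Ê_ba` is the
orthogonal complement of `Ē_a` in `Ē_b`. -/
def inducedClifford {a b : FinSub V} (h : a ≤ b) : (diff a b).1 →ₗ[ℝ] (bar l b).1 :=
  (incl (diff_le (bar l a) (bar l b))).toLinearMap ∘ₗ
    (projUnitary _ _ (bijective_proj_diff l h)).toLinearEquiv.toLinearMap ∘ₗ
    (toBar l (diff a b)).toLinearMap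

/-- The map `β_ba : S𝔠_l(E_a) → S𝔠_l(E_b)`, where `S𝔠_l(E) = C₀(ℝ) ⊗̂ C₀(E, Cl(Ē))`: the
composition of the Bott map `f ⊗̂ u ↦ f(X ⊗̂ 1 + 1 ⊗̂ C_l) ⊗̂ u` to `S𝔠_l(E_ba) ⊗̂ 𝔠_l(E_a)` and the
isomorphism of the latter with `S𝔠_l(E_b)` which is given by the unitary `Ē_ba → Ê_ba`. -/
def bottInd (a b : FinSub V) (h : a ≤ b) : SC a.1 (bar l a).1 →⋆ₙₐ[ℂ] SC b.1 (bar l b).1 :=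
  bott (incl (bar_mono l h)) (proj b a) (inducedClifford l h ∘ₗ proj b (diff a b))
    (fun v y => inner_diff (projUnitary _ _ (bijective_proj_diff l h)
      (toBar l (diff a b) (proj b (diff a b) v))) y.2)
    (fun _ h1 h2 => eq_zero_of_proj h1 <| (toBar l (diff a b)).injective <|
      (projUnitary _ _ (bijective_proj_diff l h)).injective <|
        (incl (diff_le (bar l a) (bar l b))).injective <| by
          rw [map_zero, map_zero, map_zero]; exact h2)

/-- The direct limit `C*`-algebra `S𝔠_l(V)` of the `C*`-algebras `S𝔠_l(E)`. -/
abbrev SCl : Type _ := DirLim (A := fun a : FinSub V => SC a.1 (bar l a).1) (bottInd l)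

/-- The isomorphism `1 ⊗̂ pr : S𝔠_l(E) → S𝔠(E)` which is given by the unitary `Ē → E` of the polar
decomposition of the orthogonal projection. -/
def stageMap (a : FinSub V) : SC a.1 (bar l a).1 →⋆ₙₐ[ℂ] SC a.1 a.1 :=
  push (LinearEquiv.refl ℝ a.1) (projUnitary _ _ (bijective_proj_bar l a)).toLinearIsometry

/-- `Φ(x) = lim_a (1 ⊗̂ pr_a)(x_a)` whenever `x = lim_a x_a` with `x_a ∈ S𝔠_l(E_a)`, and every `x`
is such a limit. -/
def IsCanonical (Φ : SCl l → SCH V) : Prop :=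
  ∀ x : SCl l,
    (∃ y : ∀ a : FinSub V, SC a.1 (bar l a).1,
      Tendsto (fun a => toLim (bottInd l) a (y a)) atTop (𝓝 x)) ∧
    ∀ y : ∀ a : FinSub V, SC a.1 (bar l a).1,
      Tendsto (fun a => toLim (bottInd l) a (y a)) atTop (𝓝 x) →
      Tendsto (fun a => toLim bottStd a (stageMap l a (y a))) atTop (𝓝 (Φ x))

/-- The subspace `g(E)`. -/
def FinSub.image (g : V ≃ₗᵢ[ℝ] V) (a : FinSub V) : FinSub V :=
  ⟨a.1.map (g.toLinearEquiv : V →ₗ[ℝ] V), inferInstance⟩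

/-- The isometry `g : E → g(E)`. -/
def FinSub.toImage (g : V ≃ₗᵢ[ℝ] V) (a : FinSub V) : a.1 ≃ₗᵢ[ℝ] (image g a).1 :=
  g.submoduleMap a.1

/-- If `g` commutes with `l̄* ∘ l`, this is the isometry `g` from `Ē` to the subspace `Ē₁` where
`E₁ = g(E)`. -/
def FinSub.toImageBar (g : V ≃ₗᵢ[ℝ] V) (hg : ∀ x, cliffordOp l (g x) = g (cliffordOp l x))
    (a : FinSub V) : (bar l a).1 →ₗᵢ[ℝ] (bar l (image g a)).1 where
  toLinearMap := ((g.toLinearEquiv : V →ₗ[ℝ] V) ∘ₗ (bar l a).1.subtype).codRestrict _ fun x => by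
    obtain ⟨e, rfl⟩ := (toBar l a).surjective x
    exact ⟨g e, ⟨e, e.2, rfl⟩, hg e⟩
  norm_map' x := g.norm_map x

/-- The action `(g F)(t, v) = g(F(t, g⁻¹ v))` of an isometry `g`, from `S𝔠(E)` to `S𝔠(g(E))`. -/
def actStd (g : V ≃ₗᵢ[ℝ] V) (a : FinSub V) : SC a.1 a.1 →⋆ₙₐ[ℂ] SC (image g a).1 (image g a).1 :=
  push (toImage g a).symm.toLinearEquiv (toImage g a).toLinearIsometry

/-- The action `(g F)(t, v) = g(F(t, g⁻¹ v))` of an isometry `g` which commutes with `l̄* ∘ l`, from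
`S𝔠_l(E)` to `S𝔠_l(g(E))`. -/
def actInd (g : V ≃ₗᵢ[ℝ] V) (hg : ∀ x, cliffordOp l (g x) = g (cliffordOp l x)) (a : FinSub V) :
    SC a.1 (bar l a).1 →⋆ₙₐ[ℂ] SC (image g a).1 (bar l (image g a)).1 :=
  push (toImage g a).symm.toLinearEquiv (toImageBar l g hg a)

end Systems

end

end HilbertClifford

open HilbertClifford Filter Topology

/-! All the connecting maps are Bott maps `bott i p C` of one shape. With `w = (t, C v)`, the value
at `(t, v)` is the value of `F` at `(‖w‖, p v)`, moved by the isometry that takes the unit vector of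
`ℝ` to `w / ‖w‖`. Three facts reduce statements about such maps to linear algebra of Clifford
operators. A composition of Bott maps is a Bott map whose operator is an orthogonal sum
(`bott_bott`). A change of variables by isometries only replaces the operator (`push_bott`,
`bott_push`). Finally, operators `C`, `C'` with `‖C v - C' v‖ ≤ η ‖C v‖` have Bott maps that are
close on a fixed `F`, uniformly in the target (`norm_bott_sub_bott_le`): a small relative error in
`C` turns the direction of `w` slightly and dilates `‖w‖` by a factor near one, and a function
vanishing at infinity is uniformly insensitive to small dilations.

Let `C = l̄* l`, a positive invertible operator. Asymptotic unitarity makes `C - 1` small on the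
complement of some finite-dimensional space. Hence, for large `E_b`, the unitary `pr_b` is close to
the inclusion of `Ē_b`, and for `c ≥ b` the induced Clifford operator on `E_cb` is close to `C`,
itself close to the inclusion there. On `E_ba` the induced operator need not be close to the
identity, so exact identities are used instead: once `E_b` contains the images of `E_a` under `C`,
`C²`, `C⁻¹` and `C⁻²`, the induced operator of `E_ca` is that of `E_ba` on `E_ba` and equals `C` on
`E_cb` (`IsLarge.inducedClifford_proj`), and both `pr_b` on `Ē_a` and its inverse on `E_a` are the
identity. It follows that the induced system, which need not commute, commutes asymptotically, and
that `1 ⊗̂ pr_a` and its inverse asymptotically intertwine it with the standard system, which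
commutes exactly.

The passage to the limit is formal. Homomorphisms `T_b` are contractive, so if the nets
`T_b(α_ba(v))` converge, then `lim x_b ↦ lim T_b(x_b)` is a well-defined homomorphism
(`DirLim.limHom`). Isometries of Euclidean spaces induce injective, hence isometric, maps of
Clifford algebras; therefore the Bott maps and the canonical maps to the limits are isometric. Thus
a net `x_a ∈ A_a` converges to `x` in the limit only if it differs from a representative of `x` by a
null net, which gives the formula for every such net (`AsymptoticSystem.tendsto_limHom`). The two
limit homomorphisms are mutually inverse because they are so at each stage. Isometries that commute
with `C` intertwine all constructions exactly, and equivariance results from reindexing nets by `a ↦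
γ a`. -/

namespace HilbertClifford

noncomputable section

/-! ## Homomorphisms out of a direct limit -/

section Limit

variable {ι : Type*} [SemilatticeSup ι] [Nonempty ι] {A : ι → Type*}
  [∀ a, NonUnitalCStarAlgebra (A a)] {α : ∀ a b, a ≤ b → A a →⋆ₙₐ[ℂ] A b}
  {D : Type*} [NonUnitalCStarAlgebra D]

namespace DirLim

/-- The inclusion of the direct limit in the algebra of classes of bounded nets. -/
def val : DirLim α →⋆ₙₐ[ℂ] NetAlg A := NonUnitalStarSubalgebraClass.subtype (limSub α)

lemma val_toLim (a : ι) (v : A a) : val (toLim α a v) = NetAlg.cls A (orbitNet α a v) := rfl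

lemma norm_val (z : DirLim α) : ‖val z‖ = ‖z‖ := rfl

lemma val_injective : Function.Injective (val : DirLim α → NetAlg A) := Subtype.val_injective

lemma isometry_val : Isometry (val : DirLim α → NetAlg A) :=
  AddMonoidHomClass.isometry_of_norm val norm_val

/-- A property of elements of the direct limit which holds for the images of the canonical maps
holds everywhere if it is preserved by the operations and by limits. -/
theorem induction {P : DirLim α → Prop} (of : ∀ a v, P (toLim α a v))
    (add : ∀ x y, P x → P y → P (x + y)) (smul : ∀ (c : ℂ) x, P x → P (c • x))
    (mul : ∀ x y, P x → P y → P (x * y)) (star : ∀ x, P x → P (star x))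
    (closed : IsClosed {z | P z}) (z : DirLim α) : P z := by
  -- The limit is the closure of a generated algebra, so it is enough that the image of the property
  -- under `val` is a closed `*`-subalgebra containing the generators. Closedness passes to the
  -- image because `val` is an isometry of a complete space.
  let S : NonUnitalStarSubalgebra ℂ (NetAlg A) :=
    { carrier := val '' {z | P z}
      add_mem' := by
        rintro _ _ ⟨x, hx, rfl⟩ ⟨y, hy, rfl⟩
        exact ⟨x + y, add x y hx hy, map_add _ _ _⟩
      zero_mem' := by
        obtain ⟨a⟩ := ‹Nonempty ι›
        exact ⟨toLim α a 0, of a 0, by rw [map_zero, map_zero]⟩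
      mul_mem' := by
        rintro _ _ ⟨x, hx, rfl⟩ ⟨y, hy, rfl⟩
        exact ⟨x * y, mul x y hx hy, map_mul _ _ _⟩
      smul_mem' := by
        rintro c _ ⟨x, hx, rfl⟩
        exact ⟨c • x, smul c x hx, map_smul _ _ _⟩
      star_mem' := by
        rintro _ ⟨x, hx, rfl⟩
        exact ⟨Star.star x, star x hx, map_star _ _⟩ }
  have hS : limSub α ≤ S := by
    refine NonUnitalStarSubalgebra.topologicalClosure_minimal _ ?_
      (isometry_val.isClosedEmbedding.isClosedMap _ closed)
    refine NonUnitalStarAlgebra.adjoin_le ?_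
    rintro _ ⟨a, v, rfl⟩
    exact ⟨toLim α a v, of a v, rfl⟩
  obtain ⟨z', hz', h⟩ := hS z.2
  rw [← val_injective h]
  exact hz'

lemma exists_lift (z : DirLim α) : ∃ x : lp A ∞, NetAlg.cls A x = val z :=
  NetAlg.cls_surjective _

/-- Only the tails of the nets contribute to the quotient norm, so elements of different stages can
be compared at all late stages `d`. -/
lemma norm_toLim_sub_le {b c : ι} {u : A b} {v : A c} {ε : ℝ} (hε : 0 ≤ ε)
    (h : ∀ᶠ d in atTop, ∀ (hb : b ≤ d) (hc : c ≤ d), ‖α b d hb u - α c d hc v‖ ≤ ε) :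
    ‖toLim α b u - toLim α c v‖ ≤ ε := by
  rw [← norm_val, map_sub, val_toLim, val_toLim, ← map_sub]
  refine NetAlg.norm_cls_le_of_eventually hε ?_
  filter_upwards [h, eventually_ge_atTop b, eventually_ge_atTop c] with d hd hb hc
  rw [lp.coeFn_sub, Pi.sub_apply, orbitNet_apply α hb, orbitNet_apply α hc]
  exact hd hb hc

/-- Each `T_b` is contractive, so the family sends null nets to nets tending to `0`; the limit
depends only on the class. -/
lemma tendsto_of_cls_eq {T : ∀ b, A b →⋆ₙₐ[ℂ] D} {x y : lp A ∞}
    (h : NetAlg.cls A x = NetAlg.cls A y) {w : D}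
    (hx : Tendsto (fun b => T b (x b)) atTop (𝓝 w)) :
    Tendsto (fun b => T b (y b)) atTop (𝓝 w) := by
  have h0 : Tendsto (fun b => T b ((x - y) b)) atTop (𝓝 0) :=
    squeeze_zero_norm (fun b => NonUnitalStarAlgHom.norm_apply_le (T b) _)
      (mem_nullNets.1 (NetAlg.cls_eq_iff.1 h))
  have h1 := hx.sub h0
  rw [sub_zero] at h1
  refine h1.congr fun b => ?_
  rw [lp.coeFn_sub, Pi.sub_apply, map_sub, sub_sub_cancel]

/-- If `T_b : A_b → D` are homomorphisms for which the nets `T_b(α_ba(v))` converge, then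
`T_b(x_b)` converges for every net `(x_b)` which represents an element of the direct limit. -/
theorem exists_tendsto {T : ∀ b, A b →⋆ₙₐ[ℂ] D}
    (hT : ∀ a v, ∃ w, Tendsto (fun b => T b (orbitNet α a v b)) atTop (𝓝 w)) (z : DirLim α) :
    ∃ w, ∀ x, NetAlg.cls A x = val z → Tendsto (fun b => T b (x b)) atTop (𝓝 w) := by
  suffices h : ∃ x, NetAlg.cls A x = val z ∧ ∃ w, Tendsto (fun b => T b (x b)) atTop (𝓝 w) by
    obtain ⟨x, hx, w, hw⟩ := h
    exact ⟨w, fun y hy => tendsto_of_cls_eq (hx.trans hy.symm) hw⟩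
  induction z using DirLim.induction with
  | of a v => exact ⟨orbitNet α a v, rfl, hT a v⟩
  | add z z' hz hz' =>
    obtain ⟨x, hx, w, hw⟩ := hz
    obtain ⟨x', hx', w', hw'⟩ := hz'
    refine ⟨x + x', by rw [map_add, map_add, hx, hx'], w + w', (hw.add hw').congr fun b => ?_⟩
    rw [lp.coeFn_add, Pi.add_apply, map_add]
  | smul c z hz =>
    obtain ⟨x, hx, w, hw⟩ := hz
    refine ⟨c • x, by rw [map_smul, map_smul, hx], c • w, (hw.const_smul c).congr fun b => ?_⟩
    rw [lp.coeFn_smul, Pi.smul_apply, map_smul]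
  | mul z z' hz hz' =>
    obtain ⟨x, hx, w, hw⟩ := hz
    obtain ⟨x', hx', w', hw'⟩ := hz'
    refine ⟨x * x', by rw [NetAlg.cls_mul, map_mul, hx, hx'], w * w',
      (hw.mul hw').congr fun b => ?_⟩
    rw [lp.infty_coeFn_mul, Pi.mul_apply, map_mul]
  | star z hz =>
    obtain ⟨x, hx, w, hw⟩ := hz
    refine ⟨Star.star x, by rw [NetAlg.cls_star, map_star, hx], Star.star w,
      hw.star.congr fun b => ?_⟩
    rw [lp.star_apply, map_star]
  | closed =>
    refine isClosed_of_closure_subset fun z hz => ?_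
    obtain ⟨x, hx⟩ := exists_lift z
    -- Approximate `z` by `z'` within `ε / 6` and represent `z - z'` by a net `y` of norm below `ε /
    -- 3`. Then `x - y` represents `z'`, its image is eventually within `ε / 6` of the limit `w`,
    -- and contractivity puts `T_n(x_n)` within `ε / 2` of `w`.
    refine ⟨x, hx, cauchySeq_tendsto_of_complete (Metric.cauchySeq_iff'.2 fun ε hε => ?_)⟩
    obtain ⟨z', ⟨x', hx', w, hw⟩, hzz'⟩ := Metric.mem_closure_iff.1 hz (ε / 6) (by positivity)
    obtain ⟨y, hy, hyn⟩ := NetAlg.exists_lift (val (z - z')) (ε := ε / 6) (by positivity)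
    rw [norm_val, ← dist_eq_norm] at hyn
    have hxy : NetAlg.cls A x' = NetAlg.cls A (x - y) := by
      rw [map_sub, hx', hx, hy, map_sub, sub_sub_cancel]
    obtain ⟨N, hN⟩ := Metric.tendsto_atTop.1 (tendsto_of_cls_eq hxy hw) (ε / 6) (by positivity)
    have key : ∀ n, N ≤ n → dist (T n (x n)) w < ε / 2 := fun n hn => by
      have h1 := hN n hn
      rw [lp.coeFn_sub, Pi.sub_apply, map_sub, dist_eq_norm] at h1
      have h2 : ‖T n (y n)‖ ≤ ‖y‖ := (NonUnitalStarAlgHom.norm_apply_le (T n) _).trans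
        (lp.norm_apply_le_norm ENNReal.top_ne_zero y n)
      have h3 : T n (x n) - w = (T n (x n) - T n (y n) - w) + T n (y n) := by abel
      rw [dist_eq_norm, h3]
      exact (norm_add_le _ _).trans_lt (by linarith)
    refine ⟨N, fun n hn => ?_⟩
    have h1 := key n hn
    have h2 := key N le_rfl
    rw [dist_comm] at h2
    exact (dist_triangle _ w _).trans_lt (by linarith)

section LimHom

variable (T : ∀ b, A b →⋆ₙₐ[ℂ] D)
  (hT : ∀ a v, ∃ w, Tendsto (fun b => T b (orbitNet α a v b)) atTop (𝓝 w))

lemma tendsto_choose {z : DirLim α} {x : lp A ∞} (hx : NetAlg.cls A x = val z) :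
    Tendsto (fun b => T b (x b)) atTop (𝓝 (exists_tendsto hT z).choose) :=
  (exists_tendsto hT z).choose_spec x hx

/-- The homomorphism `lim_b x_b ↦ lim_b T_b(x_b)` out of a direct limit. -/
def limHom : DirLim α →⋆ₙₐ[ℂ] D where
  toFun z := (exists_tendsto hT z).choose
  map_smul' c z := by
    obtain ⟨x, hx⟩ := exists_lift z
    refine tendsto_nhds_unique
      (tendsto_choose T hT (x := c • x) (by rw [map_smul, map_smul, hx]))
      (((tendsto_choose T hT hx).const_smul c).congr fun b => ?_)
    rw [lp.coeFn_smul, Pi.smul_apply, map_smul]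
  map_zero' := by
    refine tendsto_nhds_unique (tendsto_choose T hT (x := 0) (by rw [map_zero, map_zero]))
      (tendsto_const_nhds.congr fun b => ?_)
    rw [lp.coeFn_zero, Pi.zero_apply, map_zero]
  map_add' z z' := by
    obtain ⟨x, hx⟩ := exists_lift z
    obtain ⟨x', hx'⟩ := exists_lift z'
    refine tendsto_nhds_unique
      (tendsto_choose T hT (x := x + x') (by rw [map_add, map_add, hx, hx']))
      (((tendsto_choose T hT hx).add (tendsto_choose T hT hx')).congr fun b => ?_)
    rw [lp.coeFn_add, Pi.add_apply, map_add]
  map_mul' z z' := by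
    obtain ⟨x, hx⟩ := exists_lift z
    obtain ⟨x', hx'⟩ := exists_lift z'
    refine tendsto_nhds_unique
      (tendsto_choose T hT (x := x * x') (by rw [NetAlg.cls_mul, map_mul, hx, hx']))
      (((tendsto_choose T hT hx).mul (tendsto_choose T hT hx')).congr fun b => ?_)
    rw [lp.infty_coeFn_mul, Pi.mul_apply, map_mul]
  map_star' z := by
    obtain ⟨x, hx⟩ := exists_lift z
    refine tendsto_nhds_unique
      (tendsto_choose T hT (x := Star.star x) (by rw [NetAlg.cls_star, map_star, hx]))
      ((tendsto_choose T hT hx).star.congr fun b => ?_)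
    rw [lp.star_apply, map_star]

lemma tendsto_limHom_of_cls_eq {z : DirLim α} {x : lp A ∞} (hx : NetAlg.cls A x = val z) :
    Tendsto (fun b => T b (x b)) atTop (𝓝 (limHom T hT z)) :=
  tendsto_choose T hT hx

lemma limHom_toLim_eq {a : ι} {v : A a} {w : D}
    (hw : Tendsto (fun b => T b (orbitNet α a v b)) atTop (𝓝 w)) :
    limHom T hT (toLim α a v) = w :=
  tendsto_nhds_unique (tendsto_limHom_of_cls_eq T hT rfl) hw

end LimHom

lemma continuous_hom (f : DirLim α →⋆ₙₐ[ℂ] D) : Continuous f :=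
  AddMonoidHomClass.continuous_of_bound f 1 fun x => by
    rw [one_mul]; exact NonUnitalStarAlgHom.norm_apply_le f x

/-- `*`-homomorphisms of `C*`-algebras are automatically continuous, so agreement on generators is
enough. -/
theorem hom_ext {f g : DirLim α →⋆ₙₐ[ℂ] D}
    (h : ∀ a v, f (toLim α a v) = g (toLim α a v)) (z : DirLim α) : f z = g z := by
  induction z using DirLim.induction with
  | of a v => exact h a v
  | add x y hx hy => rw [map_add, map_add, hx, hy]
  | smul c x hx => rw [map_smul, map_smul, hx]
  | mul x y hx hy => rw [map_mul, map_mul, hx, hy]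
  | star x hx => rw [map_star, map_star, hx]
  | closed => exact isClosed_eq (continuous_hom f) (continuous_hom g)

end DirLim

/-- A directed family of isometric homomorphisms `α_ba : A_a → A_b` for which
`α_cb(α_ba(v)) - α_ca(v)` tends to `0` as `b → ∞`, uniformly in `c ≥ b`. -/
structure AsymptoticSystem (α : ∀ a b, a ≤ b → A a →⋆ₙₐ[ℂ] A b) : Prop where
  norm_map : ∀ a b h v, ‖α a b h v‖ = ‖v‖
  coherent : ∀ a v (ε : ℝ), 0 < ε → ∃ b₁, ∀ b (hab : a ≤ b), b₁ ≤ b → ∀ c (hbc : b ≤ c),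
    ‖α b c hbc (α a b hab v) - α a c (hab.trans hbc) v‖ ≤ ε

namespace AsymptoticSystem

open DirLim

variable (hα : AsymptoticSystem α)

include hα

lemma norm_toLim (a : ι) (v : A a) : ‖toLim α a v‖ = ‖v‖ :=
  norm_toLim_of_tendsto α (f := fun _ => ‖v‖) (fun b h => (hα.norm_map a b h v).symm)
    tendsto_const_nhds

/-- The maps need not commute, so `α_ba(v)` and `v` may have different images in the limit.
Coherence bounds the distance of these images by the defect `α_db(α_ba(v)) - α_da(v)`, which is
small for all `d ≥ b` once `b` is large. -/
lemma tendsto_toLim_orbitNet (a : ι) (v : A a) :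
    Tendsto (fun b => toLim α b (orbitNet α a v b)) atTop (𝓝 (toLim α a v)) := by
  refine Metric.tendsto_atTop.2 fun ε hε => ?_
  obtain ⟨b₁, hb₁⟩ := hα.coherent a v (ε / 2) (half_pos hε)
  refine ⟨a ⊔ b₁, fun b hb => ?_⟩
  have hab : a ≤ b := le_sup_left.trans hb
  rw [orbitNet_apply α hab, dist_eq_norm]
  refine (norm_toLim_sub_le (half_pos hε).le ?_).trans_lt (half_lt_self hε)
  exact Eventually.of_forall fun d hd _ => hb₁ b hab (le_sup_right.trans hb) d hd

/-- The homomorphism induced by the canonical maps themselves fixes the generators, hence is the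
identity. Thus a net representing `z` as a class also converges to `z` inside the limit algebra. -/
lemma tendsto_toLim_of_cls_eq {z : DirLim α} {x : lp A ∞} (hx : NetAlg.cls A x = val z) :
    Tendsto (fun b => toLim α b (x b)) atTop (𝓝 z) := by
  have hT : ∀ a v, ∃ w, Tendsto (fun b => toLim α b (orbitNet α a v b)) atTop (𝓝 w) :=
    fun a v => ⟨_, hα.tendsto_toLim_orbitNet a v⟩
  have h : limHom (toLim α) hT z = z :=
    hom_ext (f := limHom (toLim α) hT) (g := NonUnitalStarAlgHom.id ℂ _)
      (fun a v => limHom_toLim_eq _ hT (hα.tendsto_toLim_orbitNet a v)) z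
  have h2 := tendsto_limHom_of_cls_eq (toLim α) hT hx
  rwa [h] at h2

/-- Every element of the direct limit is a limit of a net `(x_a)` with `x_a ∈ A_a`. -/
lemma exists_net (z : DirLim α) :
    ∃ y : ∀ a, A a, Tendsto (fun a => toLim α a (y a)) atTop (𝓝 z) := by
  obtain ⟨x, hx⟩ := DirLim.exists_lift z
  exact ⟨x, hα.tendsto_toLim_of_cls_eq hx⟩

/-- The canonical maps are isometric, so a net converging to `x` differs from a representative of
`x` by elements whose norms tend to `0`, and contractive maps do not see the difference. The index
map `t` allows nets moved to other stages, as happens under a group action on the index set. -/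
theorem tendsto_limHom (T : ∀ b, A b →⋆ₙₐ[ℂ] D)
    (hT : ∀ a v, ∃ w, Tendsto (fun b => T b (orbitNet α a v b)) atTop (𝓝 w))
    {Z : Type*} {f : Filter Z} {t : Z → ι} (ht : Tendsto t f atTop) {y : ∀ z, A (t z)}
    {x : DirLim α} (hy : Tendsto (fun z => toLim α (t z) (y z)) f (𝓝 x)) :
    Tendsto (fun z => T (t z) (y z)) f (𝓝 (limHom T hT x)) := by
  obtain ⟨u, hu⟩ := DirLim.exists_lift x
  have h1 := (hα.tendsto_toLim_of_cls_eq hu).comp ht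
  have h2 := (hy.sub h1).norm
  rw [sub_self, norm_zero] at h2
  have h3 : Tendsto (fun z => T (t z) (y z - u (t z))) f (𝓝 0) := by
    refine squeeze_zero_norm (fun z => NonUnitalStarAlgHom.norm_apply_le (T (t z)) _)
      (h2.congr fun z => ?_)
    rw [Function.comp_apply, ← map_sub, hα.norm_toLim]
  have h4 := ((tendsto_limHom_of_cls_eq T hT hu).comp ht).add h3
  rw [add_zero] at h4
  refine h4.congr fun z => ?_
  rw [Function.comp_apply, map_sub, add_sub_cancel]

omit hα in
/-- A net `u_b ∈ A_b` for which `α_cb(u_b) - u_c` tends to `0` as `b → ∞`, uniformly in `c ≥ b`,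
converges in the direct limit. -/
lemma exists_tendsto_toLim (u : ∀ b, A b)
    (hu : ∀ ε : ℝ, 0 < ε → ∃ b₁, ∀ b, b₁ ≤ b → ∀ c (hbc : b ≤ c), ‖α b c hbc (u b) - u c‖ ≤ ε) :
    ∃ w, Tendsto (fun b => toLim α b (u b)) atTop (𝓝 w) := by
  refine cauchySeq_tendsto_of_complete (Metric.cauchySeq_iff'.2 fun ε hε => ?_)
  obtain ⟨b₁, hb₁⟩ := hu (ε / 3) (by positivity)
  refine ⟨b₁, fun b hb => ?_⟩
  rw [dist_eq_norm]
  -- At a late stage `d` both elements are compared with `u d`, each at cost `ε / 3`.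
  refine (norm_toLim_sub_le (ε := ε / 3 + ε / 3) (by positivity) ?_).trans_lt (by linarith)
  refine Eventually.of_forall fun d hd hd₁ => ?_
  have h1 := hb₁ b hb d hd
  have h2 := hb₁ b₁ le_rfl d hd₁
  rw [norm_sub_rev] at h2
  have h3 : α b d hd (u b) - α b₁ d hd₁ (u b₁) =
      (α b d hd (u b) - u d) + (u d - α b₁ d hd₁ (u b₁)) := by abel
  rw [h3]
  exact (norm_add_le _ _).trans (add_le_add h1 h2)

end AsymptoticSystem

end Limit

end

end HilbertClifford

namespace HilbertClifford

noncomputable section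

/-! ## Isometric homomorphisms of Clifford algebras -/

section CliffordMap

-- Contraction is determined by its recursion on left multiplication by vectors, and pulling the
-- functional back along `f` makes the scalar terms of the two recursions agree. Needed for the
-- naturality of `changeForm`.
open CliffordAlgebra in
lemma map_contractLeft_of_comp {R M N : Type*} [CommRing R] [AddCommGroup M] [Module R M]
    [AddCommGroup N] [Module R N] {Q₁ : QuadraticForm R M} {Q₂ : QuadraticForm R N}
    (f : Q₁ →qᵢ Q₂) (d : Module.Dual R N) (x : CliffordAlgebra Q₁) :
    CliffordAlgebra.map f (contractLeft (d ∘ₗ f.toLinearMap) x) =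
      contractLeft d (CliffordAlgebra.map f x) := by
  induction x using CliffordAlgebra.left_induction with
  | algebraMap r => simp only [contractLeft_algebraMap, map_zero, AlgHom.commutes]
  | add x y hx hy => rw [map_add, map_add, map_add, map_add, hx, hy]
  | ι_mul x m hx =>
    rw [contractLeft_ι_mul, map_sub, map_mul, map_mul, hx, map_smul, map_apply_ι,
      contractLeft_ι_mul]
    rfl

-- Here `f` and `f'` are one linear map seen as an isometry for two pairs of forms, and the bilinear
-- forms correspond under it. This naturality transfers injectivity between different quadratic
-- forms.
open CliffordAlgebra in
lemma map_changeForm_of_comp {R M N : Type*} [CommRing R] [AddCommGroup M] [Module R M]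
    [AddCommGroup N] [Module R N] {Q₁ Q₁' : QuadraticForm R M} {Q₂ Q₂' : QuadraticForm R N}
    (f : Q₁ →qᵢ Q₂) (f' : Q₁' →qᵢ Q₂') (hf : ∀ m, f m = f' m)
    {B₁ : LinearMap.BilinForm R M} {B₂ : LinearMap.BilinForm R N}
    (h₁ : B₁.toQuadraticMap = Q₁' - Q₁) (h₂ : B₂.toQuadraticMap = Q₂' - Q₂)
    (hB : ∀ m, B₁ m = B₂ (f m) ∘ₗ f'.toLinearMap) (x : CliffordAlgebra Q₁) :
    CliffordAlgebra.map f' (changeForm h₁ x) = changeForm h₂ (CliffordAlgebra.map f x) := by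
  induction x using CliffordAlgebra.left_induction with
  | algebraMap r => simp only [changeForm_algebraMap, AlgHom.commutes]
  | add x y hx hy => rw [map_add, map_add, map_add, map_add, hx, hy]
  | ι_mul x m hx =>
    rw [changeForm_ι_mul, map_sub, map_mul, map_mul, hB, map_contractLeft_of_comp, hx, map_apply_ι,
      map_apply_ι, changeForm_ι_mul, hf]

open CliffordAlgebra in
/-- Over a field of characteristic different from two, an injective isometry of quadratic spaces
induces an injective homomorphism of Clifford algebras. -/
theorem cliffordAlgebra_map_injective {K M N : Type*} [Field K] [Invertible (2 : K)]
    [AddCommGroup M] [Module K M] [AddCommGroup N] [Module K N] {Q₁ : QuadraticForm K M}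
    {Q₂ : QuadraticForm K N} (f : Q₁ →qᵢ Q₂) (hf : Function.Injective f) :
    Function.Injective (CliffordAlgebra.map f) := by
  -- For the zero forms the Clifford algebras are exterior algebras, where injectivity over a field
  -- is known. The linear identification with the exterior algebra is natural, because the
  -- associated bilinear forms depend only on values of the quadratic forms, which `f` preserves.
  let f' : (0 : QuadraticForm K M) →qᵢ (0 : QuadraticForm K N) := ⟨f.toLinearMap, fun _ => rfl⟩
  have hf' : Function.Injective (CliffordAlgebra.map f') :=
    ExteriorAlgebra.map_injective_field (f := f.toLinearMap) (LinearMap.ker_eq_bot.2 hf)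
  have key := map_changeForm_of_comp f f' (fun _ => rfl)
    (changeForm.associated_neg_proof (Q := Q₁)) (changeForm.associated_neg_proof (Q := Q₂))
    (fun m => by
      ext m'
      simp only [QuadraticMap.associated_apply, LinearMap.comp_apply, neg_apply]
      have h : ∀ z, Q₂ (f z) = Q₁ z := f.map_app
      have h1 : f'.toLinearMap m' = f m' := rfl
      rw [h1, ← map_add, h, h, h])
  intro x y hxy
  refine (equivExterior Q₁).injective (hf' ?_)
  exact (key x).trans ((congrArg _ hxy).trans (key y).symm)

variable {V₁ V₂ : Type*} [NormedAddCommGroup V₁] [InnerProductSpace ℝ V₁]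
  [NormedAddCommGroup V₂] [InnerProductSpace ℝ V₂]

/-- The real Clifford algebras embed, and `ℂ` is flat over `ℝ`. -/
lemma Cl.map_injective (j : V₁ →ₗᵢ[ℝ] V₂) : Function.Injective (Cl.map j) := by
  let jq : normForm V₁ →qᵢ normForm V₂ :=
    ⟨j.toLinearMap, fun v => by
      rw [normForm_apply, normForm_apply]; exact congrArg (· ^ 2) (j.norm_map v)⟩
  have h : Function.Injective (CliffordAlgebra.map jq) :=
    cliffordAlgebra_map_injective jq j.injective
  exact Module.Flat.lTensor_preserves_injective_linearMap (M := ℂ)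
    (CliffordAlgebra.map jq).toLinearMap h

lemma Cl.norm_map [FiniteDimensional ℝ V₁] [FiniteDimensional ℝ V₂] (j : V₁ →ₗᵢ[ℝ] V₂)
    (x : Cl V₁) : ‖Cl.map j x‖ = ‖x‖ :=
  NonUnitalStarAlgHom.norm_map (Cl.map j) (Cl.map_injective j) x

lemma Cl.norm_vec_le [FiniteDimensional ℝ V₁] (v : V₁) : ‖Cl.vec v‖ ≤ ‖v‖ :=
  Cl.norm_le_of_rep (norm_nonneg v) fun r => Cl.norm_rep_vec_le r v

end CliffordMap

end

end HilbertClifford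

namespace HilbertClifford

noncomputable section

set_option linter.unusedSectionVars false

/-! ## Estimates and composition rules for Bott maps -/

section Bott

section SymC0

variable {X A : Type*} [TopologicalSpace X] [CStarAlgebra A] {σ : A →⋆ₐ[ℂ] A}

lemma SymC0.norm_apply_le (F : SymC0 X A σ) (z : ℝ × X) : ‖F z‖ ≤ ‖F‖ :=
  F.1.toBCF.norm_coe_le_norm z

lemma SymC0.norm_le {F : SymC0 X A σ} {r : ℝ} (hr : 0 ≤ r) (h : ∀ z, ‖F z‖ ≤ r) : ‖F‖ ≤ r :=
  (BoundedContinuousFunction.norm_le (f := F.1.toBCF) hr).2 h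

lemma SymC0.sub_apply (F G : SymC0 X A σ) (z : ℝ × X) : (F - G) z = F z - G z := rfl

end SymC0

variable {E W E₁ W₁ E₂ W₂ : Type*}
  [NormedAddCommGroup E] [InnerProductSpace ℝ E] [FiniteDimensional ℝ E]
  [NormedAddCommGroup W] [InnerProductSpace ℝ W] [FiniteDimensional ℝ W]
  [NormedAddCommGroup E₁] [InnerProductSpace ℝ E₁] [FiniteDimensional ℝ E₁]
  [NormedAddCommGroup W₁] [InnerProductSpace ℝ W₁] [FiniteDimensional ℝ W₁]
  [NormedAddCommGroup E₂] [InnerProductSpace ℝ E₂] [FiniteDimensional ℝ E₂]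
  [NormedAddCommGroup W₂] [InnerProductSpace ℝ W₂] [FiniteDimensional ℝ W₂]

/-- Two isometries of `ℝ ⊕ W` which agree on `W` induce homomorphisms of Clifford algebras whose
distance is controlled by the images of the unit vector of `ℝ`. -/
lemma Cl.norm_map_sub_map_le {j k : Ext W →ₗᵢ[ℝ] Ext W₁}
    (h : ∀ y, j (Ext.inr W y) = k (Ext.inr W y)) (x : Cl (Ext W)) :
    ‖Cl.map j x - Cl.map k x‖ ≤ ‖j (Ext.mk 1 0) - k (Ext.mk 1 0)‖ * ‖x‖ := by
  set e : Cl (Ext W) := Cl.vec (Ext.mk 1 0) with he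
  set ρ := Cl.map (Ext.refl W) with hρ
  have hn1 : ‖(Ext.mk 1 0 : Ext W)‖ = 1 := by
    have : ‖(Ext.mk 1 0 : Ext W)‖ ^ 2 = 1 ^ 2 := by rw [Ext.norm_sq]; simp
    exact (sq_eq_sq₀ (norm_nonneg _) zero_le_one).1 this
  have hee : e * e = 1 := by rw [he, Cl.vec_mul_self, hn1]; simp
  have hρe : ρ e = -e := by
    rw [hρ, he, Cl.map_vec, ← map_neg]
    congr 1
    refine Ext.ext_iff' ?_ ?_ <;> simp [Ext.refl]
  have hρρ : ∀ y, ρ (ρ y) = y := fun y => by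
    rw [hρ, Cl.map_map]
    convert Cl.map_id y
    ext1 z
    refine Ext.ext_iff' ?_ ?_ <;> simp [Ext.refl]
  -- Write `x = p + e q` with `p` and `q` fixed by the reflection. Such elements come from `Cl(W)`,
  -- where the two maps agree, so the difference is the Clifford vector `j(ε) - k(ε)` times the
  -- image of `q`, and `‖q‖ ≤ ‖x‖`.
  set p : Cl (Ext W) := (2⁻¹ : ℂ) • (x + ρ x) with hp
  set q : Cl (Ext W) := (2⁻¹ : ℂ) • (e * (x - ρ x)) with hq
  have hpf : ρ p = p := by rw [hp, map_smul, map_add, hρρ, add_comm]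
  have hqf : ρ q = q := by
    rw [hq, map_smul, map_mul, map_sub, hρρ, hρe, neg_mul, ← mul_neg, neg_sub]
  have hx : x = p + e * q := by
    rw [hp, hq, mul_smul_comm, ← mul_assoc, hee, one_mul, ← smul_add]
    have : x + ρ x + (x - ρ x) = (2 : ℂ) • x := by rw [two_smul]; abel
    rw [this, smul_smul, inv_mul_cancel₀ two_ne_zero, one_smul]
  have hqn : ‖q‖ ≤ ‖x‖ := by
    rw [hq, norm_smul]
    have h1 : ‖e * (x - ρ x)‖ ≤ 1 * (‖x‖ + ‖x‖) := by
      refine (norm_mul_le _ _).trans (mul_le_mul ((Cl.norm_vec_le _).trans hn1.le)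
        ((norm_sub_le _ _).trans ?_) (norm_nonneg _) zero_le_one)
      exact add_le_add le_rfl (Cl.norm_map_le _ _)
    have h2 : ‖(2⁻¹ : ℂ)‖ = 2⁻¹ := by simp
    rw [h2]
    linarith
  have hd : Cl.map j x - Cl.map k x =
      Cl.vec (j (Ext.mk 1 0) - k (Ext.mk 1 0)) * Cl.map j q := by
    rw [hx, map_add, map_add, map_mul, map_mul, Cl.map_eq_of_refl_eq hpf h,
      ← Cl.map_eq_of_refl_eq hqf h, he, Cl.map_vec, Cl.map_vec, map_sub, sub_mul]
    abel
  rw [hd]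
  refine (norm_mul_le _ _).trans ?_
  exact mul_le_mul (Cl.norm_vec_le _) ((Cl.norm_map_le _ _).trans hqn) (norm_nonneg _)
    (norm_nonneg _)

lemma Ext.turn_one (u : W →ₗᵢ[ℝ] W₁) (t : ℝ) (c : W₁) (hc : ∀ y, inner ℝ c (u y) = 0) :
    Ext.turn u t c hc (Ext.mk 1 0) = (Ext.mk t c).unitDir := by
  rw [Ext.turn_apply]
  simp

lemma Ext.norm_smul_unitDir (w : Ext W) : ‖w‖ • w.unitDir = w := by
  by_cases h : w = 0
  · rw [h, norm_zero, zero_smul]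
  · rw [Ext.unitDir, if_neg h, smul_smul, mul_inv_cancel₀ (norm_ne_zero_iff.2 h), one_smul]

/-- Scaled by `‖w‖`, the difference of directions is `w - w'` plus `‖w'‖ - ‖w‖` times a unit vector,
and each term costs `η ‖w‖`. The relative form of the hypothesis avoids the discontinuity of the
direction at `0`: if `w = 0`, then `w' = 0`. -/
lemma Ext.norm_unitDir_sub_le {w w' : Ext W} {η : ℝ} (hη0 : 0 ≤ η) (h : ‖w - w'‖ ≤ η * ‖w‖) : ‖w.unitDir - w'.unitDir‖ ≤ 2 * η := by
  by_cases hw : w = 0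
  · have hw' : w' = 0 := by
      rw [hw, norm_zero, mul_zero, zero_sub, norm_neg] at h
      exact norm_le_zero_iff.1 h
    rw [hw, hw', sub_self, norm_zero]
    positivity
  · have hw0 : 0 < ‖w‖ := norm_pos_iff.2 hw
    have h1 : ‖w‖ • (w.unitDir - w'.unitDir) = (w - w') + (‖w'‖ - ‖w‖) • w'.unitDir := by
      rw [smul_sub, sub_smul, Ext.norm_smul_unitDir, Ext.norm_smul_unitDir]
      abel
    have h2 : ‖w‖ * ‖w.unitDir - w'.unitDir‖ ≤ η * ‖w‖ + η * ‖w‖ := by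
      have h3 : ‖w‖ * ‖w.unitDir - w'.unitDir‖ = ‖‖w‖ • (w.unitDir - w'.unitDir)‖ := by
        rw [norm_smul, norm_norm]
      rw [h3, h1]
      refine (norm_add_le _ _).trans (add_le_add h ?_)
      rw [norm_smul, Ext.norm_unitDir, mul_one, Real.norm_eq_abs, abs_sub_comm]
      exact (abs_norm_sub_norm_le w w').trans h
    have h4 : ‖w‖ * ‖w.unitDir - w'.unitDir‖ ≤ ‖w‖ * (2 * η) := by linarith
    exact le_of_mul_le_mul_left h4 hw0

/-- Functions in `C₀(ℝ × E, Cl(ℝ ⊕ W))` vary slowly under small dilations of the first variable. -/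
def IsModulus (F : SC E W) (δ η : ℝ) : Prop :=
  0 < η ∧ η < 1 ∧ 2 * η * ‖F‖ ≤ δ / 2 ∧
    ∀ s s' : ℝ, ∀ q : E, |s - s'| ≤ η * s → ‖F (s, q) - F (s', q)‖ ≤ δ / 2

/-- For bounded `s` a small dilation is a small displacement, and `F` is uniformly continuous; for
large `s` both values of `F` are small since `F` vanishes at infinity. -/
lemma exists_isModulus (F : SC E W) {δ : ℝ} (hδ : 0 < δ) : ∃ η, IsModulus F δ η := by
  have : ProperSpace E := FiniteDimensional.proper ℝ E
  have huc : UniformContinuous F := ZeroAtInftyContinuousMap.uniformContinuous F.1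
  obtain ⟨d, hd, hF⟩ := Metric.uniformContinuous_iff.1 huc (δ / 2) (half_pos hδ)
  have h0 : ∀ᶠ z in cocompact (ℝ × E), ‖F z‖ < δ / 4 := by
    have := F.tendsto_zero.norm
    rw [norm_zero] at this
    exact this.eventually_lt_const (by positivity)
  rw [← Metric.cobounded_eq_cocompact, ← comap_norm_atTop, eventually_comap] at h0
  obtain ⟨R, hR⟩ := eventually_atTop.1 h0
  set R' : ℝ := max R 1 with hR'
  have hR1 : 1 ≤ R' := le_max_right _ _
  have hbig : ∀ s : ℝ, ∀ q : E, R' ≤ s → ‖F (s, q)‖ ≤ δ / 4 := fun s q hs => by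
    refine (hR ‖((s, q) : ℝ × E)‖ ?_ _ rfl).le
    exact (le_max_left _ _).trans (hs.trans ((le_abs_self s).trans (le_max_left _ _)))
  -- The bound `1 / 2` keeps `s' ≥ R'` when `s > 2 R'`; the second makes displacements less than `d`
  -- when `s ≤ 2 R'`; the third gives `2 η ‖F‖ ≤ δ / 2`.
  set η : ℝ := min (1 / 2) (min (d / (4 * R')) (δ / (4 * (‖F‖ + 1)))) with hη
  have hη0 : 0 < η := by positivity
  have hη1 : η ≤ 1 / 2 := min_le_left _ _
  have hη2 : η ≤ d / (4 * R') := (min_le_right _ _).trans (min_le_left _ _)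
  have hη3 : η ≤ δ / (4 * (‖F‖ + 1)) := (min_le_right _ _).trans (min_le_right _ _)
  refine ⟨η, hη0, by linarith, ?_, fun s s' q hs => ?_⟩
  · rw [le_div_iff₀ (by positivity)] at hη3
    nlinarith [norm_nonneg F]
  · rw [le_div_iff₀ (by positivity)] at hη2
    obtain ⟨hs1, hs2⟩ := abs_le.1 hs
    by_cases hsR : s ≤ 2 * R'
    · rw [← dist_eq_norm]
      refine (hF ?_).le
      rw [Prod.dist_eq, dist_self, Real.dist_eq]
      refine max_lt ?_ hd
      have : η * s ≤ η * (2 * R') := mul_le_mul_of_nonneg_left hsR hη0.le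
      nlinarith
    · have hsR := not_le.1 hsR
      have h1 : s' ≥ R' := by nlinarith
      refine (norm_sub_le _ _).trans ?_
      linarith [hbig s q (by linarith), hbig s' q h1]

lemma Ext.norm_snd_le (t : ℝ) (c : W) : ‖c‖ ≤ ‖(Ext.mk t c : Ext W)‖ := by
  refine (sq_le_sq₀ (norm_nonneg _) (norm_nonneg _)).1 ?_
  rw [Ext.norm_sq]
  exact le_add_of_nonneg_left (sq_nonneg _)

lemma Ext.norm_mk_sub_mk (t : ℝ) (c c' : W) :
    ‖(Ext.mk t c : Ext W) - Ext.mk t c'‖ = ‖c - c'‖ := by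
  have h : (Ext.mk t c : Ext W) - Ext.mk t c' = Ext.inr W (c - c') := by
    refine Ext.ext_iff' ?_ ?_ <;> simp [Ext.inr]
  rw [h, LinearIsometry.norm_map]

/-- Bott maps for nearby Clifford operators are close, uniformly in the target. -/
theorem norm_bott_sub_bott_le {F : SC E W} {δ η : ℝ} (hη : IsModulus F δ η)
    {i i' : W →ₗᵢ[ℝ] W₁} {p p' : E₁ →ₗ[ℝ] E} {C C' : E₁ →ₗ[ℝ] W₁}
    {hC : ∀ v y, inner ℝ (C v) (i y) = 0} {hinj : ∀ v, p v = 0 → C v = 0 → v = 0}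
    {hC' : ∀ v y, inner ℝ (C' v) (i' y) = 0} {hinj' : ∀ v, p' v = 0 → C' v = 0 → v = 0}
    (hi : ∀ y, i y = i' y) (hp : ∀ v, p v = p' v) (h : ∀ v, ‖C v - C' v‖ ≤ η * ‖C v‖) :
    ‖bott i p C hC hinj F - bott i' p' C' hC' hinj' F‖ ≤ δ := by
  obtain ⟨hη0, hη1, hηF, hF⟩ := hη
  have hδ : 0 ≤ δ := by
    have : 0 ≤ 2 * η * ‖F‖ := by positivity
    linarith
  refine SymC0.norm_le hδ fun ⟨t, v⟩ => ?_
  rw [SymC0.sub_apply, bott_apply, bott_apply, ← hp]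
  set w : Ext W₁ := Ext.mk t (C v) with hw
  set w' : Ext W₁ := Ext.mk t (C' v) with hw'
  -- The relative error of the operators passes to `w`, since `w - w'` has no `ℝ`-component and `‖C
  -- v‖ ≤ ‖w‖`.
  have hww : ‖w - w'‖ ≤ η * ‖w‖ := by
    rw [hw, hw', Ext.norm_mk_sub_mk]
    exact (h v).trans (mul_le_mul_of_nonneg_left (Ext.norm_snd_le t (C v)) hη0.le)
  have h1 := Cl.norm_map_sub_map_le (j := Ext.turn i t (C v) (hC v))
    (k := Ext.turn i' t (C' v) (hC' v))
    (fun y => by rw [Ext.turn_inr, Ext.turn_inr, hi]) (F (‖w‖, p v))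
  rw [Ext.turn_one, Ext.turn_one] at h1
  have h2 : ‖w.unitDir - w'.unitDir‖ * ‖F (‖w‖, p v)‖ ≤ 2 * η * ‖F‖ :=
    mul_le_mul (Ext.norm_unitDir_sub_le hη0.le hww) (SymC0.norm_apply_le _ _) (norm_nonneg _)
      (by positivity)
  have h3 := hF ‖w‖ ‖w'‖ (p v) ((abs_norm_sub_norm_le w w').trans hww)
  have h4 := Cl.norm_map_le (Ext.turn i' t (C' v) (hC' v)) (F (‖w‖, p v) - F (‖w'‖, p v))
  rw [map_sub] at h4
  -- The isometry is changed at a fixed value of `F`, then the argument of `F` is changed; each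
  -- costs at most `δ / 2`.
  rw [← sub_add_sub_cancel _ (Cl.map (Ext.turn i' t (C' v) (hC' v)) (F (‖w‖, p v)))]
  refine (norm_add_le _ _).trans ?_
  linarith

lemma SC.norm_apply_neg (F : SC E W) (t : ℝ) (v : E) : ‖F (-t, v)‖ = ‖F (t, v)‖ := by
  rw [F.apply_neg, Cl.norm_map]

/-- A Bott map is isometric if the projection `p` has a section on which the Clifford operator
vanishes. -/
lemma norm_bott {i : W →ₗᵢ[ℝ] W₁} {p : E₁ →ₗ[ℝ] E} {C : E₁ →ₗ[ℝ] W₁}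
    {hC : ∀ v y, inner ℝ (C v) (i y) = 0} {hinj : ∀ v, p v = 0 → C v = 0 → v = 0}
    (s : E → E₁) (hs : ∀ q, p (s q) = q) (hs' : ∀ q, C (s q) = 0) (F : SC E W) :
    ‖bott i p C hC hinj F‖ = ‖F‖ := by
  refine le_antisymm (NonUnitalStarAlgHom.norm_apply_le _ F)
    (SymC0.norm_le (norm_nonneg _) fun ⟨t, q⟩ => ?_)
  have h1 := SymC0.norm_apply_le (bott i p C hC hinj F) (t, s q)
  -- On the section the Bott map sees `F(|t|, q)`, which has the norm of `F(t, q)` by the reflection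
  -- symmetry.
  have h0 : ‖(Ext.mk t (C (s q)) : Ext W₁)‖ = |t| := by
    refine (sq_eq_sq₀ (norm_nonneg _) (abs_nonneg _)).1 ?_
    rw [Ext.norm_sq, hs', sq_abs]
    simp
  rw [bott_apply, Cl.norm_map, hs, h0] at h1
  refine le_trans (le_of_eq ?_) h1
  rcases abs_choice t with h | h <;> rw [h]
  exact (SC.norm_apply_neg F t q).symm

/-- The composition of two Bott maps is a Bott map. -/
theorem bott_bott {i : W →ₗᵢ[ℝ] W₁} {p : E₁ →ₗ[ℝ] E} {C : E₁ →ₗ[ℝ] W₁}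
    {hC : ∀ v y, inner ℝ (C v) (i y) = 0} {hinj : ∀ v, p v = 0 → C v = 0 → v = 0}
    {i' : W₁ →ₗᵢ[ℝ] W₂} {p' : E₂ →ₗ[ℝ] E₁} {C' : E₂ →ₗ[ℝ] W₂}
    {hC' : ∀ v y, inner ℝ (C' v) (i' y) = 0} {hinj' : ∀ v, p' v = 0 → C' v = 0 → v = 0}
    {i'' : W →ₗᵢ[ℝ] W₂} {p'' : E₂ →ₗ[ℝ] E} {C'' : E₂ →ₗ[ℝ] W₂}
    {hC'' : ∀ v y, inner ℝ (C'' v) (i'' y) = 0} {hinj'' : ∀ v, p'' v = 0 → C'' v = 0 → v = 0}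
    (hi : ∀ y, i'' y = i' (i y)) (hp : ∀ v, p'' v = p (p' v))
    (h : ∀ v, C'' v = C' v + i' (C (p' v))) (F : SC E W) :
    bott i' p' C' hC' hinj' (bott i p C hC hinj F) = bott i'' p'' C'' hC'' hinj'' F := by
  refine SymC0.ext fun ⟨t, v⟩ => ?_
  rw [bott_apply, bott_apply, bott_apply, Cl.map_map, hp]
  set w' : Ext W₂ := Ext.mk t (C' v) with hw'
  set w₁ : Ext W₁ := Ext.mk ‖w'‖ (C (p' v)) with hw₁
  set w : Ext W₂ := Ext.mk t (C'' v) with hw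
  -- Pythagoras: `C' v` is orthogonal to the image of `i'`, so the two steps accumulate the same
  -- length as the single one.
  have hn : ‖w₁‖ = ‖w‖ := by
    refine (sq_eq_sq₀ (norm_nonneg _) (norm_nonneg _)).1 ?_
    rw [hw₁, hw, Ext.norm_sq, Ext.norm_sq]
    change ‖w'‖ ^ 2 + ‖C (p' v)‖ ^ 2 = t ^ 2 + ‖C'' v‖ ^ 2
    rw [hw', Ext.norm_sq, h, norm_add_sq_real, hC', LinearIsometry.norm_map]
    change t ^ 2 + ‖C' v‖ ^ 2 + _ = _
    ring
  rw [hn]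
  have hinr : ∀ y, ((Ext.turn i' t (C' v) (hC' v)).comp (Ext.turn i ‖w'‖ (C (p' v)) (hC (p' v))))
      (Ext.inr W y) = Ext.turn i'' t (C'' v) (hC'' v) (Ext.inr W y) := fun y => by
    rw [LinearIsometry.coe_comp, Function.comp_apply, Ext.turn_inr, Ext.turn_inr, Ext.turn_inr, hi]
  -- At `w = 0` directions are a convention and the isometries may differ on the unit vector of `ℝ`.
  -- There `F(0, ·)` is fixed by the reflection, so agreement on `W` is enough.
  by_cases h0 : w = 0
  · refine Cl.map_eq_of_refl_eq ?_ hinr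
    rw [h0, norm_zero]
    exact F.sym_apply_zero _
  · have h1 : ((Ext.turn i' t (C' v) (hC' v)).comp (Ext.turn i ‖w'‖ (C (p' v)) (hC (p' v))))
        (Ext.mk 1 0) = Ext.turn i'' t (C'' v) (hC'' v) (Ext.mk 1 0) := by
      rw [LinearIsometry.coe_comp, Function.comp_apply, Ext.turn_one, Ext.turn_one, ← hw₁, ← hw]
      have h2 : ‖w‖ • Ext.turn i' t (C' v) (hC' v) w₁.unitDir = ‖w‖ • w.unitDir := by
        rw [← map_smul, ← hn, Ext.norm_smul_unitDir, hn, Ext.norm_smul_unitDir, Ext.turn_apply]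
        change ‖w'‖ • w'.unitDir + Ext.inr W₂ (i' (C (p' v))) = w
        rw [Ext.norm_smul_unitDir, hw, h]
        refine Ext.ext_iff' ?_ ?_ <;> simp [hw', Ext.inr]
      exact smul_right_injective _ (norm_ne_zero_iff.2 h0) h2
    congr 2
    ext1 x
    have hx : x = x.fst • (Ext.mk 1 0 : Ext W) + Ext.inr W x.snd := by
      refine Ext.ext_iff' ?_ ?_ <;> simp [Ext.inr]
    rw [hx, map_add, map_add, map_smul, map_smul, h1, hinr]

lemma Ext.map_mk (u : W →ₗᵢ[ℝ] W₁) (t : ℝ) (y : W) :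
    Ext.map u (Ext.mk t y) = Ext.mk t (u y) := rfl

lemma Ext.map_unitDir (u : W →ₗᵢ[ℝ] W₁) (w : Ext W) :
    Ext.map u w.unitDir = (Ext.map u w).unitDir := by
  by_cases h : w = 0
  · have h' : Ext.map u w = 0 := by rw [h, map_zero]
    rw [Ext.unitDir, Ext.unitDir, if_pos h, if_pos h', Ext.map_mk, map_zero]
  · have h' : Ext.map u w ≠ 0 := fun h0 => h ((Ext.map u).injective (h0.trans (map_zero _).symm))
    rw [Ext.unitDir, Ext.unitDir, if_neg h, if_neg h', map_smul, LinearIsometry.norm_map]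

/-- The isometry `id ⊕ j` preserves lengths and unit directions, including the conventional
direction at `0`. The data of the resulting Bott map are tied to the given ones only by pointwise
equations, so that the lemma applies to Bott maps in any presentation. -/
theorem push_bott {i : W →ₗᵢ[ℝ] W₁} {p : E₁ →ₗ[ℝ] E} {C : E₁ →ₗ[ℝ] W₁}
    {hC : ∀ v y, inner ℝ (C v) (i y) = 0} {hinj : ∀ v, p v = 0 → C v = 0 → v = 0}
    {ψ : E₂ ≃ₗ[ℝ] E₁} {j : W₁ →ₗᵢ[ℝ] W₂}
    {i'' : W →ₗᵢ[ℝ] W₂} {p'' : E₂ →ₗ[ℝ] E} {C'' : E₂ →ₗ[ℝ] W₂}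
    {hC'' : ∀ v y, inner ℝ (C'' v) (i'' y) = 0} {hinj'' : ∀ v, p'' v = 0 → C'' v = 0 → v = 0}
    (hi : ∀ y, i'' y = j (i y)) (hp : ∀ v, p'' v = p (ψ v))
    (h : ∀ v, C'' v = j (C (ψ v))) (F : SC E W) :
    push ψ j (bott i p C hC hinj F) = bott i'' p'' C'' hC'' hinj'' F := by
  refine SymC0.ext fun ⟨t, v⟩ => ?_
  rw [push_apply, bott_apply, bott_apply, Cl.map_map, hp]
  have hw : (Ext.mk t (C'' v) : Ext W₂) = Ext.map j (Ext.mk t (C (ψ v))) := by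
    rw [h, Ext.map_mk]
  rw [hw, LinearIsometry.norm_map]
  congr 2
  ext1 x
  rw [LinearIsometry.coe_comp, Function.comp_apply, Ext.turn_apply, Ext.turn_apply, hw,
    ← Ext.map_unitDir, map_add, map_smul, hi]
  rfl

theorem bott_push {ψ : E₁ ≃ₗ[ℝ] E} {j : W →ₗᵢ[ℝ] W₁}
    {i : W₁ →ₗᵢ[ℝ] W₂} {p : E₂ →ₗ[ℝ] E₁} {C : E₂ →ₗ[ℝ] W₂}
    {hC : ∀ v y, inner ℝ (C v) (i y) = 0} {hinj : ∀ v, p v = 0 → C v = 0 → v = 0}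
    {i'' : W →ₗᵢ[ℝ] W₂} {p'' : E₂ →ₗ[ℝ] E} {C'' : E₂ →ₗ[ℝ] W₂}
    {hC'' : ∀ v y, inner ℝ (C'' v) (i'' y) = 0} {hinj'' : ∀ v, p'' v = 0 → C'' v = 0 → v = 0}
    (hi : ∀ y, i'' y = i (j y)) (hp : ∀ v, p'' v = ψ (p v))
    (h : ∀ v, C'' v = C v) (F : SC E W) :
    bott i p C hC hinj (push ψ j F) = bott i'' p'' C'' hC'' hinj'' F := by
  refine SymC0.ext fun ⟨t, v⟩ => ?_
  rw [bott_apply, push_apply, bott_apply, Cl.map_map, hp]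
  simp only [h]
  congr 2
  ext1 x
  rw [LinearIsometry.coe_comp, Function.comp_apply, Ext.turn_apply, Ext.turn_apply]
  simp only [hi]
  rfl

lemma push_push (ψ : E₁ ≃ₗ[ℝ] E) (j : W →ₗᵢ[ℝ] W₁) (ψ' : E₂ ≃ₗ[ℝ] E₁) (j' : W₁ →ₗᵢ[ℝ] W₂)
    (F : SC E W) : push ψ' j' (push ψ j F) = push (ψ'.trans ψ) (j'.comp j) F := by
  refine SymC0.ext fun ⟨t, v⟩ => ?_
  rw [push_apply, push_apply, push_apply, Cl.map_map]
  rfl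

lemma push_congr {ψ ψ' : E₁ ≃ₗ[ℝ] E} {j j' : W →ₗᵢ[ℝ] W₁} (hψ : ∀ v, ψ v = ψ' v)
    (hj : ∀ y, j y = j' y) (F : SC E W) : push ψ j F = push ψ' j' F := by
  obtain rfl : ψ = ψ' := LinearEquiv.ext hψ
  obtain rfl : j = j' := LinearIsometry.ext hj
  rfl

lemma push_id {ψ : E ≃ₗ[ℝ] E} {j : W →ₗᵢ[ℝ] W} (hψ : ∀ v, ψ v = v) (hj : ∀ y, j y = y)
    (F : SC E W) : push ψ j F = F := by
  refine SymC0.ext fun ⟨t, v⟩ => ?_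
  rw [push_apply, hψ]
  have h : Ext.map j = LinearIsometry.id := by
    ext1 x
    refine Ext.ext_iff' rfl ?_
    exact hj _
  rw [h, Cl.map_id]

end Bott

end

end HilbertClifford

namespace HilbertClifford

noncomputable section

set_option linter.unusedSectionVars false

/-! ## Polar decompositions -/

section Polar

open ContinuousLinearMap

variable {V W V' W' : Type*} [NormedAddCommGroup V] [InnerProductSpace ℝ V] [CompleteSpace V]
  [NormedAddCommGroup W] [InnerProductSpace ℝ W] [CompleteSpace W]
  [NormedAddCommGroup V'] [InnerProductSpace ℝ V'] [CompleteSpace V']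
  [NormedAddCommGroup W'] [InnerProductSpace ℝ W'] [CompleteSpace W']

lemma inner_absOp_absOp (l : V ≃L[ℝ] W) (x y : V) :
    inner ℝ (absOp l (absOp l x)) y = inner ℝ (l x) (l y) := by
  have h : absOp l (absOp l x) = adjoint (l : V →L[ℝ] W) (l x) :=
    congrArg (fun A : V →L[ℝ] V => A x) (absOp_mul_self l)
  rw [h, adjoint_inner_left]
  rfl

/-- With `S = (l* l)^(1/2)`, one has `S² - 1 = (S + 1)(S - 1)`, and `S + 1` does not decrease norms
because `S` is positive. -/
lemma norm_absOp_sub_le (l : V ≃L[ℝ] W) (x : V) :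
    ‖absOp l x - x‖ ≤ ‖absOp l (absOp l x) - x‖ := by
  set y := absOp l x - x with hy
  have h1 : absOp l (absOp l x) - x = absOp l y + y := by rw [hy, map_sub]; abel
  have h2 : ‖y‖ * ‖y‖ ≤ ‖absOp l y + y‖ * ‖y‖ := by
    refine le_trans ?_ (real_inner_le_norm _ _)
    have h3 : 0 ≤ inner ℝ (absOp l y) y := (absOp_isPositive l).inner_nonneg_left y
    rw [inner_add_left, real_inner_self_eq_norm_mul_norm]
    linarith
  rw [h1]
  by_cases h0 : ‖y‖ = 0
  · rw [h0]; exact norm_nonneg _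
  · exact le_of_mul_le_mul_right h2 (lt_of_le_of_ne (norm_nonneg _) (Ne.symm h0))

/-- If `l` nearly preserves the inner products with `x`, then it is close at `x` to the unitary of
its polar decomposition. -/
lemma norm_polarUnitary_sub_le (l : V ≃L[ℝ] W) (x : V) {δ : ℝ} (hδ : 0 ≤ δ)
    (h : ∀ y, inner ℝ (l x) (l y) - inner ℝ x y ≤ δ * ‖y‖) : ‖polarUnitary l x - l x‖ ≤ δ := by
  -- The distance to be bounded is `‖S x - x‖ ≤ ‖S² x - x‖` for `S = (l* l)^(1/2)`; testing the
  -- hypothesis on `y = S² x - x` bounds the latter.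
  rw [← polarUnitary_absOp l x, ← map_sub, LinearIsometryEquiv.norm_map, norm_sub_rev]
  refine (norm_absOp_sub_le l x).trans ?_
  set z := absOp l (absOp l x) - x with hz
  have h1 : ‖z‖ * ‖z‖ ≤ δ * ‖z‖ := by
    rw [← real_inner_self_eq_norm_mul_norm]
    nth_rewrite 1 [hz]
    rw [inner_sub_left, inner_absOp_absOp]
    exact h z
  by_cases h0 : ‖z‖ = 0
  · rw [h0]; exact hδ
  · exact le_of_mul_le_mul_right h1 (lt_of_le_of_ne (norm_nonneg _) (Ne.symm h0))

/-- Uniqueness of the positive square root. -/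
lemma eq_absOp_of_sq (l : V ≃L[ℝ] W) (B : V →L[ℝ] V) (hB : B.IsPositive)
    (h : ∀ x, B (B x) = absOp l (absOp l x)) (x : V) : B x = absOp l x := by
  have hc : Commute (absOp l : V →L[ℝ] V) B := by
    refine absOp_commute l B ?_
    rw [← absOp_mul_self l]
    ext1 y
    change absOp l (absOp l (B y)) = B (absOp l (absOp l y))
    rw [← h, ← h]
  have hc' : ∀ y, absOp l (B y) = B (absOp l y) := fun y =>
    congrArg (fun A : V →L[ℝ] V => A y) hc
  set y := B x - absOp l x with hy
  -- For commuting roots this is `(S + B)(B - S) = B² - S² = 0`. Both terms of the quadratic form at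
  -- `y` are nonnegative, so each vanishes, and `S` is definite.
  have h1 : absOp l y + B y = 0 := by
    rw [hy, map_sub, map_sub, hc', h]
    abel
  have h2 : inner ℝ (absOp l y) y = 0 := by
    have h3 : 0 ≤ inner ℝ (absOp l y) y := (absOp_isPositive l).inner_nonneg_left y
    have h4 : 0 ≤ inner ℝ (B y) y := hB.inner_nonneg_left y
    have h5 : inner ℝ (absOp l y) y + inner ℝ (B y) y = 0 := by
      rw [← inner_add_left, h1, inner_zero_left]
    linarith
  rw [← cliffordOp_eq_absOp] at h2
  exact sub_eq_zero.1 (eq_zero_of_inner_cliffordOp l h2)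

/-- The polar decomposition is compatible with restrictions to subspaces which are invariant under
`l* l`. -/
theorem polarUnitary_restrict (l : V ≃L[ℝ] W) (l' : V' ≃L[ℝ] W') (j : V' →ₗᵢ[ℝ] V)
    (k : W' →ₗᵢ[ℝ] W) (hjk : ∀ x, l (j x) = k (l' x))
    (hinv : ∀ x, ∃ y, ∀ z, inner ℝ (l (j x)) (l z) = inner ℝ (j y) z) (x : V') :
    polarUnitary l (j x) = k (polarUnitary l' x) := by
  set J : V' →L[ℝ] V := j.toContinuousLinearMap with hJ
  set N : V →L[ℝ] V := adjoint (l : V →L[ℝ] W) ∘L (l : V →L[ℝ] W) with hN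
  set A : V →L[ℝ] V := (absOp l : V →L[ℝ] V) with hA
  have hNin : ∀ u z, inner ℝ (N u) z = inner ℝ (l u) (l z) := fun u z => by
    rw [hN, ContinuousLinearMap.comp_apply, adjoint_inner_left]; rfl
  have hJJ : ∀ u, adjoint J (J u) = u := fun u => by
    refine ext_inner_right ℝ fun z => ?_
    rw [adjoint_inner_left]
    exact j.inner_map_map u z
  have hNJ : ∀ u, ∃ y, N (J u) = J y := fun u => by
    obtain ⟨y, hy⟩ := hinv u
    exact ⟨y, ext_inner_right ℝ fun z => (hNin _ _).trans (hy z)⟩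
  set P : V →L[ℝ] V := J ∘L adjoint J with hP
  have hPs : IsSelfAdjoint P := (isPositive_self_comp_adjoint J).isSelfAdjoint
  have hNs : IsSelfAdjoint N := (isPositive_adjoint_comp_self (l : V →L[ℝ] W)).isSelfAdjoint
  have hPN : P * N * P = N * P := by
    ext1 u
    obtain ⟨y, hy⟩ := hNJ (adjoint J u)
    change J (adjoint J (N (J (adjoint J u)))) = N (J (adjoint J u))
    rw [hy, hJJ]
  -- The range of `j` is invariant under the self-adjoint operator `N`, so the adjoint of `P N P = N
  -- P` gives `P N P = P N`. Hence the square root of `N` commutes with `P` as well.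
  have hcomm : Commute N P := by
    have h1 := congrArg star hPN
    rw [star_mul, star_mul, star_mul, hPs.star_eq, hNs.star_eq, ← mul_assoc, hPN] at h1
    exact h1
  have hAP : Commute A P := absOp_commute l P hcomm
  have hAP' : ∀ u, A (P u) = P (A u) := fun u => congrArg (fun T : V →L[ℝ] V => T u) hAP
  have hPJ : ∀ u, P (J u) = J u := fun u => congrArg J (hJJ u)
  -- The compression of the square root to the subspace is positive and squares to `l'* l'`, so by
  -- uniqueness it is the square root there.
  set B : V' →L[ℝ] V' := adjoint J ∘L A ∘L J with hB
  have hBpos : B.IsPositive := (absOp_isPositive l).adjoint_conj J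
  have hJB : ∀ u, J (B u) = A (J u) := fun u => by
    change P (A (J u)) = A (J u)
    rw [← hAP', hPJ]
  have hBB : ∀ u, B (B u) = absOp l' (absOp l' u) := fun u => by
    refine ext_inner_right ℝ fun z => ?_
    have h1 : B (B u) = adjoint J (A (A (J u))) := congrArg (fun v => adjoint J (A v)) (hJB u)
    rw [inner_absOp_absOp, h1, adjoint_inner_left]
    have h2 := inner_absOp_absOp l (J u) (J z)
    refine h2.trans ?_
    change inner ℝ (l (j u)) (l (j z)) = _
    rw [hjk, hjk, k.inner_map_map]
  have hBeq := eq_absOp_of_sq l' B hBpos hBB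
  obtain ⟨u, rfl⟩ := (absOp l').surjective x
  have h1 : j (absOp l' u) = absOp l (j u) := by
    rw [← hBeq]
    exact hJB u
  rw [h1, polarUnitary_absOp, polarUnitary_absOp, hjk]

end Polar

/-! ## Unitaries between finite-dimensional subspaces -/

section FinSub

namespace FinSub

variable {V W : Type*} [NormedAddCommGroup V] [InnerProductSpace ℝ V] [CompleteSpace V]
  [NormedAddCommGroup W] [InnerProductSpace ℝ W] [CompleteSpace W]

lemma coe_proj_eq {a b : FinSub V} (x : a.1) {y : V} (hy : y ∈ b.1)
    (h : ∀ w ∈ b.1, inner ℝ ((x : V) - y) w = 0) : (proj a b x : V) = y :=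
  Submodule.eq_starProjection_of_mem_of_inner_eq_zero hy h

lemma inner_coe_sub_proj {a b : FinSub V} (x : a.1) {w : V} (hw : w ∈ b.1) :
    inner ℝ ((x : V) - proj a b x) w = 0 :=
  b.1.starProjection_inner_eq_zero (x : V) w hw

lemma coe_proj_of_mem {a b : FinSub V} (x : a.1) (hx : (x : V) ∈ b.1) : (proj a b x : V) = x :=
  coe_proj_eq x hx fun w _ => by rw [sub_self, inner_zero_left]

lemma coe_proj_diff {a b c : FinSub V} (hab : a ≤ b) (x : c.1) (hx : (x : V) ∈ b.1) :
    (proj c (diff a b) x : V) = x - proj c a x := by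
  refine coe_proj_eq x ⟨?_, sub_mem hx (hab (proj c a x).2)⟩ fun w hw => ?_
  · exact Submodule.sub_starProjection_mem_orthogonal _
  · rw [sub_sub_cancel, real_inner_comm]
    exact inner_diff ⟨w, hw⟩ (proj c a x).2

lemma proj_proj {a b c : FinSub V} (hab : a ≤ b) (x : c.1) :
    proj b a (proj c b x) = proj c a x := by
  refine Subtype.ext (coe_proj_eq _ (proj c a x).2 fun w hw => ?_)
  have h1 := inner_coe_sub_proj x (hab hw)
  have h2 := inner_coe_sub_proj x hw
  rw [inner_sub_left] at h1 h2 ⊢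
  linarith

lemma coe_proj_diff_add {a b c : FinSub V} (hab : a ≤ b) (hbc : b ≤ c) (x : c.1) :
    (proj c (diff a c) x : V) =
      proj b (diff a b) (proj c b x) + proj c (diff b c) x := by
  rw [coe_proj_diff (hab.trans hbc) x x.2, coe_proj_diff hab _ (proj c b x).2,
    coe_proj_diff hbc x x.2, proj_proj hab]
  abel

/-- Pythagoras for the orthogonal decomposition `E_ca = E_ba ⊕ E_cb`. -/
lemma norm_proj_diff_le {a b c : FinSub V} (hab : a ≤ b) (hbc : b ≤ c) (x : c.1) :
    ‖(proj b (diff a b) (proj c b x) : V)‖ ≤ ‖(proj c (diff a c) x : V)‖ ∧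
      ‖(proj c (diff b c) x : V)‖ ≤ ‖(proj c (diff a c) x : V)‖ := by
  have h0 : inner ℝ (proj b (diff a b) (proj c b x) : V) (proj c (diff b c) x : V) = 0 := by
    rw [real_inner_comm]
    exact inner_diff _ (diff_le a b (proj b (diff a b) (proj c b x)).2)
  have h1 : ‖(proj c (diff a c) x : V)‖ ^ 2 =
      ‖(proj b (diff a b) (proj c b x) : V)‖ ^ 2 + ‖(proj c (diff b c) x : V)‖ ^ 2 := by
    rw [coe_proj_diff_add hab hbc, norm_add_sq_real, h0]
    ring
  constructor
  · refine (sq_le_sq₀ (norm_nonneg _) (norm_nonneg _)).1 ?_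
    rw [h1]; exact le_add_of_nonneg_right (sq_nonneg _)
  · refine (sq_le_sq₀ (norm_nonneg _) (norm_nonneg _)).1 ?_
    rw [h1]; exact le_add_of_nonneg_left (sq_nonneg _)

variable {a b : FinSub V} (h : Function.Bijective (proj a b))

-- For the projection `P`, `⟨P x, P y⟩ - ⟨x, y⟩ = ⟨P x - x, y⟩`, so `norm_polarUnitary_sub_le` puts
-- the unitary within `‖P x - x‖` of `P x`; a second such term leads back to `x`. In particular
-- vectors common to both subspaces are fixed.
include h in
lemma norm_projUnitary_sub_le (x : a.1) :
    ‖(projUnitary a b h x : V) - x‖ ≤ 2 * ‖(proj a b x : V) - x‖ := by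
  set δ := ‖(proj a b x : V) - x‖ with hδ
  have h1 := norm_polarUnitary_sub_le (LinearEquiv.ofBijective (proj a b) h).toContinuousLinearEquiv
    x (norm_nonneg _ : 0 ≤ δ) (fun y => by
      change inner ℝ (proj a b x : V) (proj a b y : V) - inner ℝ (x : V) (y : V) ≤ δ * ‖(y : V)‖
      have h2 := inner_proj a b y (proj a b x)
      rw [real_inner_comm, h2, real_inner_comm, ← inner_sub_left]
      exact real_inner_le_norm _ _)
  have h3 : ‖(projUnitary a b h x : V) - proj a b x‖ ≤ δ := h1
  rw [← sub_add_sub_cancel _ (proj a b x : V)]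
  refine (norm_add_le _ _).trans ?_
  linarith

lemma coe_projUnitary_of_mem (x : a.1) (hx : (x : V) ∈ b.1) : (projUnitary a b h x : V) = x := by
  have h1 := norm_projUnitary_sub_le h x
  rw [coe_proj_of_mem x hx, sub_self, norm_zero, mul_zero] at h1
  exact sub_eq_zero.1 (norm_le_zero_iff.1 h1)

lemma norm_coe_projUnitary (x : a.1) : ‖(projUnitary a b h x : V)‖ = ‖(x : V)‖ :=
  (projUnitary a b h).norm_map x

lemma coe_projUnitary_symm_of_mem (x : b.1) (hx : (x : V) ∈ a.1) :
    ((projUnitary a b h).symm x : V) = x := by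
  have h1 : projUnitary a b h ⟨x, hx⟩ = x := Subtype.ext (coe_projUnitary_of_mem h ⟨x, hx⟩ x.2)
  nth_rewrite 1 [← h1]
  rw [LinearIsometryEquiv.symm_apply_apply]

lemma norm_projUnitary_symm_sub_le {κ : ℝ}
    (hκ : ∀ x : a.1, ‖(projUnitary a b h x : V) - x‖ ≤ κ * ‖(x : V)‖) (y : b.1) :
    ‖((projUnitary a b h).symm y : V) - y‖ ≤ κ * ‖(y : V)‖ := by
  obtain ⟨x, rfl⟩ := (projUnitary a b h).surjective y
  rw [LinearIsometryEquiv.symm_apply_apply, norm_sub_rev, norm_coe_projUnitary]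
  exact hκ x

/-- A case of `polarUnitary_restrict`. Since `⟨P u, P z⟩ = ⟨P u, z⟩`, the invariance condition
involves one projection only. -/
lemma projUnitary_restrict {a' b' : FinSub V} (h' : Function.Bijective (proj a' b'))
    (j : a.1 →ₗᵢ[ℝ] a'.1) (k : b.1 →ₗᵢ[ℝ] b'.1)
    (hjk : ∀ x, proj a' b' (j x) = k (proj a b x))
    (hinv : ∀ x, ∃ y, ∀ z : a'.1, inner ℝ (proj a' b' (j x) : V) (z : V) = inner ℝ (j y : V) z) (x : a.1) :
    projUnitary a' b' h' (j x) = k (projUnitary a b h x) :=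
  polarUnitary_restrict (LinearEquiv.ofBijective (proj a' b') h').toContinuousLinearEquiv
    (LinearEquiv.ofBijective (proj a b) h).toContinuousLinearEquiv j k hjk
    (fun x => by
      obtain ⟨y, hy⟩ := hinv x
      refine ⟨y, fun z => Eq.trans ?_ (hy z)⟩
      change inner ℝ (proj a' b' (j x) : V) (proj a' b' z : V) = _
      rw [real_inner_comm, inner_proj, real_inner_comm]) x

end FinSub

end FinSub

end

end HilbertClifford

namespace HilbertClifford

noncomputable section

set_option linter.unusedSectionVars false

/-! ## The induced Clifford operators -/

section Induced

namespace FinSub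

variable {V W : Type*} [NormedAddCommGroup V] [InnerProductSpace ℝ V] [CompleteSpace V]
  [NormedAddCommGroup W] [InnerProductSpace ℝ W] [CompleteSpace W] (l : V ≃L[ℝ] W)

lemma exists_norm_le_mul_norm_cliffordOp :
    ∃ M : ℝ, 0 < M ∧ ∀ x, ‖x‖ ≤ M * ‖cliffordOp l x‖ := by
  refine ⟨‖((cliffordOp l).symm : V →L[ℝ] V)‖ + 1, by positivity, fun x => ?_⟩
  have h := ((cliffordOp l).symm : V →L[ℝ] V).le_opNorm (cliffordOp l x)
  have h2 : ((cliffordOp l).symm : V →L[ℝ] V) (cliffordOp l x) = x :=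
    (cliffordOp l).symm_apply_apply x
  rw [h2] at h
  linarith [norm_nonneg (cliffordOp l x)]

lemma exists_norm_cliffordOp_le :
    ∃ K : ℝ, 0 < K ∧ ∀ x, ‖cliffordOp l x‖ ≤ K * ‖x‖ := by
  refine ⟨‖(cliffordOp l : V →L[ℝ] V)‖ + 1, by positivity, fun x => ?_⟩
  have h := (cliffordOp l : V →L[ℝ] V).le_opNorm x
  have h2 : (cliffordOp l : V →L[ℝ] V) x = cliffordOp l x := rfl
  rw [h2] at h
  linarith [norm_nonneg x]

lemma inner_cliffordOp_symm_left (x y : V) :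
    inner ℝ ((cliffordOp l).symm x) y = inner ℝ x ((cliffordOp l).symm y) := by
  have h := inner_cliffordOp_left l ((cliffordOp l).symm x) ((cliffordOp l).symm y)
  rw [ContinuousLinearEquiv.apply_symm_apply, ContinuousLinearEquiv.apply_symm_apply] at h
  exact h.symm

/-- The operator `l̄* l` is `ε`-close to the identity on the orthogonal complement of `E`. -/
def IsNear (E : FinSub V) (ε : ℝ) : Prop := ∀ v ∈ E.1ᗮ, ‖cliffordOp l v - v‖ ≤ ε * ‖v‖

variable {l}

/-- `l̄* l - 1 = l̄* (l - l̄)`, and `l̄*` is isometric. -/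
lemma _root_.HilbertClifford.AsymptoticallyUnitary.exists_isNear (hl : AsymptoticallyUnitary l)
    {ε : ℝ} (hε : 0 < ε) : ∃ E : FinSub V, IsNear l E ε := by
  obtain ⟨E, hE, h⟩ := hl ε hε
  refine ⟨⟨E, hE⟩, fun v hv => ?_⟩
  have h1 : cliffordOp l v - v = (polarUnitary l).symm (l v - polarUnitary l v) := by
    rw [map_sub, LinearIsometryEquiv.symm_apply_apply]; rfl
  rw [h1, LinearIsometryEquiv.norm_map]
  exact (ContinuousLinearMap.le_opNorm _ (⟨v, hv⟩ : Eᗮ)).trans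
    (mul_le_mul_of_nonneg_right h.le (norm_nonneg _))

lemma IsNear.mono {E b : FinSub V} {ε : ℝ} (hE : IsNear l E ε) (h : E ≤ b) : IsNear l b ε :=
  fun v hv => hE v (Submodule.orthogonal_le h hv)

lemma IsNear.norm_sub_le {b c : FinSub V} {ε : ℝ} (hb : IsNear l b ε) (v : (diff b c).1) :
    ‖cliffordOp l (v : V) - v‖ ≤ ε * ‖(v : V)‖ := hb v v.2.1

/-- Write `x = C e` with `C = l̄* l` and `e ∈ E_b`, and let `y` be the part of `x` orthogonal to
`E_b`. Then `‖y‖² = ⟨C e, y⟩ = ⟨e, C y - y⟩` because `C` is symmetric and `e ⟂ y`, and `C - 1` is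
small at `y`. -/
lemma IsNear.norm_proj_bar_sub_le {b : FinSub V} {ε M : ℝ} (hb : IsNear l b ε) (hε : 0 ≤ ε)
    (hM : ∀ x, ‖x‖ ≤ M * ‖cliffordOp l x‖) (x : (bar l b).1) :
    ‖(proj (bar l b) b x : V) - x‖ ≤ ε * M * ‖(x : V)‖ := by
  obtain ⟨e, rfl⟩ := (toBar l b).surjective x
  set x := toBar l b e with hx
  rw [norm_sub_rev]
  set y : V := (x : V) - proj (bar l b) b x with hy
  have hyb : ∀ w ∈ b.1, inner ℝ y w = 0 := fun w hw => inner_coe_sub_proj x hw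
  have hyo : y ∈ b.1ᗮ := (Submodule.mem_orthogonal' _ _).2 hyb
  clear_value y
  have h1 : ‖y‖ * ‖y‖ ≤ (ε * M * ‖(x : V)‖) * ‖y‖ := by
    have h2 : inner ℝ y y = inner ℝ (e : V) (cliffordOp l y - y) := by
      have h3 : inner ℝ (e : V) y = 0 := by rw [real_inner_comm]; exact hyb e e.2
      have h4 : inner ℝ (proj (bar l b) b x : V) y = 0 := by
        rw [real_inner_comm]; exact hyb _ (proj (bar l b) b x).2
      rw [inner_sub_right, h3, sub_zero, ← inner_cliffordOp_left, ← coe_toBar, ← hx]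
      nth_rewrite 1 [hy]
      rw [inner_sub_left, h4, sub_zero]
    rw [← real_inner_self_eq_norm_mul_norm, h2]
    refine (real_inner_le_norm _ _).trans ?_
    have h5 := mul_le_mul (hM (e : V)) (hb y hyo) (norm_nonneg _)
      ((norm_nonneg _).trans (hM (e : V)))
    rw [hx, coe_toBar]
    linarith
  by_cases h0 : ‖y‖ = 0
  · rw [h0]
    have : 0 ≤ M * ‖(x : V)‖ := by
      rw [hx, coe_toBar]; exact (norm_nonneg _).trans (hM (e : V))
    rw [mul_assoc]
    exact mul_nonneg hε this
  · exact le_of_mul_le_mul_right h1 (lt_of_le_of_ne (norm_nonneg _) (Ne.symm h0))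

variable (l) in
/-- The unitary `pr_a` of the polar decomposition of the orthogonal projection `Ē_a → E_a`. -/
abbrev pr (a : FinSub V) : (bar l a).1 ≃ₗᵢ[ℝ] a.1 := projUnitary _ _ (bijective_proj_bar l a)

lemma IsNear.norm_pr_sub_le {b : FinSub V} {ε M : ℝ} (hb : IsNear l b ε) (hε : 0 ≤ ε)
    (hM : ∀ x, ‖x‖ ≤ M * ‖cliffordOp l x‖) (x : (bar l b).1) :
    ‖(pr l b x : V) - x‖ ≤ 2 * (ε * M) * ‖(x : V)‖ := by
  refine (norm_projUnitary_sub_le _ x).trans ?_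
  linarith [hb.norm_proj_bar_sub_le hε hM x]

lemma IsNear.norm_pr_symm_sub_le {b : FinSub V} {ε M : ℝ} (hb : IsNear l b ε) (hε : 0 ≤ ε)
    (hM : ∀ x, ‖x‖ ≤ M * ‖cliffordOp l x‖) (x : b.1) :
    ‖((pr l b).symm x : V) - x‖ ≤ 2 * (ε * M) * ‖(x : V)‖ :=
  norm_projUnitary_symm_sub_le _ (hb.norm_pr_sub_le hε hM) x

lemma coe_inducedClifford {a b : FinSub V} (h : a ≤ b) (v : (diff a b).1) :
    (inducedClifford l h v : V) =
      projUnitary _ _ (bijective_proj_diff l h) (toBar l (diff a b) v) := rfl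

lemma norm_inducedClifford {a b : FinSub V} (h : a ≤ b) (v : (diff a b).1) :
    ‖(inducedClifford l h v : V)‖ = ‖cliffordOp l (v : V)‖ := by
  rw [coe_inducedClifford, norm_coe_projUnitary, coe_toBar]

/-- The induced Clifford operator is close to the identity far out in the space. -/
lemma IsNear.norm_inducedClifford_sub_le {b c : FinSub V} (h : b ≤ c) {ε M : ℝ}
    (hb : IsNear l b ε) (hε : 0 ≤ ε) (hM : ∀ x, ‖x‖ ≤ M * ‖cliffordOp l x‖) (v : (diff b c).1) :
    ‖(inducedClifford l h v : V) - cliffordOp l (v : V)‖ ≤ 2 * (ε * (1 + M)) * ‖(v : V)‖ := by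
  rw [coe_inducedClifford]
  refine (norm_projUnitary_sub_le _ _).trans ?_
  have hmem : (toBar l (diff b c) v : V) ∈ (bar l c).1 :=
    bar_mono l (diff_le b c) (toBar l (diff b c) v).2
  -- The displacement of `C v` under the projection to the complement of `Ē_b` is its component in
  -- `Ē_b`, written below as `y = C w` with `w ∈ E_b`.
  rw [coe_proj_diff (bar_mono l h) _ hmem, sub_sub_cancel_left, norm_neg, mul_assoc]
  refine mul_le_mul_of_nonneg_left ?_ zero_le_two
  obtain ⟨w, hw⟩ := (toBar l b).surjective
    (proj (bar l (diff b c)) (bar l b) (toBar l (diff b c) v))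
  have hin : inner ℝ (cliffordOp l (v : V)) (cliffordOp l (w : V)) =
      inner ℝ (cliffordOp l (w : V)) (cliffordOp l (w : V)) := by
    have h1 := inner_coe_sub_proj (toBar l (diff b c) v) (toBar l b w).2
    rw [← hw, inner_sub_left, sub_eq_zero] at h1
    exact h1
  rw [← hw, coe_toBar]
  set y := cliffordOp l (w : V) with hy
  have h0 : inner ℝ (v : V) (w : V) = 0 := inner_diff v w.2
  -- The added terms cancel: `⟨v, w⟩ = 0` and `⟨C v, w⟩ = ⟨v, C w⟩ = ⟨v, y⟩`. The factor `C v - v`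
  -- is small, and `‖y + w‖ ≤ (1 + M) ‖y‖`.
  have h2 : inner ℝ (cliffordOp l (v : V)) y = inner ℝ (cliffordOp l (v : V) - v) (y + w) := by
    rw [inner_sub_left, inner_add_right, inner_add_right, h0, inner_cliffordOp_left l _ (w : V),
      ← hy]
    ring
  have h3 : ‖y‖ * ‖y‖ ≤ (ε * (1 + M) * ‖(v : V)‖) * ‖y‖ := by
    rw [← real_inner_self_eq_norm_mul_norm, ← hin, h2]
    refine (real_inner_le_norm _ _).trans ?_
    have h4 : ‖y + (w : V)‖ ≤ (1 + M) * ‖y‖ :=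
      (norm_add_le _ _).trans (by linarith [hM (w : V)])
    have h5 := mul_le_mul (hb.norm_sub_le v) h4 (norm_nonneg _) (by positivity)
    linarith
  by_cases hy0 : ‖y‖ = 0
  · rw [hy0]
    have hM0 : 0 ≤ (1 + M) * ‖(v : V)‖ := by
      have h6 := hM (v : V)
      by_cases hM1 : 0 ≤ M
      · positivity
      · have h7 : ‖(v : V)‖ ≤ 0 :=
          h6.trans (mul_nonpos_of_nonpos_of_nonneg (not_le.1 hM1).le (norm_nonneg _))
        rw [le_antisymm h7 (norm_nonneg _), mul_zero]
    rw [mul_assoc]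
    exact mul_nonneg hε hM0
  · exact le_of_mul_le_mul_right h3 (lt_of_le_of_ne (norm_nonneg _) (Ne.symm hy0))

variable (l) in
/-- `E_b` contains the images of `E_a` under the powers of `l̄* l` with exponents `-2, …, 2`. -/
structure IsLarge (a b : FinSub V) : Prop where
  le : a ≤ b
  op : ∀ w ∈ a.1, cliffordOp l w ∈ b.1
  op_op : ∀ w ∈ a.1, cliffordOp l (cliffordOp l w) ∈ b.1
  symm : ∀ w ∈ a.1, (cliffordOp l).symm w ∈ b.1
  symm_symm : ∀ w ∈ a.1, (cliffordOp l).symm ((cliffordOp l).symm w) ∈ b.1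

variable (l) in
lemma exists_isLarge (a : FinSub V) : ∃ b₁, ∀ b, b₁ ≤ b → IsLarge l a b := by
  have key : ∀ T : V →ₗ[ℝ] V, ∃ b₁ : FinSub V, ∀ b, b₁ ≤ b → ∀ w ∈ a.1, T w ∈ b.1 := fun T =>
    ⟨⟨a.1.map T, inferInstance⟩, fun b hb w hw => hb ⟨w, hw, rfl⟩⟩
  obtain ⟨b₁, h₁⟩ := key (cliffordOp l : V →L[ℝ] V)
  obtain ⟨b₂, h₂⟩ := key ((cliffordOp l : V →L[ℝ] V) ∘L (cliffordOp l : V →L[ℝ] V))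
  obtain ⟨b₃, h₃⟩ := key ((cliffordOp l).symm : V →L[ℝ] V)
  obtain ⟨b₄, h₄⟩ := key (((cliffordOp l).symm : V →L[ℝ] V) ∘L ((cliffordOp l).symm : V →L[ℝ] V))
  refine ⟨a ⊔ (b₁ ⊔ b₂ ⊔ (b₃ ⊔ b₄)), fun b hb => ⟨le_sup_left.trans hb, h₁ b ?_, h₂ b ?_,
    h₃ b ?_, h₄ b ?_⟩⟩
  · exact le_sup_left.trans (le_sup_left.trans (le_sup_right.trans hb))
  · exact le_sup_right.trans (le_sup_left.trans (le_sup_right.trans hb))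
  · exact le_sup_left.trans (le_sup_right.trans (le_sup_right.trans hb))
  · exact le_sup_right.trans (le_sup_right.trans (le_sup_right.trans hb))

lemma diff_mono {a b c : FinSub V} (h : b ≤ c) : diff a b ≤ diff a c :=
  inf_le_inf_left (a.1ᗮ) h

lemma diff_anti {a b c : FinSub V} (h : a ≤ b) : diff b c ≤ diff a c :=
  inf_le_inf_right c.1 (Submodule.orthogonal_le h)

/-- With `R = C⁻¹`, the compression of `R²` to `E_a` is invertible, since its quadratic form at `u`
is `‖R u‖²`. Choosing `u ∈ E_a` whose image under it is `w`, the vector `g = w - R² u` is orthogonal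
to `E_a`, and `C² (w - g) = u` is orthogonal to every `z ⟂ E_a`. Membership of `g` in `E_b` is the
reason for the exponent `-2` in `IsLarge`. -/
lemma IsLarge.exists_diff {a b : FinSub V} (hb : IsLarge l a b) {w : V} (hw : w ∈ a.1) :
    ∃ g : (diff a b).1, ∀ z ∈ a.1ᗮ,
      inner ℝ (cliffordOp l w) (cliffordOp l z) =
        inner ℝ (cliffordOp l (g : V)) (cliffordOp l z) := by
  set R := (cliffordOp l).symm with hR
  let T : a.1 →ₗ[ℝ] a.1 := (a.1.orthogonalProjectionOnto : V →ₗ[ℝ] a.1) ∘ₗ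
    ((R : V →L[ℝ] V) ∘L (R : V →L[ℝ] V) : V →L[ℝ] V).toLinearMap ∘ₗ a.1.subtype
  have hT : ∀ (u : a.1), ∀ v ∈ a.1, inner ℝ (R (R (u : V)) - T u) v = 0 := fun u v hv =>
    a.1.starProjection_inner_eq_zero _ v hv
  have hinj : Function.Injective T := by
    refine (injective_iff_map_eq_zero _).2 fun u hu => ?_
    have h1 := hT u u u.2
    rw [hu, Submodule.coe_zero, sub_zero, hR, inner_cliffordOp_symm_left] at h1
    have h2 : (cliffordOp l).symm (u : V) = 0 := inner_self_eq_zero.1 h1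
    exact Subtype.ext ((cliffordOp l).symm.map_eq_zero_iff.1 h2)
  obtain ⟨u, hu⟩ := LinearMap.injective_iff_surjective.1 hinj ⟨w, hw⟩
  refine ⟨⟨w - R (R u), (Submodule.mem_orthogonal' _ _).2 fun v hv => ?_,
    sub_mem (hb.le hw) (hb.symm_symm u u.2)⟩, fun z hz => ?_⟩
  · have h1 := hT u v hv
    rw [hu] at h1
    rw [← neg_sub, inner_neg_left, h1, neg_zero]
  · have h1 : cliffordOp l (w - R (R u)) = cliffordOp l w - R (u : V) := by
      rw [map_sub, hR, ContinuousLinearEquiv.apply_symm_apply]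
    have h2 : inner ℝ (R (u : V)) (cliffordOp l z) = 0 := by
      rw [hR, inner_cliffordOp_symm_left, ContinuousLinearEquiv.symm_apply_apply]
      exact (Submodule.mem_orthogonal _ _).1 hz u u.2
    change _ = inner ℝ (cliffordOp l (w - R (R u))) (cliffordOp l z)
    rw [h1, inner_sub_left, h2, sub_zero]

/-- Since `C² E_a ⊆ E_b`, the vector `C v` is already orthogonal to `Ē_a = C E_a`; it lies in both
subspaces and the unitary fixes it. -/
lemma IsLarge.inducedClifford_of_diff {a b c : FinSub V} (hb : IsLarge l a b) (hbc : b ≤ c)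
    {v : V} (hv : v ∈ (diff b c).1) :
    (inducedClifford l (hb.le.trans hbc) ⟨v, diff_anti hb.le hv⟩ : V) = cliffordOp l v := by
  rw [coe_inducedClifford]
  refine coe_projUnitary_of_mem _ _ ⟨(Submodule.mem_orthogonal _ _).2 fun u hu => ?_,
    bar_mono l (diff_le a c) (toBar l (diff a c) _).2⟩
  obtain ⟨w, hw⟩ := (toBar l a).surjective ⟨u, hu⟩
  have hw' : cliffordOp l (w : V) = u := congrArg Subtype.val hw
  rw [coe_toBar, ← inner_cliffordOp_left, ← hw']
  exact (Submodule.mem_orthogonal _ _).1 hv.1 _ (hb.op_op w w.2)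

/-- On `Ē_ba` both projections subtract the component in `Ē_a`. The polar parts agree as well
because `Ē_ba` is invariant under `P* P` for the larger projection `P`; this is where `exists_diff`
is needed, to replace the subtracted `C w` with `w ∈ E_a` by `C g` with `g ∈ E_ba`. -/
lemma IsLarge.inducedClifford_incl {a b c : FinSub V} (hb : IsLarge l a b) (hbc : b ≤ c)
    (v : (diff a b).1) :
    (inducedClifford l (hb.le.trans hbc) (incl (diff_mono hbc) v) : V) =
      inducedClifford l hb.le v := by
  rw [coe_inducedClifford, coe_inducedClifford]
  have h1 := projUnitary_restrict (bijective_proj_diff l hb.le)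
    (bijective_proj_diff l (hb.le.trans hbc)) (incl (bar_mono l (diff_mono hbc)))
    (incl (diff_mono (bar_mono l hbc))) (fun x => Subtype.ext ?_) (fun x => ?_)
    (toBar l (diff a b) v)
  · exact congrArg Subtype.val h1
  · rw [coe_incl, coe_proj_diff (bar_mono l hb.le) x (bar_mono l (diff_le a b) x.2),
      coe_proj_diff (bar_mono l (hb.le.trans hbc)) (incl (bar_mono l (diff_mono hbc)) x)
        (bar_mono l ((diff_le a b).trans hbc) x.2)]
    rfl
  · obtain ⟨e, rfl⟩ := (toBar l (diff a b)).surjective x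
    obtain ⟨w, hw⟩ := (toBar l a).surjective
      (proj (bar l (diff a b)) (bar l a) (toBar l (diff a b) e))
    obtain ⟨g, hg⟩ := hb.exists_diff w.2
    refine ⟨toBar l (diff a b) (e - g), fun z => ?_⟩
    obtain ⟨z, rfl⟩ := (toBar l (diff a c)).surjective z
    have h2 : (proj (bar l (diff a c)) (diff (bar l a) (bar l c))
        (incl (bar_mono l (diff_mono hbc)) (toBar l (diff a b) e)) : V) =
        cliffordOp l (e : V) - cliffordOp l (w : V) := by
      rw [coe_proj_diff (bar_mono l (hb.le.trans hbc))
        (incl (bar_mono l (diff_mono hbc)) (toBar l (diff a b) e))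
        (bar_mono l ((diff_le a b).trans hbc) (toBar l (diff a b) e).2)]
      exact congrArg (fun y : (bar l a).1 => cliffordOp l (e : V) - (y : V)) hw.symm
    rw [h2, coe_incl, coe_toBar, coe_toBar, Submodule.coe_sub, map_sub, inner_sub_left,
      inner_sub_left, hg z z.2.1]

/-- For large `E_b`, the induced Clifford operator of `E_ca` is that of `E_ba` on `E_ba` and `l̄* l`
on `E_cb`. -/
theorem IsLarge.inducedClifford_proj {a b c : FinSub V} (hb : IsLarge l a b) (hbc : b ≤ c)
    (v : c.1) :
    (inducedClifford l (hb.le.trans hbc) (proj c (diff a c) v) : V) =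
      inducedClifford l hb.le (proj b (diff a b) (proj c b v)) +
        cliffordOp l (proj c (diff b c) v : V) := by
  have h1 : proj c (diff a c) v = incl (diff_mono hbc) (proj b (diff a b) (proj c b v)) +
      ⟨(proj c (diff b c) v : V), diff_anti hb.le (proj c (diff b c) v).2⟩ :=
    Subtype.ext (coe_proj_diff_add hb.le hbc v)
  rw [h1, map_add, Submodule.coe_add, hb.inducedClifford_incl hbc,
    hb.inducedClifford_of_diff hbc (proj c (diff b c) v).2]

/-- `C E_a ⊆ E_b`, so `Ē_a` lies in both `Ē_b` and `E_b`, where `pr_b` is the identity. -/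
lemma IsLarge.coe_pr {a b : FinSub V} (hb : IsLarge l a b) {x : V} (hx : x ∈ (bar l a).1) :
    (pr l b ⟨x, bar_mono l hb.le hx⟩ : V) = x := by
  refine coe_projUnitary_of_mem _ _ ?_
  obtain ⟨w, hw, rfl⟩ := hx
  exact hb.op w hw

/-- `C⁻¹ E_a ⊆ E_b`, so `E_a ⊆ C E_b = Ē_b`. -/
lemma IsLarge.coe_pr_symm {a b : FinSub V} (hb : IsLarge l a b) {x : V} (hx : x ∈ a.1) :
    ((pr l b).symm ⟨x, hb.le hx⟩ : V) = x := by
  refine coe_projUnitary_symm_of_mem _ _ ?_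
  exact ⟨(cliffordOp l).symm x, hb.symm x hx, (cliffordOp l).apply_symm_apply x⟩

lemma IsLarge.trans_le {a b c : FinSub V} (hb : IsLarge l a b) (hbc : b ≤ c) : IsLarge l a c :=
  ⟨hb.le.trans hbc, fun w hw => hbc (hb.op w hw), fun w hw => hbc (hb.op_op w hw),
    fun w hw => hbc (hb.symm w hw), fun w hw => hbc (hb.symm_symm w hw)⟩

end FinSub

end Induced

end

end HilbertClifford

namespace HilbertClifford

noncomputable section

set_option linter.unusedSectionVars false

/-! ## The two directed systems and the maps between them -/

section Compositions

variable {E W E₁ W₁ E₂ W₂ : Type*}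
  [NormedAddCommGroup E] [InnerProductSpace ℝ E] [FiniteDimensional ℝ E]
  [NormedAddCommGroup W] [InnerProductSpace ℝ W] [FiniteDimensional ℝ W]
  [NormedAddCommGroup E₁] [InnerProductSpace ℝ E₁] [FiniteDimensional ℝ E₁]
  [NormedAddCommGroup W₁] [InnerProductSpace ℝ W₁] [FiniteDimensional ℝ W₁]
  [NormedAddCommGroup E₂] [InnerProductSpace ℝ E₂] [FiniteDimensional ℝ E₂]
  [NormedAddCommGroup W₂] [InnerProductSpace ℝ W₂] [FiniteDimensional ℝ W₂]

/-- The summands of the composite operator are orthogonal, so its vanishing forces both to vanish.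
The existential form supplies the side conditions of the composite together with the equation. -/
lemma exists_bott_bott (i : W →ₗᵢ[ℝ] W₁) (p : E₁ →ₗ[ℝ] E) (C : E₁ →ₗ[ℝ] W₁)
    (hC : ∀ v y, inner ℝ (C v) (i y) = 0) (hinj : ∀ v, p v = 0 → C v = 0 → v = 0)
    (i' : W₁ →ₗᵢ[ℝ] W₂) (p' : E₂ →ₗ[ℝ] E₁) (C' : E₂ →ₗ[ℝ] W₂)
    (hC' : ∀ v y, inner ℝ (C' v) (i' y) = 0) (hinj' : ∀ v, p' v = 0 → C' v = 0 → v = 0) :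
    ∃ hC'' hinj'', ∀ F : SC E W, bott i' p' C' hC' hinj' (bott i p C hC hinj F) =
      bott (i'.comp i) (p ∘ₗ p') (C' + i'.toLinearMap ∘ₗ C ∘ₗ p') hC'' hinj'' F := by
  refine ⟨fun v y => ?_, fun v h1 h2 => ?_, fun F => bott_bott (fun _ => rfl) (fun _ => rfl)
    (fun _ => rfl) F⟩
  · change inner ℝ (C' v + i' (C (p' v))) (i' (i y)) = 0
    rw [inner_add_left, hC', i'.inner_map_map, hC, add_zero]
  · have h3 : C' v + i' (C (p' v)) = 0 := h2
    have h4 : i' (C (p' v)) = 0 := by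
      refine (inner_self_eq_zero (𝕜 := ℝ)).1 ?_
      have h5 := congrArg (fun z => inner ℝ z (i' (C (p' v)))) h3
      simpa only [inner_add_left, hC', zero_add, inner_zero_left] using h5
    have h6 : C (p' v) = 0 := i'.injective (h4.trans (map_zero i').symm)
    rw [h4, add_zero] at h3
    exact hinj' v (hinj _ h1 h6) h3

lemma exists_push_bott (i : W →ₗᵢ[ℝ] W₁) (p : E₁ →ₗ[ℝ] E) (C : E₁ →ₗ[ℝ] W₁)
    (hC : ∀ v y, inner ℝ (C v) (i y) = 0) (hinj : ∀ v, p v = 0 → C v = 0 → v = 0)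
    (j : W₁ →ₗᵢ[ℝ] W₂) :
    ∃ hC'' hinj'', ∀ F : SC E W, push (LinearEquiv.refl ℝ E₁) j (bott i p C hC hinj F) =
      bott (j.comp i) p (j.toLinearMap ∘ₗ C) hC'' hinj'' F :=
  ⟨fun v y => (j.inner_map_map _ _).trans (hC v y),
    fun v h1 h2 => hinj v h1 (j.injective (h2.trans (map_zero j).symm)),
    fun F => push_bott (fun _ => rfl) (fun _ => rfl) (fun _ => rfl) F⟩

end Compositions

section Systems

open FinSub

variable {V W : Type*} [NormedAddCommGroup V] [InnerProductSpace ℝ V] [CompleteSpace V]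
  [NormedAddCommGroup W] [InnerProductSpace ℝ W] [CompleteSpace W]

lemma FinSub.proj_incl {a b : FinSub V} (h : a ≤ b) (q : a.1) : proj b a (incl h q) = q :=
  Subtype.ext (coe_proj_of_mem (incl h q) q.2)

lemma FinSub.proj_diff_incl {a b : FinSub V} (h : a ≤ b) (q : a.1) :
    proj b (diff a b) (incl h q) = 0 := by
  refine Subtype.ext ?_
  rw [coe_proj_diff h (incl h q) (h q.2), coe_incl, proj_incl h, sub_self, Submodule.coe_zero]

lemma norm_bottStd {a b : FinSub V} (h : a ≤ b) (F : SC a.1 a.1) : ‖bottStd a b h F‖ = ‖F‖ := by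
  unfold bottStd
  exact norm_bott (incl h) (proj_incl h) (fun q => by
    rw [LinearMap.comp_apply, proj_diff_incl h, map_zero]) F

lemma exists_bottStd_eq {a b : FinSub V} (h : a ≤ b) : ∃ hC hinj, ∀ F, bottStd a b h F =
    bott (incl h) (proj b a) ((incl (diff_le a b)).toLinearMap ∘ₗ proj b (diff a b)) hC hinj F :=
  ⟨_, _, fun _ => rfl⟩

/-- The Clifford operators are inclusions, and they add up along `E_ca = E_ba ⊕ E_cb`. -/
lemma bottStd_bottStd {a b c : FinSub V} (hab : a ≤ b) (hbc : b ≤ c) (F : SC a.1 a.1) :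
    bottStd b c hbc (bottStd a b hab F) = bottStd a c (hab.trans hbc) F := by
  obtain ⟨hC₁, hinj₁, h₁⟩ := exists_bottStd_eq hab
  obtain ⟨hC₂, hinj₂, h₂⟩ := exists_bottStd_eq hbc
  obtain ⟨hC₃, hinj₃, h₃⟩ := exists_bottStd_eq (hab.trans hbc)
  rw [h₁, h₂, h₃]
  refine bott_bott (fun y => ?_) (fun v => ?_) (fun v => ?_) F
  · rfl
  · exact (proj_proj hab v).symm
  · refine Subtype.ext ?_
    change (proj c (diff a c) v : V) = proj c (diff b c) v + proj b (diff a b) (proj c b v)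
    rw [coe_proj_diff_add hab hbc, add_comm]

variable (V) in
/-- The Bott maps form a directed system. -/
theorem asymptoticSystem_bottStd :
    AsymptoticSystem (A := fun a : FinSub V => SC a.1 a.1) bottStd where
  norm_map a b h F := norm_bottStd h F
  coherent a F ε hε := by
    refine ⟨a, fun b hab _ c hbc => ?_⟩
    rw [bottStd_bottStd, sub_self, norm_zero]
    exact hε.le

variable {l : V ≃L[ℝ] W}

variable (l) in
lemma exists_bottInd_eq {a b : FinSub V} (h : a ≤ b) : ∃ hC hinj, ∀ F, bottInd l a b h F =
    bott (incl (bar_mono l h)) (proj b a) (inducedClifford l h ∘ₗ proj b (diff a b)) hC hinj F :=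
  ⟨_, _, fun _ => rfl⟩

lemma norm_bottInd {a b : FinSub V} (h : a ≤ b) (F : SC a.1 (bar l a).1) :
    ‖bottInd l a b h F‖ = ‖F‖ := by
  unfold bottInd
  exact norm_bott (incl h) (proj_incl h) (fun q => by
    rw [LinearMap.comp_apply, proj_diff_incl h, map_zero]) F

/-- For large `b` the operators of the composite and of the direct map agree on `E_ba`, and on
`E_cb` they differ by the induced operator minus `C`, which is small far out. -/
lemma exists_norm_bottInd_bottInd_sub_le (hl : AsymptoticallyUnitary l) (a : FinSub V)
    (F : SC a.1 (bar l a).1) {δ : ℝ} (hδ : 0 < δ) :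
    ∃ b₁, ∀ b (hab : a ≤ b), b₁ ≤ b → ∀ c (hbc : b ≤ c),
      ‖bottInd l b c hbc (bottInd l a b hab F) - bottInd l a c (hab.trans hbc) F‖ ≤ δ := by
  obtain ⟨η, hη⟩ := exists_isModulus F hδ
  obtain ⟨M, hM0, hM⟩ := exists_norm_le_mul_norm_cliffordOp l
  -- The error `2 ε (1 + M)` of the induced operator, times the `M` from `‖v_ca‖ ≤ M ‖C v_ca‖`, must
  -- equal `η`.
  set ε : ℝ := η / (2 * (1 + M) * M) with hεdef
  have hε : 0 < ε := div_pos hη.1 (by positivity)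
  have hεη : ε * (2 * (1 + M) * M) = η := div_mul_cancel₀ _ (by positivity)
  obtain ⟨E, hE⟩ := hl.exists_isNear hε
  obtain ⟨b₁, hb₁⟩ := exists_isLarge l a
  refine ⟨E ⊔ b₁, fun b hab hb c hbc => ?_⟩
  have hbE : IsNear l b ε := hE.mono (le_sup_left.trans hb)
  have hbL : IsLarge l a b := hb₁ b (le_sup_right.trans hb)
  obtain ⟨hC₁, hinj₁, h₁⟩ := exists_bottInd_eq l hab
  obtain ⟨hC₂, hinj₂, h₂⟩ := exists_bottInd_eq l hbc
  obtain ⟨hC₃, hinj₃, h₃⟩ := exists_bottInd_eq l (hab.trans hbc)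
  obtain ⟨hC, hinj, hcomp⟩ := exists_bott_bott _ _ _ hC₁ hinj₁ _ _ _ hC₂ hinj₂
  -- The order is reversed so that the error is measured against the direct operator, whose value at
  -- `v_ca` has norm exactly `‖C v_ca‖`.
  rw [norm_sub_rev, h₁, h₂, h₃, hcomp]
  refine norm_bott_sub_bott_le hη (fun _ => rfl) (fun v => (proj_proj hab v).symm) fun v => ?_
  set vca := proj c (diff a c) v with hvca
  set vcb := proj c (diff b c) v with hvcb
  set vba := proj b (diff a b) (proj c b v) with hvba
  change ‖(inducedClifford l (hab.trans hbc) vca : V) -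
      (inducedClifford l hbc vcb + inducedClifford l hab vba)‖ ≤
    η * ‖(inducedClifford l (hab.trans hbc) vca : V)‖
  have h1 : (inducedClifford l (hab.trans hbc) vca : V) -
      (inducedClifford l hbc vcb + inducedClifford l hab vba) =
      -((inducedClifford l hbc vcb : V) - cliffordOp l (vcb : V)) := by
    rw [hvca, hbL.inducedClifford_proj hbc v]
    abel
  have h2 := hbE.norm_inducedClifford_sub_le hbc hε.le hM vcb
  have h3 : ‖(vcb : V)‖ ≤ ‖(vca : V)‖ := (norm_proj_diff_le hab hbc v).2
  have h4 := hM (vca : V)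
  rw [h1, norm_neg, norm_inducedClifford]
  refine h2.trans ?_
  rw [← hεη]
  calc 2 * (ε * (1 + M)) * ‖(vcb : V)‖ ≤ 2 * (ε * (1 + M)) * (M * ‖cliffordOp l (vca : V)‖) :=
        mul_le_mul_of_nonneg_left (h3.trans h4) (by positivity)
    _ = _ := by ring

/-- The induced maps form an asymptotically coherent directed system. -/
theorem asymptoticSystem_bottInd (hl : AsymptoticallyUnitary l) :
    AsymptoticSystem (A := fun a : FinSub V => SC a.1 (bar l a).1) (bottInd l) where
  norm_map _ _ h F := norm_bottInd h F
  coherent a F _ hδ := exists_norm_bottInd_bottInd_sub_le hl a F hδ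

variable (l) in
/-- The inverse of `stageMap`. -/
def stageInv (a : FinSub V) : SC a.1 a.1 →⋆ₙₐ[ℂ] SC a.1 (bar l a).1 :=
  push (LinearEquiv.refl ℝ a.1) (pr l a).symm.toLinearIsometry

lemma stageInv_stageMap (a : FinSub V) (F : SC a.1 (bar l a).1) :
    stageInv l a (stageMap l a F) = F :=
  (push_push _ _ _ _ F).trans (push_id (fun _ => rfl) (fun y => (pr l a).symm_apply_apply y) F)

lemma stageMap_stageInv (a : FinSub V) (F : SC a.1 a.1) :
    stageMap l a (stageInv l a F) = F :=
  (push_push _ _ _ _ F).trans (push_id (fun _ => rfl) (fun y => (pr l a).apply_symm_apply y) F)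

set_option maxHeartbeats 1000000 in
/-- The maps `1 ⊗̂ pr_a` asymptotically intertwine the two systems. -/
theorem exists_norm_bottStd_stageMap_sub_le (hl : AsymptoticallyUnitary l) (a : FinSub V)
    (F : SC a.1 (bar l a).1) {δ : ℝ} (hδ : 0 < δ) :
    ∃ b₁, ∀ b (hab : a ≤ b), b₁ ≤ b → ∀ c (hbc : b ≤ c),
      ‖bottStd b c hbc (stageMap l b (bottInd l a b hab F)) -
        stageMap l c (bottInd l a c (hab.trans hbc) F)‖ ≤ δ := by
  obtain ⟨η, hη⟩ := exists_isModulus F hδ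
  obtain ⟨M, hM0, hM⟩ := exists_norm_le_mul_norm_cliffordOp l
  obtain ⟨K, hK0, hK⟩ := exists_norm_cliffordOp_le l
  -- The terms are the errors of `pr_c` at `y`, of `C - 1` at `v_cb` and of `pr_b` at `z`, all
  -- measured against `‖y‖`; the constants `K` and `M` bound `C` and its inverse.
  set ε : ℝ := η / (2 * M + M + 2 * M * K * M) with hεdef
  have hε : 0 < ε := div_pos hη.1 (by positivity)
  have hεη : ε * (2 * M + M + 2 * M * K * M) = η := div_mul_cancel₀ _ (by positivity)
  obtain ⟨E, hE⟩ := hl.exists_isNear hε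
  obtain ⟨b₁, hb₁⟩ := exists_isLarge l a
  refine ⟨E ⊔ b₁, fun b hab hb c hbc => ?_⟩
  have hbE : IsNear l b ε := hE.mono (le_sup_left.trans hb)
  have hcE : IsNear l c ε := hbE.mono hbc
  have hbL : IsLarge l a b := hb₁ b (le_sup_right.trans hb)
  obtain ⟨hC₁, hinj₁, h₁⟩ := exists_bottInd_eq l hab
  obtain ⟨hC₂, hinj₂, h₂⟩ := exists_bottStd_eq hbc
  obtain ⟨hC₃, hinj₃, h₃⟩ := exists_bottInd_eq l (hab.trans hbc)
  obtain ⟨hC₄, hinj₄, h₄⟩ := exists_push_bott _ _ _ hC₁ hinj₁ (pr l b).toLinearIsometry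
  obtain ⟨hC₅, hinj₅, h₅⟩ := exists_push_bott _ _ _ hC₃ hinj₃ (pr l c).toLinearIsometry
  obtain ⟨hC₆, hinj₆, h₆⟩ := exists_bott_bott _ _ _ hC₄ hinj₄ _ _ _ hC₂ hinj₂
  rw [norm_sub_rev, h₂, h₁, h₃, stageMap, stageMap, h₄, h₅, h₆]
  refine norm_bott_sub_bott_le hη (fun y => Subtype.ext ?_) (fun v => (proj_proj hab v).symm)
    fun v => ?_
  -- The comparison of Bott maps requires equal inclusions of the Clifford variables; both `pr_b`
  -- and `pr_c` are the identity on `Ē_a`.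
  · exact ((hbL.trans_le hbc).coe_pr y.2).trans (hbL.coe_pr y.2).symm
  set vca := proj c (diff a c) v with hvca
  set vcb := proj c (diff b c) v with hvcb
  set vba := proj b (diff a b) (proj c b v) with hvba
  set y := inducedClifford l (hab.trans hbc) vca with hy
  set z := inducedClifford l hab vba with hz
  change ‖(pr l c y : V) - (vcb + pr l b z)‖ ≤ η * ‖(pr l c y : V)‖
  have hyz : (y : V) = z + cliffordOp l (vcb : V) := hbL.inducedClifford_proj hbc v
  have h1 : (pr l c y : V) - (vcb + pr l b z) =
      ((pr l c y : V) - y) + (cliffordOp l (vcb : V) - vcb) - ((pr l b z : V) - z) := by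
    rw [hyz]; abel
  have n1 := hcE.norm_pr_sub_le hε.le hM y
  have n2 := hbE.norm_sub_le vcb
  have n3 := hbE.norm_pr_sub_le hε.le hM z
  have m1 : ‖(vca : V)‖ ≤ M * ‖(y : V)‖ := by
    rw [hy, norm_inducedClifford]; exact hM _
  have m2 : ‖(vcb : V)‖ ≤ M * ‖(y : V)‖ := (norm_proj_diff_le hab hbc v).2.trans m1
  have m3 : ‖(z : V)‖ ≤ K * (M * ‖(y : V)‖) := by
    rw [hz, norm_inducedClifford]
    exact (hK _).trans (mul_le_mul_of_nonneg_left
      ((norm_proj_diff_le hab hbc v).1.trans m1) hK0.le)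
  rw [h1, norm_coe_projUnitary]
  calc _ ≤ 2 * (ε * M) * ‖(y : V)‖ + ε * (M * ‖(y : V)‖) +
        2 * (ε * M) * (K * (M * ‖(y : V)‖)) := by
        refine (norm_sub_le _ _).trans (add_le_add ((norm_add_le _ _).trans
          (add_le_add n1 (n2.trans ?_))) (n3.trans ?_))
        · exact mul_le_mul_of_nonneg_left m2 hε.le
        · exact mul_le_mul_of_nonneg_left m3 (by positivity)
    _ = η * ‖(y : V)‖ := by rw [← hεη]; ring

set_option maxHeartbeats 1000000 in
/-- The inverses of the maps `1 ⊗̂ pr_a` asymptotically intertwine the two systems. -/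
theorem exists_norm_bottInd_stageInv_sub_le (hl : AsymptoticallyUnitary l) (a : FinSub V)
    (F : SC a.1 a.1) {δ : ℝ} (hδ : 0 < δ) :
    ∃ b₁, ∀ b (hab : a ≤ b), b₁ ≤ b → ∀ c (hbc : b ≤ c),
      ‖bottInd l b c hbc (stageInv l b (bottStd a b hab F)) -
        stageInv l c (bottStd a c (hab.trans hbc) F)‖ ≤ δ := by
  obtain ⟨η, hη⟩ := exists_isModulus F hδ
  obtain ⟨M, hM0, hM⟩ := exists_norm_le_mul_norm_cliffordOp l
  -- The terms are the errors of `pr_c⁻¹`, of `C - 1`, of the induced operator minus `C`, and of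
  -- `pr_b⁻¹`. All arguments are components of `y`, so no bound on `C` enters.
  set ε : ℝ := η / (2 * M + 1 + 2 * (1 + M) + 2 * M) with hεdef
  have hε : 0 < ε := div_pos hη.1 (by positivity)
  have hεη : ε * (2 * M + 1 + 2 * (1 + M) + 2 * M) = η := div_mul_cancel₀ _ (by positivity)
  obtain ⟨E, hE⟩ := hl.exists_isNear hε
  obtain ⟨b₁, hb₁⟩ := exists_isLarge l a
  refine ⟨E ⊔ b₁, fun b hab hb c hbc => ?_⟩
  have hbE : IsNear l b ε := hE.mono (le_sup_left.trans hb)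
  have hcE : IsNear l c ε := hbE.mono hbc
  have hbL : IsLarge l a b := hb₁ b (le_sup_right.trans hb)
  obtain ⟨hC₁, hinj₁, h₁⟩ := exists_bottStd_eq hab
  obtain ⟨hC₂, hinj₂, h₂⟩ := exists_bottInd_eq l hbc
  obtain ⟨hC₃, hinj₃, h₃⟩ := exists_bottStd_eq (hab.trans hbc)
  obtain ⟨hC₄, hinj₄, h₄⟩ := exists_push_bott _ _ _ hC₁ hinj₁ (pr l b).symm.toLinearIsometry
  obtain ⟨hC₅, hinj₅, h₅⟩ := exists_push_bott _ _ _ hC₃ hinj₃ (pr l c).symm.toLinearIsometry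
  obtain ⟨hC₆, hinj₆, h₆⟩ := exists_bott_bott _ _ _ hC₄ hinj₄ _ _ _ hC₂ hinj₂
  rw [norm_sub_rev, h₂, h₁, h₃, stageInv, stageInv, h₄, h₅, h₆]
  refine norm_bott_sub_bott_le hη (fun y => Subtype.ext ?_) (fun v => (proj_proj hab v).symm)
    fun v => ?_
  · exact ((hbL.trans_le hbc).coe_pr_symm y.2).trans (hbL.coe_pr_symm y.2).symm
  set vca := proj c (diff a c) v with hvca
  set vcb := proj c (diff b c) v with hvcb
  set vba := proj b (diff a b) (proj c b v) with hvba
  set y := incl (diff_le a c) vca with hy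
  set z := incl (diff_le a b) vba with hz
  change ‖((pr l c).symm y : V) - (inducedClifford l hbc vcb + (pr l b).symm z)‖ ≤
    η * ‖(pr l c).symm y‖
  have hyz : (y : V) = z + vcb := coe_proj_diff_add hab hbc v
  have h1 : ((pr l c).symm y : V) - (inducedClifford l hbc vcb + (pr l b).symm z) =
      (((pr l c).symm y : V) - y) - (cliffordOp l (vcb : V) - vcb) -
        ((inducedClifford l hbc vcb : V) - cliffordOp l (vcb : V)) -
        (((pr l b).symm z : V) - z) := by
    rw [hyz]; abel
  have n1 := hcE.norm_pr_symm_sub_le hε.le hM y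
  have n2 := hbE.norm_sub_le vcb
  have n3 := hbE.norm_inducedClifford_sub_le hbc hε.le hM vcb
  have n4 := hbE.norm_pr_symm_sub_le hε.le hM z
  have m2 : ‖(vcb : V)‖ ≤ ‖(y : V)‖ := (norm_proj_diff_le hab hbc v).2
  have m3 : ‖(z : V)‖ ≤ ‖(y : V)‖ := (norm_proj_diff_le hab hbc v).1
  rw [h1, LinearIsometryEquiv.norm_map]
  calc _ ≤ 2 * (ε * M) * ‖(y : V)‖ + ε * ‖(y : V)‖ + 2 * (ε * (1 + M)) * ‖(y : V)‖ +
        2 * (ε * M) * ‖(y : V)‖ := by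
        refine (norm_sub_le _ _).trans (add_le_add ((norm_sub_le _ _).trans
          (add_le_add ((norm_sub_le _ _).trans (add_le_add n1 (n2.trans ?_)))
            (n3.trans ?_))) (n4.trans ?_))
        · exact mul_le_mul_of_nonneg_left m2 hε.le
        · exact mul_le_mul_of_nonneg_left m2 (by positivity)
        · exact mul_le_mul_of_nonneg_left m3 (by positivity)
    _ = η * ‖y‖ := by rw [← hεη, Submodule.coe_norm]; ring

end Systems

end

end HilbertClifford

namespace HilbertClifford

noncomputable section

set_option linter.unusedSectionVars false

/-! ## Isomorphisms and group actions of direct limits -/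

section Abstract

/-- Mutually inverse `*`-homomorphisms form a `*`-isomorphism. -/
def starAlgEquivOfInverse {A B : Type*} [NonUnitalCStarAlgebra A] [NonUnitalCStarAlgebra B]
    (f : A →⋆ₙₐ[ℂ] B) (g : B →⋆ₙₐ[ℂ] A) (h₁ : ∀ x, g (f x) = x) (h₂ : ∀ y, f (g y) = y) :
    A ≃⋆ₐ[ℂ] B where
  toFun := f
  invFun := g
  left_inv := h₁
  right_inv := h₂
  map_mul' := map_mul f
  map_add' := map_add f
  map_star' := map_star f
  map_smul' := map_smul f

/-- A group action by `*`-endomorphisms is an action by `*`-automorphisms. -/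
def actionOfEndomorphisms {Γ A : Type*} [Group Γ] [NonUnitalCStarAlgebra A]
    (ρ : Γ → A →⋆ₙₐ[ℂ] A) (h1 : ∀ x, ρ 1 x = x) (hmul : ∀ γ γ' x, ρ (γ * γ') x = ρ γ (ρ γ' x)) :
    Γ →* (A ≃⋆ₐ[ℂ] A) where
  toFun γ := starAlgEquivOfInverse (ρ γ) (ρ γ⁻¹)
    (fun x => by rw [← hmul, inv_mul_cancel, h1]) (fun x => by rw [← hmul, mul_inv_cancel, h1])
  map_one' := StarAlgEquiv.ext h1
  map_mul' γ γ' := StarAlgEquiv.ext (hmul γ γ')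

variable {ι κ : Type*} [SemilatticeSup ι] [Nonempty ι] [SemilatticeSup κ] [Nonempty κ]
  {A : ι → Type*} {B : κ → Type*} [∀ a, NonUnitalCStarAlgebra (A a)]
  [∀ a, NonUnitalCStarAlgebra (B a)] {α : ∀ a b, a ≤ b → A a →⋆ₙₐ[ℂ] A b}
  {β : ∀ a b, a ≤ b → B a →⋆ₙₐ[ℂ] B b}

/-- Strict intertwining turns the net into the orbit of `θ_a(v)` read along `σ`, and orbits converge
to the image of their starting point. -/
lemma AsymptoticSystem.tendsto_toLim_comp (hβ : AsymptoticSystem β) {σ : ι → κ} (hσ : Monotone σ)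
    (hσt : Tendsto σ atTop atTop) (θ : ∀ a, A a →⋆ₙₐ[ℂ] B (σ a))
    (hθ : ∀ a b h v, θ b (α a b h v) = β (σ a) (σ b) (hσ h) (θ a v)) (a : ι) (v : A a) :
    Tendsto (fun b => ((toLim β (σ b)).comp (θ b)) (orbitNet α a v b)) atTop
      (𝓝 (toLim β (σ a) (θ a v))) := by
  refine ((hβ.tendsto_toLim_orbitNet (σ a) (θ a v)).comp hσt).congr' ?_
  filter_upwards [eventually_ge_atTop a] with b hb
  rw [Function.comp_apply, orbitNet_apply β (hσ hb), orbitNet_apply α hb,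
    NonUnitalStarAlgHom.comp_apply, hθ]

/-- Asymptotic intertwining is the Cauchy condition of `exists_tendsto_toLim` for the net
`θ_b(α_ba(v))`. -/
lemma exists_tendsto_toLim_comp {B : ι → Type*} [∀ a, NonUnitalCStarAlgebra (B a)]
    {β : ∀ a b, a ≤ b → B a →⋆ₙₐ[ℂ] B b} (θ : ∀ a, A a →⋆ₙₐ[ℂ] B a)
    (hθ : ∀ a v (δ : ℝ), 0 < δ → ∃ b₁, ∀ b (hab : a ≤ b), b₁ ≤ b → ∀ c (hbc : b ≤ c),
      ‖β b c hbc (θ b (α a b hab v)) - θ c (α a c (hab.trans hbc) v)‖ ≤ δ) (a : ι) (v : A a) :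
    ∃ w, Tendsto (fun b => ((toLim β b).comp (θ b)) (orbitNet α a v b)) atTop (𝓝 w) := by
  refine AsymptoticSystem.exists_tendsto_toLim (fun b => θ b (orbitNet α a v b)) fun ε hε => ?_
  obtain ⟨b₁, hb₁⟩ := hθ a v ε hε
  refine ⟨a ⊔ b₁, fun b hb c hbc => ?_⟩
  have hab : a ≤ b := le_sup_left.trans hb
  rw [orbitNet_apply α hab, orbitNet_apply α (hab.trans hbc)]
  exact hb₁ b hab (le_sup_right.trans hb) c hbc

end Abstract

/-! ## Isometries -/

section Isometries

open FinSub

variable {V W : Type*} [NormedAddCommGroup V] [InnerProductSpace ℝ V] [CompleteSpace V]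
  [NormedAddCommGroup W] [InnerProductSpace ℝ W] [CompleteSpace W]

/-! ### Naturality of Bott maps under changes of variables -/

section PushBott

variable {E W E₁ W₁ E' W' E₁' W₁' : Type*}
  [NormedAddCommGroup E] [InnerProductSpace ℝ E] [FiniteDimensional ℝ E]
  [NormedAddCommGroup W] [InnerProductSpace ℝ W] [FiniteDimensional ℝ W]
  [NormedAddCommGroup E₁] [InnerProductSpace ℝ E₁] [FiniteDimensional ℝ E₁]
  [NormedAddCommGroup W₁] [InnerProductSpace ℝ W₁] [FiniteDimensional ℝ W₁]
  [NormedAddCommGroup E'] [InnerProductSpace ℝ E'] [FiniteDimensional ℝ E']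
  [NormedAddCommGroup W'] [InnerProductSpace ℝ W'] [FiniteDimensional ℝ W']
  [NormedAddCommGroup E₁'] [InnerProductSpace ℝ E₁'] [FiniteDimensional ℝ E₁']
  [NormedAddCommGroup W₁'] [InnerProductSpace ℝ W₁'] [FiniteDimensional ℝ W₁']

/-- Both sides equal one Bott map with operator `C'`, by `push_bott` and `bott_push`. -/
lemma push_bott_comm {i : W →ₗᵢ[ℝ] W₁} {p : E₁ →ₗ[ℝ] E} {C : E₁ →ₗ[ℝ] W₁}
    {hC : ∀ v y, inner ℝ (C v) (i y) = 0} {hinj : ∀ v, p v = 0 → C v = 0 → v = 0}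
    {i' : W' →ₗᵢ[ℝ] W₁'} {p' : E₁' →ₗ[ℝ] E'} {C' : E₁' →ₗ[ℝ] W₁'}
    {hC' : ∀ v y, inner ℝ (C' v) (i' y) = 0} {hinj' : ∀ v, p' v = 0 → C' v = 0 → v = 0}
    {ψ : E' ≃ₗ[ℝ] E} {j : W →ₗᵢ[ℝ] W'} {ψ₁ : E₁' ≃ₗ[ℝ] E₁} {j₁ : W₁ →ₗᵢ[ℝ] W₁'}
    (hi : ∀ y, i' (j y) = j₁ (i y)) (hp : ∀ v, ψ (p' v) = p (ψ₁ v))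
    (h : ∀ v, C' v = j₁ (C (ψ₁ v))) (F : SC E W) :
    push ψ₁ j₁ (bott i p C hC hinj F) = bott i' p' C' hC' hinj' (push ψ j F) :=
  (push_bott (i'' := i'.comp j) (p'' := (ψ : E' →ₗ[ℝ] E) ∘ₗ p') (C'' := C')
    (hC'' := fun v y => hC' v (j y))
    (hinj'' := fun v h1 h2 => hinj' v (ψ.injective (h1.trans (map_zero ψ).symm)) h2)
    hi hp h F).trans (bott_push (fun _ => rfl) (fun _ => rfl) (fun _ => rfl) F).symm

end PushBott

lemma FinSub.mem_image {g : V ≃ₗᵢ[ℝ] V} {a : FinSub V} {w : V} :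
    w ∈ (image g a).1 ↔ g.symm w ∈ a.1 := by
  constructor
  · rintro ⟨x, hx, rfl⟩
    change g.symm (g x) ∈ a.1
    rwa [g.symm_apply_apply]
  · intro h
    exact ⟨g.symm w, h, g.apply_symm_apply w⟩

lemma FinSub.apply_mem_image (g : V ≃ₗᵢ[ℝ] V) {a : FinSub V} {w : V} (hw : w ∈ a.1) :
    g w ∈ (image g a).1 := ⟨w, hw, rfl⟩

lemma FinSub.image_mono (g : V ≃ₗᵢ[ℝ] V) : Monotone (image g : FinSub V → FinSub V) :=
  fun _ _ h => Submodule.map_mono h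

lemma FinSub.tendsto_image (g : V ≃ₗᵢ[ℝ] V) :
    Tendsto (image g : FinSub V → FinSub V) atTop atTop :=
  tendsto_atTop_atTop_of_monotone (image_mono g) fun b =>
    ⟨image g.symm b, fun w hw => mem_image.2 (apply_mem_image g.symm hw)⟩

lemma FinSub.inner_apply_symm (g : V ≃ₗᵢ[ℝ] V) (x y : V) :
    inner ℝ (g x) y = inner ℝ x (g.symm y) := by
  nth_rewrite 1 [← g.apply_symm_apply y]
  exact g.inner_map_map _ _

lemma FinSub.diff_image (g : V ≃ₗᵢ[ℝ] V) (a b : FinSub V) :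
    diff (image g a) (image g b) = image g (diff a b) := by
  refine Subtype.ext (Submodule.ext fun w => ?_)
  rw [mem_image]
  refine and_congr ?_ mem_image
  change w ∈ (image g a).1ᗮ ↔ g.symm w ∈ a.1ᗮ
  rw [Submodule.mem_orthogonal, Submodule.mem_orthogonal]
  constructor
  · intro h u hu
    rw [← inner_apply_symm]
    exact h _ (apply_mem_image g hu)
  · rintro h _ ⟨u, hu, rfl⟩
    exact (inner_apply_symm g u w).trans (h u hu)

lemma FinSub.bar_image (l : V ≃L[ℝ] W) (g : V ≃ₗᵢ[ℝ] V)
    (hg : ∀ x, cliffordOp l (g x) = g (cliffordOp l x)) (a : FinSub V) :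
    bar l (image g a) = image g (bar l a) := by
  refine Subtype.ext (Submodule.ext fun w => ?_)
  constructor
  · rintro ⟨_, ⟨x, hx, rfl⟩, rfl⟩
    exact ⟨cliffordOp l x, ⟨x, hx, rfl⟩, (hg x).symm⟩
  · rintro ⟨_, ⟨x, hx, rfl⟩, rfl⟩
    exact ⟨g x, ⟨x, hx, rfl⟩, hg x⟩

/-- Orthogonal projections are natural under isometries. The target enters through an equation,
because complements and spaces `Ē` of images are equal to images only propositionally. -/
lemma FinSub.coe_proj_image (g : V ≃ₗᵢ[ℝ] V) {a b a' b' : FinSub V} (hb : b' = image g b)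
    (x : a.1) (x' : a'.1) (h : (x' : V) = g x) : (proj a' b' x' : V) = g (proj a b x) := by
  subst hb
  refine coe_proj_eq x' (apply_mem_image g (proj a b x).2) ?_
  rintro _ ⟨_, hw, rfl⟩
  rw [h, ← map_sub]
  exact (g.inner_map_map _ _).trans (inner_coe_sub_proj x hw)

/-- A case of `projUnitary_restrict` in which the inclusions are onto, so the invariance condition
is automatic. -/
lemma FinSub.coe_projUnitary_image (g : V ≃ₗᵢ[ℝ] V) {a b a' b' : FinSub V} (ha : a' = image g a)
    (hb : b' = image g b) (h : Function.Bijective (proj a b)) (h' : Function.Bijective (proj a' b'))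
    (x : a.1) (x' : a'.1) (hx : (x' : V) = g x) :
    (projUnitary a' b' h' x' : V) = g (projUnitary a b h x) := by
  subst ha hb
  obtain rfl : x' = toImage g a x := Subtype.ext hx
  have h1 := projUnitary_restrict h h' (toImage g a).toLinearIsometry
    (toImage g b).toLinearIsometry (fun x => Subtype.ext (coe_proj_image g rfl x _ rfl))
    (fun x => by
      obtain ⟨y, hy⟩ := (toImage g a).surjective
        (proj (image g b) (image g a) (proj (image g a) (image g b) (toImage g a x)))
      refine ⟨y, fun z => ?_⟩
      have h2 : (toImage g a).toLinearIsometry y = toImage g a y := rfl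
      rw [h2, hy, inner_proj]
      rfl) x
  exact congrArg Subtype.val h1

lemma FinSub.coe_toImage_symm (g : V ≃ₗᵢ[ℝ] V) (a : FinSub V) (x : (image g a).1) :
    (((toImage g a).symm x : a.1) : V) = g.symm x := by
  obtain ⟨y, rfl⟩ := (toImage g a).surjective x
  rw [LinearIsometryEquiv.symm_apply_apply]
  exact (g.symm_apply_apply _).symm

lemma FinSub.toImage_symm_proj (g : V ≃ₗᵢ[ℝ] V) (a c : FinSub V) (v : (image g c).1) :
    (toImage g a).symm (proj (image g c) (image g a) v) = proj c a ((toImage g c).symm v) := by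
  obtain ⟨u, rfl⟩ := (toImage g c).surjective v
  rw [LinearIsometryEquiv.symm_apply_apply, LinearIsometryEquiv.symm_apply_eq]
  exact Subtype.ext (coe_proj_image g rfl u _ rfl)

lemma FinSub.coe_proj_diff_image (g : V ≃ₗᵢ[ℝ] V) (a c : FinSub V) (v : (image g c).1) :
    (proj (image g c) (diff (image g a) (image g c)) v : V) =
      g (proj c (diff a c) ((toImage g c).symm v)) := by
  obtain ⟨u, rfl⟩ := (toImage g c).surjective v
  rw [LinearIsometryEquiv.symm_apply_apply]
  exact coe_proj_image g (diff_image g a c) u _ rfl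

lemma actStd_bottStd (g : V ≃ₗᵢ[ℝ] V) {a b : FinSub V} (h : a ≤ b) (F : SC a.1 a.1) :
    actStd g b (bottStd a b h F) =
      bottStd (image g a) (image g b) (image_mono g h) (actStd g a F) := by
  obtain ⟨hC₁, hinj₁, h₁⟩ := exists_bottStd_eq h
  obtain ⟨hC₂, hinj₂, h₂⟩ := exists_bottStd_eq (image_mono g h)
  rw [h₁, h₂, actStd, actStd]
  refine push_bott_comm (fun y => ?_) (fun v => ?_) (fun v => ?_) F
  · rfl
  · exact toImage_symm_proj g a b v
  · exact Subtype.ext (coe_proj_diff_image g a b v)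

/-! ### Isometries commuting with `l̄* l` -/

section Equivariant

variable (l : V ≃L[ℝ] W) (g : V ≃ₗᵢ[ℝ] V) (hg : ∀ x, cliffordOp l (g x) = g (cliffordOp l x))

include hg in
lemma FinSub.inducedClifford_image {a b : FinSub V} (h : a ≤ b) (x : (diff a b).1)
    (x' : (diff (image g a) (image g b)).1) (hx : (x' : V) = g x) :
    (inducedClifford l (image_mono g h) x' : V) = g (inducedClifford l h x) := by
  rw [coe_inducedClifford, coe_inducedClifford]
  refine coe_projUnitary_image g ?_ ?_ _ _ _ _ ?_
  · rw [diff_image, bar_image l g hg]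
  · rw [bar_image l g hg, bar_image l g hg, diff_image]
  · rw [coe_toBar, coe_toBar, hx, hg]

lemma actInd_bottInd {a b : FinSub V} (h : a ≤ b) (F : SC a.1 (bar l a).1) :
    actInd l g hg b (bottInd l a b h F) =
      bottInd l (image g a) (image g b) (image_mono g h) (actInd l g hg a F) := by
  obtain ⟨hC₁, hinj₁, h₁⟩ := exists_bottInd_eq l h
  obtain ⟨hC₂, hinj₂, h₂⟩ := exists_bottInd_eq l (image_mono g h)
  rw [h₁, h₂, actInd, actInd]
  refine push_bott_comm (fun y => ?_) (fun v => ?_) (fun v => ?_) F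
  · rfl
  · exact toImage_symm_proj g a b v
  · exact Subtype.ext (inducedClifford_image l g hg h _ _ (coe_proj_diff_image g a b v))

/-- Equivariance is exact at every finite stage, since `g` carries the polar decomposition for `E_a`
to that for `g(E_a)`. -/
lemma stageMap_actInd (a : FinSub V) (F : SC a.1 (bar l a).1) :
    stageMap l (image g a) (actInd l g hg a F) = actStd g a (stageMap l a F) := by
  rw [stageMap, actInd, actStd, stageMap, push_push, push_push]
  refine push_congr (fun v => rfl) (fun y => Subtype.ext ?_) F
  exact coe_projUnitary_image g (bar_image l g hg a) rfl _ _ y _ rfl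

end Equivariant

/-! ### Comparison of stages over equal subspaces -/

section TransportStd

variable {E W₀ : Type*} [NormedAddCommGroup E] [InnerProductSpace ℝ E] [FiniteDimensional ℝ E]
  [NormedAddCommGroup W₀] [InnerProductSpace ℝ W₀] [FiniteDimensional ℝ W₀]

/-- The algebras over `c` and `c'` are different types although the subspaces are equal, so the
comparison takes place in the limit and on underlying vectors. -/
lemma toLim_bottStd_push_congr {c c' : FinSub V} (h : c = c') {ψ : c.1 ≃ₗ[ℝ] E}
    {ψ' : c'.1 ≃ₗ[ℝ] E} {j : W₀ →ₗᵢ[ℝ] c.1} {j' : W₀ →ₗᵢ[ℝ] c'.1}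
    (hψ : ∀ (x : c.1) (x' : c'.1), (x : V) = x' → ψ x = ψ' x')
    (hj : ∀ y, (j y : V) = j' y) (F : SC E W₀) :
    toLim (A := fun a : FinSub V => SC a.1 a.1) bottStd c (push ψ j F) =
      toLim (A := fun a : FinSub V => SC a.1 a.1) bottStd c' (push ψ' j' F) := by
  subst h
  rw [push_congr (fun v => hψ v v rfl) (fun y => Subtype.ext (hj y)) F]

lemma toLim_bottInd_push_congr (l : V ≃L[ℝ] W) {c c' : FinSub V} (h : c = c')
    {ψ : c.1 ≃ₗ[ℝ] E} {ψ' : c'.1 ≃ₗ[ℝ] E} {j : W₀ →ₗᵢ[ℝ] (bar l c).1}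
    {j' : W₀ →ₗᵢ[ℝ] (bar l c').1}
    (hψ : ∀ (x : c.1) (x' : c'.1), (x : V) = x' → ψ x = ψ' x')
    (hj : ∀ y, (j y : V) = j' y) (F : SC E W₀) :
    toLim (A := fun a : FinSub V => SC a.1 (bar l a).1) (bottInd l) c (push ψ j F) =
      toLim (A := fun a : FinSub V => SC a.1 (bar l a).1) (bottInd l) c' (push ψ' j' F) := by
  subst h
  rw [push_congr (fun v => hψ v v rfl) (fun y => Subtype.ext (hj y)) F]

end TransportStd

end Isometries

end

end HilbertClifford

namespace HilbertClifford

noncomputable section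

/-! ## The canonical isomorphism -/

section Abstract

variable {ι : Type*} [SemilatticeSup ι] [Nonempty ι] {A B : ι → Type*}
  [∀ a, NonUnitalCStarAlgebra (A a)] [∀ a, NonUnitalCStarAlgebra (B a)]
  {α : ∀ a b, a ≤ b → A a →⋆ₙₐ[ℂ] A b} {β : ∀ a b, a ≤ b → B a →⋆ₙₐ[ℂ] B b}

/-- Isomorphisms `A_a ≅ B_a` which asymptotically intertwine two systems induce an isomorphism of
the direct limits. -/
theorem AsymptoticSystem.exists_starAlgEquiv (hα : AsymptoticSystem α) (hβ : AsymptoticSystem β)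
    (θ : ∀ a, A a →⋆ₙₐ[ℂ] B a) (θ' : ∀ a, B a →⋆ₙₐ[ℂ] A a)
    (h₁ : ∀ a v, θ' a (θ a v) = v) (h₂ : ∀ a v, θ a (θ' a v) = v)
    (hθ : ∀ a v (δ : ℝ), 0 < δ → ∃ b₁, ∀ b (hab : a ≤ b), b₁ ≤ b → ∀ c (hbc : b ≤ c),
      ‖β b c hbc (θ b (α a b hab v)) - θ c (α a c (hab.trans hbc) v)‖ ≤ δ)
    (hθ' : ∀ a v (δ : ℝ), 0 < δ → ∃ b₁, ∀ b (hab : a ≤ b), b₁ ≤ b → ∀ c (hbc : b ≤ c),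
      ‖α b c hbc (θ' b (β a b hab v)) - θ' c (β a c (hab.trans hbc) v)‖ ≤ δ) :
    ∃ Φ : DirLim α ≃⋆ₐ[ℂ] DirLim β, ∀ (t : ι → ι) (y : ∀ a, A (t a)) (x : DirLim α),
      Tendsto t atTop atTop → Tendsto (fun a => toLim α (t a) (y a)) atTop (𝓝 x) →
      Tendsto (fun a => toLim β (t a) (θ (t a) (y a))) atTop (𝓝 (Φ x)) := by
  have hT := exists_tendsto_toLim_comp θ hθ
  have hT' := exists_tendsto_toLim_comp θ' hθ'
  refine ⟨starAlgEquivOfInverse (DirLim.limHom _ hT) (DirLim.limHom _ hT') (fun x => ?_)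
    (fun x => ?_), fun _ _ _ ht hy => hα.tendsto_limHom _ hT ht hy⟩
  -- Along a net `y` converging to `x`, applying both limit homomorphisms gives the limit of
  -- `θ'(θ(y))`, which is `y` itself at each stage.
  · obtain ⟨y, hy⟩ := hα.exists_net x
    refine tendsto_nhds_unique ?_ hy
    exact (hβ.tendsto_limHom _ hT' tendsto_id (hα.tendsto_limHom _ hT tendsto_id hy)).congr
      fun a => congrArg (toLim α a) (h₁ a (y a))
  · obtain ⟨y, hy⟩ := hβ.exists_net x
    refine tendsto_nhds_unique ?_ hy
    exact (hα.tendsto_limHom _ hT tendsto_id (hβ.tendsto_limHom _ hT' tendsto_id hy)).congr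
      fun a => congrArg (toLim β a) (h₂ a (y a))

/-- Compatible maps `A_a → A_{γa}` induce a group action on the direct limit. -/
theorem AsymptoticSystem.exists_action (hα : AsymptoticSystem α) {Γ : Type*} [Group Γ]
    {σ : Γ → ι → ι} (hσ : ∀ γ, Monotone (σ γ)) (hσt : ∀ γ, Tendsto (σ γ) atTop atTop)
    (θ : ∀ γ a, A a →⋆ₙₐ[ℂ] A (σ γ a))
    (hθ : ∀ γ a b h v, θ γ b (α a b h v) = α (σ γ a) (σ γ b) (hσ γ h) (θ γ a v))
    (h1 : ∀ a v, toLim α (σ 1 a) (θ 1 a v) = toLim α a v)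
    (hmul : ∀ γ γ' a v, toLim α (σ (γ * γ') a) (θ (γ * γ') a v) =
      toLim α (σ γ (σ γ' a)) (θ γ (σ γ' a) (θ γ' a v))) :
    ∃ ρ : Γ →* (DirLim α ≃⋆ₐ[ℂ] DirLim α), (∀ γ, Continuous (ρ γ)) ∧
      ∀ γ a v, ρ γ (toLim α a v) = toLim α (σ γ a) (θ γ a v) := by
  have ht : ∀ γ a v, Tendsto (fun b => ((toLim α (σ γ b)).comp (θ γ b)) (orbitNet α a v b)) atTop
      (𝓝 (toLim α (σ γ a) (θ γ a v))) := fun γ =>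
    hα.tendsto_toLim_comp (hσ γ) (hσt γ) (θ γ) (hθ γ)
  let ρ : Γ → DirLim α →⋆ₙₐ[ℂ] DirLim α := fun γ => DirLim.limHom _ fun a v => ⟨_, ht γ a v⟩
  have hρ : ∀ γ a v, ρ γ (toLim α a v) = toLim α (σ γ a) (θ γ a v) := fun γ a v =>
    DirLim.limHom_toLim_eq _ _ (ht γ a v)
  refine ⟨actionOfEndomorphisms ρ (fun x => ?_) (fun γ γ' x => ?_),
    fun γ => DirLim.continuous_hom (ρ γ), hρ⟩
  · exact DirLim.hom_ext (f := ρ 1) (g := NonUnitalStarAlgHom.id ℂ (DirLim α))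
      (fun a v => (hρ 1 a v).trans (h1 a v)) x
  -- The group law is checked on generators in the limit, because `σ (γ γ') a` and `σ γ (σ γ' a)`
  -- need not be literally the same index.
  · refine DirLim.hom_ext (f := ρ (γ * γ')) (g := (ρ γ).comp (ρ γ')) (fun a v => ?_) x
    rw [NonUnitalStarAlgHom.comp_apply, hρ, hρ, hρ, hmul]

end Abstract

section Canonical

open FinSub

variable {V W : Type*} [NormedAddCommGroup V] [InnerProductSpace ℝ V] [CompleteSpace V]
  [NormedAddCommGroup W] [InnerProductSpace ℝ W] [CompleteSpace W]

theorem exists_action_bottStd {Γ : Type*} [Group Γ] (π : Γ →* (V ≃ₗᵢ[ℝ] V)) :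
    ∃ ρ : Γ →* (SCH V ≃⋆ₐ[ℂ] SCH V), (∀ γ, Continuous (ρ γ)) ∧
      ∀ γ a (x : SC a.1 a.1), ρ γ (toLim bottStd a x) =
        toLim bottStd (image (π γ) a) (actStd (π γ) a x) := by
  refine (asymptoticSystem_bottStd V).exists_action (fun γ => image_mono (π γ))
    (fun γ => tendsto_image (π γ)) (fun γ a => actStd (π γ) a)
    (fun γ a b h v => actStd_bottStd (π γ) h v) (fun a v => ?_) (fun γ γ' a v => ?_)
  · have h : (π 1 : V ≃ₗᵢ[ℝ] V) = 1 := map_one π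
    -- The identity is presented as a change of variables, so that the two stages can be compared
    -- over the equal subspaces `1(E_a)` and `E_a`.
    conv_rhs => rw [← push_id (ψ := LinearEquiv.refl ℝ a.1) (j := LinearIsometry.id)
      (fun _ => rfl) (fun _ => rfl) v]
    refine toLim_bottStd_push_congr ?_ (fun x x' hx => Subtype.ext ?_) (fun y => ?_) v
    · exact Subtype.ext (Submodule.ext fun w => by rw [mem_image, h]; rfl)
    · refine (coe_toImage_symm (π 1) a x).trans ?_
      rw [hx, h]
      rfl
    · exact DFunLike.congr_fun h (y : V)
  · have h : (π (γ * γ') : V ≃ₗᵢ[ℝ] V) = π γ * π γ' := map_mul π γ γ'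
    have h2 := push_push (toImage (π γ') a).symm.toLinearEquiv (toImage (π γ') a).toLinearIsometry
      (toImage (π γ) (image (π γ') a)).symm.toLinearEquiv
      (toImage (π γ) (image (π γ') a)).toLinearIsometry v
    refine Eq.trans ?_ (congrArg (toLim (A := fun a : FinSub V => SC a.1 a.1) bottStd
      (image (π γ) (image (π γ') a))) h2.symm)
    refine toLim_bottStd_push_congr ?_ (fun x x' hx => Subtype.ext ?_) (fun y => ?_) v
    · exact Subtype.ext (Submodule.ext fun w => by rw [mem_image, mem_image, mem_image, h]; rfl)
    · refine (coe_toImage_symm (π (γ * γ')) a x).trans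
        (Eq.trans ?_ (coe_toImage_symm (π γ') a _).symm)
      refine Eq.trans ?_ (congrArg (π γ').symm (coe_toImage_symm (π γ) (image (π γ') a) x')).symm
      rw [hx, h]
      rfl
    · exact DFunLike.congr_fun h (y : V)

theorem exists_action_bottInd {l : V ≃L[ℝ] W} (hl : AsymptoticallyUnitary l) {Γ : Type*} [Group Γ]
    (π : Γ →* (V ≃ₗᵢ[ℝ] V)) (hπ : ∀ γ x, cliffordOp l (π γ x) = π γ (cliffordOp l x)) :
    ∃ ρ : Γ →* (SCl l ≃⋆ₐ[ℂ] SCl l), (∀ γ, Continuous (ρ γ)) ∧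
      ∀ γ a (x : SC a.1 (bar l a).1), ρ γ (toLim (bottInd l) a x) =
        toLim (bottInd l) (image (π γ) a) (actInd l (π γ) (hπ γ) a x) := by
  refine (asymptoticSystem_bottInd hl).exists_action (fun γ => image_mono (π γ))
    (fun γ => tendsto_image (π γ)) (fun γ a => actInd l (π γ) (hπ γ) a)
    (fun γ a b h v => actInd_bottInd l (π γ) (hπ γ) h v) (fun a v => ?_) (fun γ γ' a v => ?_)
  · have h : (π 1 : V ≃ₗᵢ[ℝ] V) = 1 := map_one π
    conv_rhs => rw [← push_id (ψ := LinearEquiv.refl ℝ a.1) (j := LinearIsometry.id)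
      (fun _ => rfl) (fun _ => rfl) v]
    refine toLim_bottInd_push_congr l ?_ (fun x x' hx => Subtype.ext ?_) (fun y => ?_) v
    · exact Subtype.ext (Submodule.ext fun w => by rw [mem_image, h]; rfl)
    · refine (coe_toImage_symm (π 1) a x).trans ?_
      rw [hx, h]
      rfl
    · exact DFunLike.congr_fun h (y : V)
  · have h : (π (γ * γ') : V ≃ₗᵢ[ℝ] V) = π γ * π γ' := map_mul π γ γ'
    have h2 := push_push (toImage (π γ') a).symm.toLinearEquiv (toImageBar l (π γ') (hπ γ') a)
      (toImage (π γ) (image (π γ') a)).symm.toLinearEquiv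
      (toImageBar l (π γ) (hπ γ) (image (π γ') a)) v
    refine Eq.trans ?_ (congrArg (toLim (A := fun a : FinSub V => SC a.1 (bar l a).1) (bottInd l)
      (image (π γ) (image (π γ') a))) h2.symm)
    refine toLim_bottInd_push_congr l ?_ (fun x x' hx => Subtype.ext ?_) (fun y => ?_) v
    · exact Subtype.ext (Submodule.ext fun w => by rw [mem_image, mem_image, mem_image, h]; rfl)
    · refine (coe_toImage_symm (π (γ * γ')) a x).trans
        (Eq.trans ?_ (coe_toImage_symm (π γ') a _).symm)
      refine Eq.trans ?_ (congrArg (π γ').symm (coe_toImage_symm (π γ) (image (π γ') a) x')).symm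
      rw [hx, h]
      rfl
    · exact DFunLike.congr_fun h (y : V)

theorem exists_starAlgEquiv_SCl_SCH {l : V ≃L[ℝ] W} (hl : AsymptoticallyUnitary l) :
    ∃ Φ : SCl l ≃⋆ₐ[ℂ] SCH V, ∀ (t : FinSub V → FinSub V)
      (y : ∀ a, SC (t a).1 (bar l (t a)).1) (x : SCl l), Tendsto t atTop atTop →
      Tendsto (fun a => toLim (bottInd l) (t a) (y a)) atTop (𝓝 x) →
      Tendsto (fun a => toLim bottStd (t a) (stageMap l (t a) (y a))) atTop (𝓝 (Φ x)) :=
  AsymptoticSystem.exists_starAlgEquiv (A := fun a : FinSub V => SC a.1 (bar l a).1)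
    (B := fun a : FinSub V => SC a.1 a.1) (α := bottInd l) (β := bottStd)
    (asymptoticSystem_bottInd hl) (asymptoticSystem_bottStd V) (stageMap l) (stageInv l)
    stageInv_stageMap stageMap_stageInv
    (fun a F _ hδ => exists_norm_bottStd_stageMap_sub_le hl a F hδ)
    (fun a F _ hδ => exists_norm_bottInd_stageInv_sub_le hl a F hδ)

/-- Every element has an approximating net, and limits in the target are unique. -/
lemma IsCanonical.eq {l : V ≃L[ℝ] W} {Φ Ψ : SCl l ≃⋆ₐ[ℂ] SCH V} (hΦ : IsCanonical l Φ)
    (hΨ : IsCanonical l Ψ) : Ψ = Φ := by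
  refine StarAlgEquiv.ext fun x => ?_
  obtain ⟨y, hy⟩ := (hΦ x).1
  exact tendsto_nhds_unique ((hΨ x).2 y hy) ((hΦ x).2 y hy)

end Canonical

end

end HilbertClifford

/-! ### The main theorem -/

set_option maxHeartbeats 1000000 in
theorem mainTheorem3 {H' H : Type*}
    [NormedAddCommGroup H'] [InnerProductSpace ℝ H'] [CompleteSpace H']
    [NormedAddCommGroup H] [InnerProductSpace ℝ H] [CompleteSpace H]
    (l : H' ≃L[ℝ] H) (hl : AsymptoticallyUnitary l) :
    ∃ Φ : SCl l ≃⋆ₐ[ℂ] SCH H',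
      IsCanonical l Φ ∧ (∀ Ψ : SCl l ≃⋆ₐ[ℂ] SCH H', IsCanonical l Ψ → Ψ = Φ) ∧
      ∀ (Γ : Type*) [Group Γ] (π' : Γ →* (H' ≃ₗᵢ[ℝ] H')) (π : Γ →* (H ≃ₗᵢ[ℝ] H))
        (hπ : ∀ γ x, l (π' γ x) = π γ (l x)),
        ∃ (ρl : Γ →* (SCl l ≃⋆ₐ[ℂ] SCl l)) (ρ : Γ →* (SCH H' ≃⋆ₐ[ℂ] SCH H')),
          (∀ γ a (x : SC a.1 (FinSub.bar l a).1),
            ρl γ (toLim (bottInd l) a x) =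
              toLim (bottInd l) (FinSub.image (π' γ) a)
                (actInd l (π' γ) (cliffordOp_equivariant l (π' γ) (π γ) (hπ γ)) a x)) ∧
          (∀ γ a (x : SC a.1 a.1),
            ρ γ (toLim bottStd a x) =
              toLim bottStd (FinSub.image (π' γ) a) (actStd (π' γ) a x)) ∧
          ∀ γ x, Φ (ρl γ x) = ρ γ (Φ x) := by
  have hα := asymptoticSystem_bottInd hl
  obtain ⟨Φ, hΦ⟩ := exists_starAlgEquiv_SCl_SCH hl
  have hc : IsCanonical l Φ := fun x => ⟨hα.exists_net x, fun y hy => hΦ id y x tendsto_id hy⟩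
  refine ⟨Φ, hc, fun Ψ hΨ => hc.eq hΨ, fun Γ _ π' π hπ => ?_⟩
  obtain ⟨ρl, hρlc, hρl⟩ := exists_action_bottInd hl π'
    fun γ => cliffordOp_equivariant l (π' γ) (π γ) (hπ γ)
  obtain ⟨ρ, hρc, hρ⟩ := exists_action_bottStd π'
  refine ⟨ρl, ρ, hρl, hρ, fun γ x => ?_⟩
  obtain ⟨y, hy⟩ := hα.exists_net x
  -- If `y` approximates `x`, then the translated net approximates `γ x` at the stages `γ(E_a)`,
  -- which are cofinal. The formula for `Φ` along this reindexing and the stagewise equivariance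
  -- identify both sides as limits of one net.
  have h1 := (((hρlc γ).tendsto x).comp hy).congr fun a => hρl γ a (y a)
  have h2 := ((hρc γ).tendsto (Φ x)).comp (hΦ id y x tendsto_id hy)
  refine tendsto_nhds_unique ((hΦ _ _ _ (FinSub.tendsto_image (π' γ)) h1).congr fun a => ?_) h2
  rw [stageMap_actInd]
  exact (hρ γ a _).symm
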